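/- Let $p$ be a prime, $k$ an algebraically closed field of characteristic $p$, and $r\ge 1$ an integer. **The algebras.** Let $X,Y,H$ be the standard basis of $\mathfrak{sl}_2(\mathbb C)$, let $\mathcal U_{\mathbb Z}$ be the subring of the universal enveloping algebra generated by all $X^{(m)}=X^m/m!$ and $Y^{(m)}=Y^m/m!$ ($m\ge 0$), and let $\mathcal U=\mathcal U_{\mathbb Z}\otimes_{\mathbb Z}k$. Elements of $\mathcal U_{\mathbb Z}$, in particular $\binom{H+c}{m}=\frac{(H+c)(H+c-1)\cdots(H+c-m+1)}{m!}$ ($c\in\mathbb Z$, $m\ge 0$), are identified with their images in $\mathcal U$. The elements $Y^{(m)}\binom Hn X^{(m')}$ form a $k$-basis of $\mathcal U$; let $\mathrm{Fr}':\mathcal U\to\mathcal U$ be the $k$-linear map with $Y^{(m)}\binom Hn X^{(m')}\mapsto Y^{(mp)}\binom H{np}X^{(m'p)}$. Let $\mathcal U_r$ be the subalgebra generated by $X^{(p^i)},Y^{(p^i)}$ with $0\le i\le r-1$, let $\mathcal A$ be the subalgebra generated by all $\binom H{p^i}$ and $Y^{(p^i)}X^{(p^i)}$ with $i\ge 0$,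 and put $\mathcal A_r=\mathcal A\cap\mathcal U_r$. For $a\in\mathbb Z$ put $\mu_a=\binom{H-a-1}{p-1}$. **The case of one pair.** If $p$ is odd, let $\mathcal P=\{0,\dots,p-1\}\times\{0,\dots,(p-1)/2\}$ and define polynomials over $\mathbb F_p$ by $\varphi_{a,m}(x)=\prod_{i=0}^{m-1}(x-i(i+a+1))$, $\psi(x)=\prod_{i\in\mathbb F_p}(x-i^2)$, $\psi^{(1)}_j(x)=\psi(x)/(x-j^2)$, $\psi^{(0)}_0(x)=\prod_{i\in\mathbb F_p^\times}(x-i^2)$, and $\psi^{(0)}_j(x)=2x(x+j^2)\prod_{i\in\mathbb F_p^\times\setminus\{j,-j\}}(x-i^2)$ for $j\ne 0$. For $\varepsilon\in\{0,1\}$ and $(a,j)\in\mathcal P$ put $$B^{(\varepsilon)}(a,j)=\psi^{(\varepsilon)}_j\Big(\mu_aYX+\big(\tfrac{a+1}2\big)^2\Big)\cdot\mu_a ,$$ and let $n^{(\varepsilon)}(a,j)$ be the largest $n\ge 0$ such that $\varphi_{a,n}(x)$ divides $\psi^{(\varepsilon)}_j\big(x+(\tfrac{a+1}2)^2\big)$.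 If $p=2$, let $\mathcal P=\{(0,\tfrac12),(1,0),(1,1)\}$ and put $B^{(0)}(0,\tfrac12)=\mu_0$, $B^{(1)}(0,\tfrac12)=\mu_0YX$, $B^{(\varepsilon)}(1,0)=\mu_1YX$, $B^{(\varepsilon)}(1,1)=\mu_1YX+\mu_1$ for $\varepsilon\in\{0,1\}$, and $n^{(\varepsilon)}(0,\tfrac12)=\varepsilon$, $n^{(\varepsilon)}(1,0)=1$, $n^{(\varepsilon)}(1,1)=0$. For every $p$ write $B^{(\varepsilon)}(a,j)=\mu_a\sum_{m=n^{(\varepsilon)}(a,j)}^{p-1}c^{(\varepsilon)}_mY^mX^m$ with the (uniquely determined) $c^{(\varepsilon)}_m\in\mathbb F_p$. **The case of $r$ pairs.** For $(a,j)\in\mathcal P$ put $s(a,j)=1$ if $p=2$, and for odd $p$ put $s(a,j)=(p-a+1)/2$ if $a$ is even and $s(a,j)=(p-a)/2$ if $a$ is odd. For $z\in\mathcal U$ put $$Z^{(\varepsilon)}\big(z;(a,j)\big)=\mu_a\sum_{m=n^{(\varepsilon)}(a,j)}^{p-1}c^{(\varepsilon)}_m\,Y^mX^{m-s(a,j)}\,\mathrm{Fr}'(z)\,X^{s(a,j)}$$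 if either $a$ is even and $(p-a+1)/2\le j\le(p-1)/2$, or $a$ is odd and $0\le j\le(a-1)/2$, and $Z^{(\varepsilon)}(z;(a,j))=\mathrm{Fr}'(z)B^{(\varepsilon)}(a,j)$ otherwise. For $\boldsymbol\varepsilon=(\varepsilon_0,\dots,\varepsilon_{r-1})\in\{0,1\}^r$ and $(\boldsymbol a,\boldsymbol j)=((a_i,j_i))_{i=0}^{r-1}\in\mathcal P^r$ define recursively $B^{(\boldsymbol\varepsilon)}(\boldsymbol a,\boldsymbol j)=B^{(\varepsilon_0)}(a_0,j_0)$ if $r=1$, and $$B^{(\boldsymbol\varepsilon)}(\boldsymbol a,\boldsymbol j)=Z^{(\varepsilon_0)}\Big(B^{(\varepsilon_1,\dots,\varepsilon_{r-1})}\big((a_1,\dots,a_{r-1}),(j_1,\dots,j_{r-1})\big);(a_0,j_0)\Big)$$ if $r\ge 2$. Put $E(\boldsymbol a,\boldsymbol j)=B^{(0,\dots,0)}(\boldsymbol a,\boldsymbol j)$. Call an index $i$ *free* if $j_i\ne 0$ (for $p$ odd), respectively $a_i\ne 1$ (for $p=2$); let $w$ be the number of free indices, and let $\mathcal X_r(\boldsymbol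 a,\boldsymbol j)$ be the set of all $\boldsymbol\varepsilon\in\{0,1\}^r$ with $\varepsilon_i=0$ for every non-free $i$. Order $\{0,1\}^r$ componentwise. **Theorem.** Let $(\boldsymbol a,\boldsymbol j)\in\mathcal P^r$. For every $\boldsymbol\varepsilon\in\mathcal X_r(\boldsymbol a,\boldsymbol j)$, the elements $B^{(\boldsymbol\theta)}(\boldsymbol a,\boldsymbol j)$ with $\boldsymbol\theta\in\mathcal X_r(\boldsymbol a,\boldsymbol j)$ and $\boldsymbol\theta\ge\boldsymbol\varepsilon$ form a $k$-basis of the $\mathcal A_r$-module $\mathcal A_r\cdot B^{(\boldsymbol\varepsilon)}(\boldsymbol a,\boldsymbol j)$. Consequently $\mathcal A_r\cdot E(\boldsymbol a,\boldsymbol j)$ has $k$-dimension $2^w$, with basis all $B^{(\boldsymbol\theta)}(\boldsymbol a,\boldsymbol j)$ with $\boldsymbol\theta\in\mathcal X_r(\boldsymbol a,\boldsymbol j)$. -/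

import Mathlib

open scoped TensorProduct

namespace SL2Hyper
noncomputable section

/-- The divided power `z ^ m / m!`. -/
def divPow {A : Type*} [Ring A] [Algebra ℂ A] (z : A) (m : ℕ) : A :=
  (m.factorial : ℂ)⁻¹ • z ^ m

/-- The binomial coefficient `z (z - 1) ⋯ (z - m + 1) / m!`. -/
def binom {A : Type*} [Ring A] [Algebra ℂ A] (z : A) (m : ℕ) : A :=
  (m.factorial : ℂ)⁻¹ • Polynomial.aeval z (descPochhammer ℂ m)

section Integrality

variable {A : Type*} [Ring A] [Algebra ℂ A]

theorem smul_cancel_succ (m : ℕ) {u v : A} (h : ((m : ℂ) + 1) • u = ((m : ℂ) + 1) • v) :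
    u = v := by
  have h1 : ((m : ℂ) + 1) ≠ 0 := by exact_mod_cast Nat.succ_ne_zero m
  exact smul_right_injective A h1 h

theorem succ_smul_divPow (z : A) (m : ℕ) :
    ((m : ℂ) + 1) • divPow z (m + 1) = z * divPow z m := by
  have h1 : ((m : ℂ) + 1) ≠ 0 := by exact_mod_cast Nat.succ_ne_zero m
  have h2 : (m.factorial : ℂ) ≠ 0 := by exact_mod_cast m.factorial_ne_zero
  rw [divPow, divPow, smul_smul, mul_smul_comm, ← pow_succ']
  congr 1
  rw [Nat.factorial_succ]; push_cast; field_simp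

theorem divPow_zero (z : A) : divPow z 0 = 1 := by simp [divPow]

theorem binom_zero (z : A) : binom z 0 = 1 := by simp [binom]

theorem succ_smul_binom (z : A) (m : ℕ) :
    ((m : ℂ) + 1) • binom z (m + 1) = (z - (m : A)) * binom z m := by
  have h1 : ((m : ℂ) + 1) ≠ 0 := by exact_mod_cast Nat.succ_ne_zero m
  have h2 : (m.factorial : ℂ) ≠ 0 := by exact_mod_cast m.factorial_ne_zero
  rw [binom, binom, smul_smul, mul_smul_comm, descPochhammer_succ_right,
    mul_comm (descPochhammer ℂ m), map_mul,
    map_sub, Polynomial.aeval_X, map_natCast]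
  congr 1
  rw [Nat.factorial_succ]; push_cast; field_simp

theorem aeval_binom (z : A) (q : Polynomial ℂ) (m : ℕ) :
    Polynomial.aeval z (binom q m) = binom (Polynomial.aeval z q) m := by
  rw [binom, binom, map_smul, ← Polynomial.aeval_algHom_apply]

/-- Pascal's rule. -/
theorem binom_add_one (z : A) (m : ℕ) :
    binom (z + 1) (m + 1) = binom z (m + 1) + binom z m := by
  have key : ∀ m : ℕ, binom ((Polynomial.X : Polynomial ℂ) + 1) (m + 1)
      = binom Polynomial.X (m + 1) + binom Polynomial.X m := by
    intro m
    induction m with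
    | zero =>
      apply smul_cancel_succ 0
      rw [smul_add, succ_smul_binom, succ_smul_binom]
      simp [binom_zero]
    | succ m ih =>
      apply smul_cancel_succ (m + 1)
      have h1 := succ_smul_binom (Polynomial.X : Polynomial ℂ) m
      rw [smul_add, succ_smul_binom, succ_smul_binom, ih]
      rw [Polynomial.smul_eq_C_mul] at h1 ⊢
      simp only [map_add, map_natCast, map_one, Nat.cast_add, Nat.cast_one] at h1 ⊢
      linear_combination -h1
  simpa [aeval_binom] using congrArg (Polynomial.aeval z) (key m)

variable {x y h : A}

theorem mul_binom_shift (hx : h * x = x * (h + 2)) (c : ℤ) (k : ℕ) :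
    x * binom (h + ((c + 2 : ℤ) : A)) k = binom (h + (c : A)) k * x := by
  have h0 : x * (h + ((c + 2 : ℤ) : A)) = (h + (c : A)) * x := by
    rw [add_mul, hx, ((Int.cast_commute c x).eq : (c : A) * x = x * c)]
    push_cast
    rw [mul_add, mul_add, mul_add]; abel
  have h1 : ∀ q : Polynomial ℂ, x * Polynomial.aeval (h + ((c + 2 : ℤ) : A)) q
      = Polynomial.aeval (h + (c : A)) q * x := by
    intro q
    induction q using Polynomial.induction_on' with
    | add p q hp hq => rw [map_add, map_add, mul_add, add_mul, hp, hq]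
    | monomial n a =>
      rw [Polynomial.aeval_monomial, Polynomial.aeval_monomial, ← mul_assoc,
        ← Algebra.commutes a x, mul_assoc, mul_assoc]
      congr 1
      exact (SemiconjBy.pow_right (show SemiconjBy x _ _ from h0) n)
  rw [binom, binom, mul_smul_comm, smul_mul_assoc, h1]

theorem mul_divPow (hy : h * y = y * (h - 2)) (j : ℕ) :
    h * divPow y j = divPow y j * (h - 2 * (j : A)) := by
  induction j with
  | zero => simp [divPow_zero]
  | succ j ih =>
    apply smul_cancel_succ j
    rw [← mul_smul_comm, ← smul_mul_assoc, succ_smul_divPow, ← mul_assoc, hy, mul_assoc, sub_mul,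
      ih, mul_assoc, ← (show Commute (2 : A) (divPow y j) from Nat.cast_commute 2 _).eq.symm]
    congr 1
    rw [← mul_sub]
    congr 1
    push_cast
    rw [mul_add, mul_one]; abel

theorem mul_divPow_succ (hy : h * y = y * (h - 2)) (hxy : x * y = y * x + h) (j : ℕ) :
    x * divPow y (j + 1) = divPow y (j + 1) * x + divPow y j * (h - (j : A)) := by
  induction j with
  | zero => simp [divPow, hxy]
  | succ j ih =>
    apply smul_cancel_succ (j + 1)
    have e : ∀ (n : ℕ) (u v : A), ((n : ℂ) + 1) • u * v = u * (((n : A) + 1) * v) := by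
      intro n u v
      rw [add_smul, one_smul, add_mul, add_mul, one_mul, Nat.cast_smul_eq_nsmul, nsmul_eq_mul,
        mul_add, (Nat.cast_commute n u).eq, mul_assoc]
    rw [← mul_smul_comm, smul_add, ← smul_mul_assoc, ← smul_mul_assoc, succ_smul_divPow,
      ← mul_assoc, hxy, add_mul, mul_assoc, ih, mul_divPow hy, mul_add, ← mul_assoc,
      ← mul_assoc y (divPow y j), ← succ_smul_divPow, ← succ_smul_divPow, add_assoc]
    congr 1
    rw [e, e, ← mul_add]
    congr 1
    have c : (j : A) * h = h * j := (Nat.cast_commute j h).eq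
    push_cast
    noncomm_ring

/-- The commutation formula for divided powers. -/
theorem divPow_mul_divPow (hx : h * x = x * (h + 2)) (hy : h * y = y * (h - 2))
    (hxy : x * y = y * x + h) (m n : ℕ) (hmn : m ≤ n) :
    divPow x m * divPow y n = ∑ k ∈ Finset.range (m + 1),
      divPow y (n - k) * binom (h + ((2 * k - m - n : ℤ) : A)) k * divPow x (m - k) := by
  induction m with
  | zero => simp [divPow_zero, binom_zero]
  | succ m ih =>
    apply smul_cancel_succ m
    rw [← smul_mul_assoc, succ_smul_divPow, mul_assoc, ih (by omega), Finset.mul_sum,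
      Finset.smul_sum]
    set F : ℕ → A := fun k => divPow y (n - k) *
      binom (h + ((2 * k - m - n - 2 : ℤ) : A)) k *
      ((((m : ℂ) + 1) - k) • divPow x (m + 1 - k)) with hF
    set G : ℕ → A := fun k => divPow y (n - (k + 1)) * (h - ((n - (k + 1) : ℕ) : A)) *
      binom (h + ((2 * k - m - n : ℤ) : A)) k * divPow x (m - k) with hG
    have h1 : ∀ k ∈ Finset.range (m + 1), x * (divPow y (n - k) *
        binom (h + ((2 * k - m - n : ℤ) : A)) k * divPow x (m - k)) = F k + G k := by
      intro k hk
      have hk' : k ≤ m := by simpa [Nat.lt_succ_iff] using hk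
      have e : n - k = (n - (k + 1)) + 1 := by omega
      have e2 := mul_binom_shift hx (2 * k - m - n - 2) k
      have e3 : (((m : ℂ) + 1) - k) • divPow x (m + 1 - k) = x * divPow x (m - k) := by
        rw [← succ_smul_divPow, show m + 1 - k = m - k + 1 by omega, Nat.cast_sub hk']
        congr 1; ring
      rw [sub_add_cancel] at e2
      rw [hF, hG]
      simp only
      rw [e3, ← mul_assoc, ← mul_assoc, e, mul_divPow_succ hy hxy, add_mul, add_mul,
        mul_assoc (divPow y _) x, e2]
      simp only [mul_assoc]
    have h2 : ∑ k ∈ Finset.range (m + 1), F k = ∑ k ∈ Finset.range (m + 1), F (k + 1) + F 0 := by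
      rw [← Finset.sum_range_succ', Finset.sum_range_succ F (m + 1)]
      simp [hF]
    rw [Finset.sum_congr rfl h1, Finset.sum_add_distrib, h2, add_right_comm,
      ← Finset.sum_add_distrib, Finset.sum_range_succ' _ (m + 1)]
    refine congrArg₂ (· + ·) (Finset.sum_congr rfl fun k hk => ?_) ?_
    · have hk' : k ≤ m := by simpa [Nat.lt_succ_iff] using hk
      rw [hF, hG]
      simp only
      set t : A := h + ((2 * k - m - n : ℤ) : A) with ht
      have a1 : h + ((2 * ((k + 1 : ℕ) : ℤ) - m - n - 2 : ℤ) : A) = t := by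
        rw [ht]; congr 2; push_cast; ring
      have a2 : h + ((2 * ((k + 1 : ℕ) : ℤ) - ((m + 1 : ℕ) : ℤ) - n : ℤ) : A) = t + 1 := by
        rw [ht, add_assoc]; congr 1; push_cast; noncomm_ring
      have a3 : h - ((n - (k + 1) : ℕ) : A) = (t - (k : A)) + ((m : A) + 1) := by
        rw [ht, Nat.cast_sub (by omega)]; push_cast; noncomm_ring
      have a4 : ∀ u : A, ((m : A) + 1) * u = ((m : ℂ) + 1) • u := by
        intro u
        rw [add_smul, one_smul, add_mul, one_mul, Nat.cast_smul_eq_nsmul, nsmul_eq_mul]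
      rw [a1, a2, a3, Nat.add_sub_add_right, mul_smul_comm, ← smul_mul_assoc, ← mul_smul_comm,
        mul_assoc (divPow y _) (_ + _), add_mul (t - (k : A)), ← succ_smul_binom, a4, ← add_mul,
        ← mul_add, ← smul_mul_assoc, ← mul_smul_comm, binom_add_one, ← add_assoc, ← add_smul,
        smul_add]
      rw [show (m : ℂ) + 1 - ((k + 1 : ℕ) : ℂ) + ((k : ℂ) + 1) = (m : ℂ) + 1 by push_cast; ring]
    · simp only [hF, Nat.cast_zero, sub_zero, Nat.sub_zero, mul_smul_comm, binom_zero]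

/-- A subring containing all divided powers of `x` and `y` contains the binomials
`(h + c) (h + c - 1) ⋯ (h + c - k + 1) / k!` with `c ∈ ℤ`. -/
theorem binom_mem (hx : h * x = x * (h + 2)) (hy : h * y = y * (h - 2))
    (hxy : x * y = y * x + h) (S : Subalgebra ℤ A) (hSx : ∀ m, divPow x m ∈ S)
    (hSy : ∀ m, divPow y m ∈ S) (k : ℕ) (c : ℤ) : binom (h + (c : A)) k ∈ S := by
  induction k using Nat.strong_induction_on generalizing c with
  | _ k ih =>
    have h0 : binom h k ∈ S := by
      have e := divPow_mul_divPow hx hy hxy k k le_rfl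
      rw [Finset.sum_range_succ, Nat.sub_self, divPow_zero, divPow_zero, one_mul, mul_one] at e
      have z : h + ((2 * k - k - k : ℤ) : A) = h := by
        rw [show (2 * k - k - k : ℤ) = 0 by ring]; simp
      rw [z] at e
      rw [← sub_eq_iff_eq_add'.mpr e]
      refine S.sub_mem (S.mul_mem (hSx _) (hSy _)) (S.sum_mem fun i hi => ?_)
      exact S.mul_mem (S.mul_mem (hSy _) (ih i (Finset.mem_range.1 hi) _)) (hSx _)
    cases k with
    | zero => rw [binom_zero]; exact S.one_mem
    | succ k =>
      induction c with
      | zero => simpa using h0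
      | succ i hi =>
        push_cast at hi ⊢
        rw [← add_assoc, binom_add_one]
        refine S.add_mem hi ?_
        simpa using ih k (Nat.lt_succ_self k) i
      | pred i hi =>
        have e := binom_add_one (h + ((-(i : ℤ) - 1 : ℤ) : A)) k
        have z : h + ((-(i : ℤ) - 1 : ℤ) : A) + 1 = h + ((-(i : ℤ) : ℤ) : A) := by
          push_cast; abel
        rw [z] at e
        rw [← sub_eq_iff_eq_add.mpr e]
        exact S.sub_mem hi (ih k (Nat.lt_succ_self k) _)

end Integrality

/-! The complex enveloping algebra and its integral form -/

/-- The universal enveloping algebra of `sl₂(ℂ)`. -/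
abbrev UC : Type := UniversalEnvelopingAlgebra ℂ (LieAlgebra.SpecialLinear.sl (Fin 2) ℂ)

def slX : LieAlgebra.SpecialLinear.sl (Fin 2) ℂ :=
  ⟨!![0, 1; 0, 0], by simp [LieAlgebra.SpecialLinear.sl]⟩

def slY : LieAlgebra.SpecialLinear.sl (Fin 2) ℂ :=
  ⟨!![0, 0; 1, 0], by simp [LieAlgebra.SpecialLinear.sl]⟩

def slH : LieAlgebra.SpecialLinear.sl (Fin 2) ℂ :=
  ⟨!![1, 0; 0, -1], by simp [LieAlgebra.SpecialLinear.sl]⟩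

def ucX : UC := UniversalEnvelopingAlgebra.ι ℂ slX

def ucY : UC := UniversalEnvelopingAlgebra.ι ℂ slY

def ucH : UC := UniversalEnvelopingAlgebra.ι ℂ slH

/-- The subring of `UC` generated by the divided powers of `X` and `Y`. -/
def UZ : Subalgebra ℤ UC :=
  Algebra.adjoin ℤ (Set.range (divPow ucX) ∪ Set.range (divPow ucY))

section Relations

attribute [local instance] LieRing.ofAssociativeRing

theorem ucH_mul_ucX : ucH * ucX = ucX * (ucH + 2) := by
  have h : ⁅slH, slX⁆ = (2 : ℂ) • slX := by
    apply Subtype.ext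
    ext i j
    fin_cases i <;> fin_cases j <;> (simp [slH, slX, Ring.lie_def]; try norm_num)
  have e : UniversalEnvelopingAlgebra.ι ℂ ⁅slH, slX⁆ = ucH * ucX - ucX * ucH :=
    LieHom.map_lie _ _ _
  rw [h, map_smul] at e
  change (2 : ℂ) • ucX = _ at e
  rw [sub_eq_iff_eq_add'.mp e.symm, mul_add, mul_two, two_smul]

theorem ucH_mul_ucY : ucH * ucY = ucY * (ucH - 2) := by
  have h : ⁅slH, slY⁆ = (-2 : ℂ) • slY := by
    apply Subtype.ext
    ext i j
    fin_cases i <;> fin_cases j <;> (simp [slH, slY, Ring.lie_def]; try norm_num)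
  have e : UniversalEnvelopingAlgebra.ι ℂ ⁅slH, slY⁆ = ucH * ucY - ucY * ucH :=
    LieHom.map_lie _ _ _
  rw [h, map_smul] at e
  change (-2 : ℂ) • ucY = _ at e
  rw [sub_eq_iff_eq_add'.mp e.symm, mul_sub, mul_two, neg_smul, two_smul, sub_eq_add_neg]

theorem ucX_mul_ucY : ucX * ucY = ucY * ucX + ucH := by
  have h : ⁅slX, slY⁆ = slH := by
    apply Subtype.ext
    ext i j
    fin_cases i <;> fin_cases j <;> simp [slH, slX, slY, Ring.lie_def]
  have e : UniversalEnvelopingAlgebra.ι ℂ ⁅slX, slY⁆ = ucX * ucY - ucY * ucX :=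
    LieHom.map_lie _ _ _
  rw [h] at e
  change ucH = _ at e
  exact sub_eq_iff_eq_add'.mp e.symm

end Relations

theorem divPow_ucX_mem (m : ℕ) : divPow ucX m ∈ UZ :=
  Algebra.subset_adjoin (Or.inl ⟨m, rfl⟩)

theorem divPow_ucY_mem (m : ℕ) : divPow ucY m ∈ UZ :=
  Algebra.subset_adjoin (Or.inr ⟨m, rfl⟩)

theorem binom_ucH_mem (c : ℤ) (m : ℕ) : binom (ucH + (c : UC)) m ∈ UZ :=
  binom_mem ucH_mul_ucX ucH_mul_ucY ucX_mul_ucY UZ divPow_ucX_mem divPow_ucY_mem m c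

/-! The hyperalgebra over `k` and its subalgebras -/

/-- The hyperalgebra of `SL₂` over `k`. -/
abbrev U (k : Type*) [Field k] : Type _ := k ⊗[ℤ] UZ

section Hyperalgebra

variable (k : Type*) [Field k]

/-- The divided power `X^(m)` in the hyperalgebra. -/
def dX (m : ℕ) : U k := 1 ⊗ₜ[ℤ] (⟨divPow ucX m, divPow_ucX_mem m⟩ : UZ)

/-- The divided power `Y^(m)` in the hyperalgebra. -/
def dY (m : ℕ) : U k := 1 ⊗ₜ[ℤ] (⟨divPow ucY m, divPow_ucY_mem m⟩ : UZ)

/-- The binomial element `(H + c choose m)` in the hyperalgebra. -/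
def bH (c : ℤ) (m : ℕ) : U k := 1 ⊗ₜ[ℤ] (⟨binom (ucH + (c : UC)) m, binom_ucH_mem c m⟩ : UZ)

/-- The standard basis element `Y^(m) (H choose n) X^(m')` of the hyperalgebra. -/
def pbw (m n m' : ℕ) : U k := dY k m * bH k 0 n * dX k m'

/-- The `k`-linear map `Fr'`: it is determined by its values on the basis of the elements
`Y^(m) (H choose n) X^(m')`. -/
def Fr' (p : ℕ) : U k →ₗ[k] U k :=
  Classical.epsilon fun f : U k →ₗ[k] U k =>
    ∀ m n m' : ℕ, f (pbw k m n m') = pbw k (m * p) (n * p) (m' * p)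

/-- The subalgebra `U_r`. -/
def Ur (p r : ℕ) : Subalgebra k (U k) :=
  Algebra.adjoin k {u | ∃ i < r, u = dX k (p ^ i) ∨ u = dY k (p ^ i)}

/-- The subalgebra `U⁰`. -/
def U0 (p : ℕ) : Subalgebra k (U k) :=
  Algebra.adjoin k {u | ∃ i : ℕ, u = bH k 0 (p ^ i)}

/-- The subalgebra `A`. -/
def subA (p : ℕ) : Subalgebra k (U k) :=
  Algebra.adjoin k (U0 k p ∪ {u | ∃ i : ℕ, u = dY k (p ^ i) * dX k (p ^ i)})

/-- The subalgebra `A_r = A ∩ U_r`. -/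
def Ar (p r : ℕ) : Subalgebra k (U k) := subA k p ⊓ Ur k p r

/-- The `A_r`-submodule `A_r · b` of the hyperalgebra generated by `b`, as a `k`-space. -/
def ArMod (p r : ℕ) (b : U k) : Submodule k (U k) :=
  (Submodule.span (Ar k p r) {b}).restrictScalars k

/-- The element `μ_a`. -/
def mu (p : ℕ) (a : ℤ) : U k := bH k (-a - 1) (p - 1)

end Hyperalgebra

/-! The index set, the polynomials and the integers attached to it -/

/-- The set `𝒫` of pairs `(a, j)`. -/
def setP (p : ℕ) : Set (ℕ × ℚ) :=
  if p = 2 then {(0, 1 / 2), (1, 0), (1, 1)}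
  else {q | q.1 < p ∧ ∃ s : ℕ, s ≤ (p - 1) / 2 ∧ q.2 = s}

section Polynomials

variable (p : ℕ) [Fact p.Prime]

open Polynomial in
/-- The polynomial `φ_{a,m}(x) = ∏_{i < m} (x - i (i + a + 1))`. -/
def phi (a : ℤ) (m : ℕ) : (ZMod p)[X] :=
  ∏ i ∈ Finset.range m, (X - C ((i : ZMod p) * ((i : ZMod p) + (a : ZMod p) + 1)))

open Polynomial in
/-- The polynomial `ψ(x) = ∏_{i ∈ 𝔽_p} (x - i²)`. -/
def psi : (ZMod p)[X] := ∏ i : ZMod p, (X - C (i ^ 2))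

open Polynomial in
/-- The polynomial `ψ_j^(ε)(x)`, for odd `p`; the division is exact. -/
def psiE (ε : Fin 2) (j : ZMod p) : (ZMod p)[X] :=
  if ε = 1 then psi p / (X - C (j ^ 2))
  else if j = 0 then ∏ i ∈ (Finset.univ : Finset (ZMod p)) \ {0}, (X - C (i ^ 2))
  else 2 * X * (X + C (j ^ 2)) *
    ∏ i ∈ (Finset.univ : Finset (ZMod p)) \ {0, j, -j}, (X - C (i ^ 2))

open Polynomial in
/-- The polynomial `ψ_j^(ε)(x + ((a + 1) / 2)²)`, for odd `p`. -/
def psiShift (ε : Fin 2) (q : ℕ × ℚ) : (ZMod p)[X] :=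
  (psiE p ε (q.2 : ZMod p)).comp (X + C ((((q.1 : ZMod p) + 1) / 2) ^ 2))

/-- The integer `n^(ε)(a, j)`; for odd `p`, the largest `n` such that `φ_{a,n}(x)` divides
`ψ_j^(ε)(x + ((a + 1) / 2)²)`. -/
def nE (ε : Fin 2) (q : ℕ × ℚ) : ℕ :=
  if p = 2 then
    if q.1 = 0 then (if ε = 0 then 0 else 1)
    else if q.2 = 0 then 1 else 0
  else sSup {n : ℕ | phi p q.1 n ∣ psiShift p ε q}

/-- The pairs `(a, j)` with `a` even and `(p - a + 1) / 2 ≤ j ≤ (p - 1) / 2` (type A), or with `a` odd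
and `0 ≤ j ≤ (a - 1) / 2` (type C). The other pairs of `𝒫` are those of types B and D. -/
def condAC (q : ℕ × ℚ) : Prop :=
  (Even q.1 ∧ ((p : ℚ) - q.1 + 1) / 2 ≤ q.2 ∧ q.2 ≤ ((p : ℚ) - 1) / 2) ∨
    (Odd q.1 ∧ 0 ≤ q.2 ∧ q.2 ≤ ((q.1 : ℚ) - 1) / 2)

/-- The integer `s(a, j)`. -/
def sInt (q : ℕ × ℚ) : ℕ :=
  if p = 2 then 1 else if Even q.1 then (p - q.1 + 1) / 2 else (p - q.1) / 2

end Polynomials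

/-! The elements `B^(ε)(a, j)` -/

section Elements

variable (k : Type*) [Field k] (p : ℕ) [Fact p.Prime] [CharP k p]

/-- The element `B^(ε)(a, j)` for a single pair `(a, j)`. -/
def B₁ (ε : Fin 2) (q : ℕ × ℚ) : U k :=
  if p = 2 then
    if q.1 = 0 then
      if ε = 0 then mu k p 0 else mu k p 0 * (dY k 1 * dX k 1)
    else if q.2 = 0 then mu k p 1 * (dY k 1 * dX k 1)
    else mu k p 1 * (dY k 1 * dX k 1) + mu k p 1
  else
    Polynomial.aeval
      (mu k p q.1 * (dY k 1 * dX k 1) + algebraMap k (U k) ((((q.1 : k) + 1) / 2) ^ 2))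
      ((psiE p ε (q.2 : ZMod p)).map (ZMod.castHom (dvd_refl p) k)) * mu k p q.1

/-- The coefficients `c_m ∈ 𝔽_p`, for `n^(ε)(a, j) ≤ m ≤ p - 1`, in the expression
`B^(ε)(a, j) = μ_a ∑ c_m Y^m X^m`. -/
def coeffB (ε : Fin 2) (q : ℕ × ℚ) : ℕ → ZMod p :=
  Classical.epsilon fun c : ℕ → ZMod p =>
    B₁ k p ε q = mu k p q.1 * ∑ m ∈ Finset.Icc (nE p ε q) (p - 1),
      ZMod.castHom (dvd_refl p) k (c m) • (dY k 1 ^ m * dX k 1 ^ m)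

open Classical in
/-- The element `Z^(ε)(z; (a, j))`. For pairs of type A or C one has `s(a, j) ≤ n^(ε)(a, j)`, so that the
exponents `m - s(a, j)` are genuine differences. -/
def Z (ε : Fin 2) (z : U k) (q : ℕ × ℚ) : U k :=
  if condAC p q then
    mu k p q.1 * ∑ m ∈ Finset.Icc (nE p ε q) (p - 1),
      ZMod.castHom (dvd_refl p) k (coeffB k p ε q m) •
        (dY k 1 ^ m * dX k 1 ^ (m - sInt p q) * Fr' k p z * dX k 1 ^ sInt p q)
  else Fr' k p z * B₁ k p ε q

/-- The element `B^(ε)(a, j)` for an `r`-tuple of pairs; the value for `r = 0` is not used. -/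
def B : (r : ℕ) → (Fin r → Fin 2) → (Fin r → ℕ × ℚ) → U k
  | 0, _, _ => 1
  | 1, ε, q => B₁ k p (ε 0) (q 0)
  | r + 2, ε, q => Z k p (ε 0) (B (r + 1) (Fin.tail ε) (Fin.tail q)) (q 0)

/-- The element `E(a, j)`. -/
def E (r : ℕ) (q : Fin r → ℕ × ℚ) : U k := B k p r (fun _ => 0) q

end Elements

/-- The set `𝒳_r(a, j)`; the order on `Fin r → Fin 2` is the componentwise one. -/
def setX (p : ℕ) {r : ℕ} (q : Fin r → ℕ × ℚ) : Set (Fin r → Fin 2) :=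
  if p = 2 then {ε | ∀ i, (q i).1 = 1 → ε i = 0}
  else {ε | ∀ i, (q i).2 = 0 → ε i = 0}

/-- The number `w` of the indices `s` with `j_s ≠ 0` if `p` is odd, with `a_s ≠ 1` if `p = 2`. -/
def wt (p : ℕ) {r : ℕ} (q : Fin r → ℕ × ℚ) : ℕ :=
  if p = 2 then (Finset.univ.filter fun i => (q i).1 ≠ 1).card
  else (Finset.univ.filter fun i => (q i).2 ≠ 0).card

end

end SL2Hyper

/-!
Put `T(z) = Y^s Fr'(z) X^s` (`twist`). Every operator `z ↦ Z^(ε)(z; (a, j))` has the form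
`z ↦ T(z) g(YX) μ_a` (`stepMap`) for a polynomial `g` (`Z_eq_stepMap`, `Z_eq_stepMap_zero`), with `s = 0` for
the types B and D. On the weight `a` the element `YX` has minimal polynomial
`φ_{a,p} = ∏ (x - i (i + a + 1))`, and this polynomial splits as `φ_{a,s} Q m`, where `φ_{a,s}` comes from
`Y^s X^s`, the factor `m` is prime to `φ_{a,s}` and belongs to the pair, and `Q` is the rest (`IsBlock`).
If the index is free then `m = (x - c)²`, and `g` is `u Q` with `u(c) ≠ 0` for `ε = 0`, but `(x - c) Q` for
`ε = 1`. If it is not free then `m = x - c` and `g = Q`.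

Three facts carry the step from `r` to `r + 1` pairs.

* `A_r` is spanned by the `Y^(m) (H choose n) X^(m)` with `m, n < p ^ r` (`mem_Ar_iff`). By Lucas'
  congruence, such an element of `A_{r+1}` acts on `Y^s X^s g(YX) μ_a` as the twist of an element of `A_r`
  combined with a polynomial in `YX` (`pbw_mul_twist_one`).
* `Fr'` is not multiplicative, but `Fr'(z z') y = Fr'(z) Fr'(z') y` for all `y` of weight `b < p` which
  commute with the `X^(p M)` and are killed by the `Y^(m) X^(m)` with `p - b ≤ m < p` (`Fr'_mul_mul`): the
  unwanted terms in the commutation formula for `X^(p M) Y^(p N)` contain such a factor. The block of a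
  pair is made so that these conditions hold (`IsGood`). Hence
  `A_{r+1} T(z) g(YX) μ_a`, for a multiple `g` of `Q`, is the span of the `T(z') h(YX) g(YX) μ_a` with
  `z' ∈ A_r z` and `h` arbitrary (`IsBlock.ArMod_twist`), and only `h` modulo `m` matters.
* If `g` misses just one root of `φ_{a,p} / φ_{a,s}`, then `T(z) g(YX) μ_a` determines `z`, since its
  component with the largest powers of `Y` and `X` recovers all coefficients of `z` (`twist_injective`).

So a free index turns `A_r z` into a direct sum of two copies of it for `ε = 0`, of which the second is what
one gets for `ε = 1`; an index which is not free gives one copy (`IsStep`). Induction on `r`, starting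
from `A_0 = k`, gives the bases (`ArMod_B_eq_span`, `eq_zero_of_sum_smul_B`).

Computations in the hyperalgebra use integer-valued polynomials `P`: each gives an element `P(H)`
(`hpZ`, `hp`), which in characteristic `p` depends only on the values of `P` modulo `p` (`hp_congr`). The
basis of the `Y^(m) (H choose n) X^(m')` is obtained over `ℤ` (`basisZ`), linear independence coming from the
Verma modules. The linear maps `Ev` read off the coefficients as functions on `ℤ`.
-/

namespace SL2Hyper
noncomputable section

/-! ### Integer-valued polynomials -/

open Polynomial in
/-- The ring of complex polynomials taking integral values at all integers. -/
def intPoly : Subalgebra ℤ ℂ[X] where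
  carrier := {P | ∀ z : ℤ, ∃ w : ℤ, P.eval (z : ℂ) = w}
  mul_mem' {P Q} hP hQ z := by
    obtain ⟨u, hu⟩ := hP z
    obtain ⟨v, hv⟩ := hQ z
    exact ⟨u * v, by simp [hu, hv]⟩
  add_mem' {P Q} hP hQ z := by
    obtain ⟨u, hu⟩ := hP z
    obtain ⟨v, hv⟩ := hQ z
    exact ⟨u + v, by simp [hu, hv]⟩
  algebraMap_mem' c z := ⟨c, by simp⟩

/-- The value of an integer-valued polynomial at an integer. -/
def val (P : intPoly) (z : ℤ) : ℤ := (P.2 z).choose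

theorem cast_val (P : intPoly) (z : ℤ) : ((val P z : ℤ) : ℂ) = P.1.eval (z : ℂ) :=
  (P.2 z).choose_spec.symm

theorem val_eq_of_eval {P : intPoly} {z w : ℤ} (h : P.1.eval (z : ℂ) = w) : val P z = w := by
  have := cast_val P z
  rw [h] at this
  exact_mod_cast this

@[simp] theorem val_add (P Q : intPoly) (z : ℤ) : val (P + Q) z = val P z + val Q z :=
  val_eq_of_eval (by simp [cast_val])

@[simp] theorem val_mul (P Q : intPoly) (z : ℤ) : val (P * Q) z = val P z * val Q z :=
  val_eq_of_eval (by simp [cast_val])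

@[simp] theorem val_zero (z : ℤ) : val 0 z = 0 := val_eq_of_eval (by simp)

@[simp] theorem val_one (z : ℤ) : val 1 z = 1 := val_eq_of_eval (by simp)

@[simp] theorem val_zsmul (c : ℤ) (P : intPoly) (z : ℤ) : val (c • P) z = c * val P z :=
  val_eq_of_eval (by simp [cast_val])

@[simp] theorem val_sum {ι : Type*} (s : Finset ι) (P : ι → intPoly) (z : ℤ) :
    val (∑ i ∈ s, P i) z = ∑ i ∈ s, val (P i) z := by
  classical
  induction s using Finset.induction_on with
  | empty => simp
  | insert a s ha ih => rw [Finset.sum_insert ha, Finset.sum_insert ha, val_add, ih]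

theorem intPoly_ext {P Q : intPoly} (h : ∀ n : ℕ, val P n = val Q n) : P = Q := by
  apply Subtype.ext
  apply Polynomial.eq_of_infinite_eval_eq
  refine (Set.infinite_range_of_injective (f := fun n : ℕ => (n : ℂ)) Nat.cast_injective).mono ?_
  rintro _ ⟨n, rfl⟩
  have h1 := cast_val P n
  have h2 := cast_val Q n
  rw [h n] at h1
  simpa using h1.symm.trans h2

open Polynomial in
theorem eval_binom_X (c z : ℤ) (n : ℕ) :
    (binom ((X : ℂ[X]) + (c : ℂ[X])) n).eval (z : ℂ) = (Ring.choose (z + c) n : ℤ) := by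
  have h2 : (n.factorial : ℂ) ≠ 0 := by exact_mod_cast n.factorial_ne_zero
  have h := Ring.descPochhammer_eq_factorial_smul_choose (z + c) n
  rw [← Polynomial.eval_eq_smeval] at h
  have h3 := congrArg (Int.cast : ℤ → ℂ) h
  have h4 : (((descPochhammer ℤ n).eval (z + c) : ℤ) : ℂ)
      = (descPochhammer ℂ n).eval ((z + c : ℤ) : ℂ) := by
    rw [← descPochhammer_map (Int.castRingHom ℂ), Polynomial.eval_map]
    exact (Polynomial.eval₂_at_apply (Int.castRingHom ℂ) (z + c)).symm
  rw [h4] at h3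
  rw [binom, eval_smul, Polynomial.aeval_def, ← Polynomial.coe_evalRingHom, Polynomial.hom_eval₂]
  simp only [coe_evalRingHom, eval_add, eval_X, eval_intCast, smul_eq_mul]
  rw [show (evalRingHom (z : ℂ)).comp (algebraMap ℂ ℂ[X]) = RingHom.id ℂ by ext; simp,
    Polynomial.eval₂_id, ← Int.cast_add, h3]
  push_cast [nsmul_eq_mul]
  field_simp

/-- The integer-valued polynomial `binom(X + c, n)`. -/
def bin (c : ℤ) (n : ℕ) : intPoly :=
  ⟨binom (Polynomial.X + (c : Polynomial ℂ)) n, fun z => ⟨_, eval_binom_X c z n⟩⟩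

@[simp] theorem val_bin (c : ℤ) (n : ℕ) (z : ℤ) : val (bin c n) z = Ring.choose (z + c) n :=
  val_eq_of_eval (eval_binom_X c z n)

open Polynomial in
theorem natDegree_bin_le (c : ℤ) (n : ℕ) : (bin c n).1.natDegree ≤ n := by
  change (binom ((X : ℂ[X]) + (c : ℂ[X])) n).natDegree ≤ n
  rw [binom]
  refine (natDegree_smul_le _ _).trans ?_
  rw [show aeval ((X : ℂ[X]) + (c : ℂ[X])) (descPochhammer ℂ n)
    = (descPochhammer ℂ n).comp (X + C (c : ℂ)) by simp [Polynomial.comp, aeval_def]]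
  refine natDegree_comp_le.trans ?_
  rw [natDegree_X_add_C, mul_one]
  exact (descPochhammer_natDegree ℂ n).le

open Polynomial in
/-- The ring endomorphism `P ↦ P(X + c)` of the ring of integer-valued polynomials. -/
def shift (c : ℤ) : intPoly →+* intPoly where
  toFun P := ⟨P.1.comp (X + (c : ℂ[X])), fun z => ⟨val P (z + c), by
    rw [cast_val]; simp⟩⟩
  map_one' := by ext; simp
  map_zero' := by ext; simp
  map_add' P Q := by ext; simp
  map_mul' P Q := by ext; simp

@[simp] theorem val_shift (c : ℤ) (P : intPoly) (z : ℤ) : val (shift c P) z = val P (z + c) :=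
  val_eq_of_eval (by rw [cast_val]; simp [shift])

theorem shift_bin (c d : ℤ) (n : ℕ) : shift c (bin d n) = bin (c + d) n :=
  intPoly_ext fun m => by simp [add_assoc]

theorem shift_shift (c d : ℤ) (P : intPoly) : shift c (shift d P) = shift (c + d) P :=
  intPoly_ext fun m => by simp [add_assoc]

theorem shift_zero (P : intPoly) : shift 0 P = P :=
  intPoly_ext fun m => by simp

open fwdDiff_aux in
/-- Newton's expansion of an integer-valued polynomial. -/
theorem newton_expansion (P : intPoly) (d : ℕ) (hd : P.1.natDegree ≤ d) :
    P = ∑ n ∈ Finset.range (d + 1), ((fwdDiff 1)^[n] (val P) 0) • bin 0 n := by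
  have key : ∀ n, d < n → (fwdDiff 1)^[n] (val P) 0 = 0 := by
    intro n hn
    have h := congrFun (Polynomial.fwdDiff_iter_eq_zero_of_degree_lt (hd.trans_lt hn)) 0
    rw [fwdDiff_iter_eq_sum_shift] at h ⊢
    have e : ((∑ k ∈ Finset.range (n + 1), ((-1 : ℤ) ^ (n - k) * n.choose k) •
        val P (0 + k • 1) : ℤ) : ℂ) = 0 := by
      refine Eq.trans ?_ h
      push_cast
      refine Finset.sum_congr rfl fun k _ => ?_
      rw [smul_eq_mul, Int.cast_mul, cast_val]
      simp
    exact_mod_cast e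
  refine intPoly_ext fun m => ?_
  have h := shift_eq_sum_fwdDiff_iter (1 : ℤ) (val P) m 0
  simp only [zero_add, nsmul_eq_mul, mul_one] at h
  rw [h, val_sum]
  have e1 : ∀ k, val (((fwdDiff 1)^[k] (val P) 0) • bin 0 k) m
      = (m.choose k : ℤ) * (fwdDiff 1)^[k] (val P) 0 := by
    intro k
    rw [val_zsmul, val_bin, add_zero, Ring.choose_natCast, mul_comm]
  rw [Finset.sum_congr rfl fun k _ => e1 k]
  -- both sums equal the sum up to the larger of the two bounds
  have s1 := Finset.sum_subset (f := fun k => (m.choose k : ℤ) * (fwdDiff 1)^[k] (val P) 0)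
    (Finset.range_mono (le_max_left (m + 1) (d + 1))) (fun k _ hk => by
      rw [Nat.choose_eq_zero_of_lt (by simpa using hk)]; simp)
  have s2 := Finset.sum_subset (f := fun k => (m.choose k : ℤ) * (fwdDiff 1)^[k] (val P) 0)
    (Finset.range_mono (le_max_right (m + 1) (d + 1))) (fun k _ hk => by
      rw [key k (by simpa using hk)]; simp)
  rw [s2, ← s1]

theorem exists_newton (P : intPoly) (d : ℕ) (hd : P.1.natDegree ≤ d) :
    ∃ c : ℕ → ℤ, P = ∑ n ∈ Finset.range (d + 1), c n • bin 0 n :=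
  ⟨_, newton_expansion P d hd⟩

/-- Newton coefficients inherit divisibility from the values. -/
theorem exists_newton_dvd (P : intPoly) (q : ℤ) (h : ∀ n : ℕ, q ∣ val P n) :
    ∃ c : ℕ → ℤ, P = q • ∑ n ∈ Finset.range (P.1.natDegree + 1), c n • bin 0 n := by
  have key : ∀ n, q ∣ (fwdDiff 1)^[n] (val P) 0 := by
    intro n
    rw [fwdDiff_iter_eq_sum_shift]
    refine Finset.dvd_sum fun k _ => ?_
    rw [smul_eq_mul]
    exact Dvd.dvd.mul_left (by simpa using h k) _
  choose c hc using key
  refine ⟨c, ?_⟩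
  conv_lhs => rw [newton_expansion P _ le_rfl]
  rw [Finset.smul_sum]
  exact Finset.sum_congr rfl fun n _ => by rw [hc, mul_smul]

/-! ### The integral form and its basis -/

/-- The divided power `X^(m)` in the integral form. -/
def XZ (m : ℕ) : UZ := ⟨divPow ucX m, divPow_ucX_mem m⟩

/-- The divided power `Y^(m)` in the integral form. -/
def YZ (m : ℕ) : UZ := ⟨divPow ucY m, divPow_ucY_mem m⟩

theorem aeval_bin (c : ℤ) (n : ℕ) :
    Polynomial.aeval ucH (bin c n).1 = binom (ucH + (c : UC)) n := by
  change Polynomial.aeval ucH (binom _ n) = _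
  rw [aeval_binom]
  simp

theorem aeval_ucH_mem (P : intPoly) : Polynomial.aeval ucH P.1 ∈ UZ := by
  obtain ⟨c, hc⟩ := exists_newton P _ le_rfl
  rw [hc, AddSubmonoidClass.coe_finsetSum, map_sum]
  refine UZ.sum_mem fun n _ => ?_
  have e : ((c n • bin 0 n : intPoly) : Polynomial ℂ) = c n • (bin 0 n).1 := rfl
  rw [e, map_zsmul, aeval_bin]
  exact UZ.zsmul_mem (binom_ucH_mem 0 n) _

/-- The ring homomorphism `P ↦ P(H)` from integer-valued polynomials to the integral form. -/
def hpZ : intPoly →ₐ[ℤ] UZ :=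
  (((Polynomial.aeval (R := ℂ) ucH).restrictScalars ℤ).comp intPoly.val).codRestrict UZ
    aeval_ucH_mem

theorem coe_hpZ (P : intPoly) : ((hpZ P : UZ) : UC) = Polynomial.aeval ucH P.1 := rfl

theorem hpZ_bin (c : ℤ) (n : ℕ) :
    hpZ (bin c n) = ⟨binom (ucH + (c : UC)) n, binom_ucH_mem c n⟩ :=
  Subtype.ext (aeval_bin c n)

section DivPow

variable {A : Type*} [Ring A] [Algebra ℂ A]

theorem divPow_mul_divPow_self (z : A) (m n : ℕ) :
    divPow z m * divPow z n = (m + n).choose m • divPow z (m + n) := by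
  rw [divPow, divPow, divPow, smul_mul_smul_comm, ← pow_add, ← Nat.cast_smul_eq_nsmul ℂ, smul_smul]
  congr 1
  rw [Nat.cast_add_choose]
  have h1 : ((m + n).factorial : ℂ) ≠ 0 := by exact_mod_cast (m + n).factorial_ne_zero
  have h2 : (m.factorial : ℂ) ≠ 0 := by exact_mod_cast m.factorial_ne_zero
  have h3 : (n.factorial : ℂ) ≠ 0 := by exact_mod_cast n.factorial_ne_zero
  field_simp

theorem op_divPow (z : A) (m : ℕ) : divPow (MulOpposite.op z) m = MulOpposite.op (divPow z m) := by
  simp [divPow]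

theorem op_binom (z : A) (m : ℕ) : binom (MulOpposite.op z) m = MulOpposite.op (binom z m) := by
  rw [binom, binom, MulOpposite.op_smul]
  congr 1
  induction descPochhammer ℂ m using Polynomial.induction_on' with
  | add p q hp hq => simp [hp, hq]
  | monomial n a => simp [Polynomial.aeval_monomial, Algebra.commutes]

/-- The commutation formula for divided powers, when the exponent of `x` is the larger one. It is
the other formula read in the opposite algebra, where `x` and `y` change roles. -/
theorem divPow_mul_divPow_of_ge {x y h : A} (hx : h * x = x * (h + 2)) (hy : h * y = y * (h - 2))
    (hxy : x * y = y * x + h) (m n : ℕ) (hmn : n ≤ m) :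
    divPow x m * divPow y n = ∑ k ∈ Finset.range (n + 1),
      divPow y (n - k) * binom (h + ((2 * k - m - n : ℤ) : A)) k * divPow x (m - k) := by
  have c2 : ∀ u : A, u * 2 = 2 * u := fun u => (Nat.cast_commute 2 u).eq.symm
  have e := divPow_mul_divPow (x := MulOpposite.op y) (y := MulOpposite.op x)
    (h := MulOpposite.op h)
    (by
      apply MulOpposite.unop_injective
      simp only [MulOpposite.unop_mul, MulOpposite.unop_op, MulOpposite.unop_add,
        MulOpposite.unop_ofNat]
      rw [add_mul, hy, mul_sub, c2]; abel)
    (by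
      apply MulOpposite.unop_injective
      simp only [MulOpposite.unop_mul, MulOpposite.unop_op, MulOpposite.unop_sub,
        MulOpposite.unop_ofNat]
      rw [sub_mul, hx, mul_add, c2]; abel)
    (by
      apply MulOpposite.unop_injective
      simp only [MulOpposite.unop_mul, MulOpposite.unop_op, MulOpposite.unop_add]
      exact hxy) n m hmn
  have e' := congrArg MulOpposite.unop e
  rw [op_divPow, op_divPow] at e'
  simp only [MulOpposite.unop_mul, MulOpposite.unop_op, Finset.unop_sum, op_divPow] at e'
  rw [e']
  refine Finset.sum_congr rfl fun k _ => ?_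
  have hc : MulOpposite.op h + ((2 * k - n - m : ℤ) : Aᵐᵒᵖ)
      = MulOpposite.op (h + ((2 * k - m - n : ℤ) : A)) := by
    rw [show (2 * k - n - m : ℤ) = 2 * k - m - n by ring, MulOpposite.op_add,
      MulOpposite.op_intCast]
  rw [hc, op_binom, MulOpposite.unop_op, mul_assoc]

end DivPow

theorem XZ_mul_YZ (m n : ℕ) : XZ m * YZ n = ∑ k ∈ Finset.range (min m n + 1),
    YZ (n - k) * hpZ (bin (2 * k - m - n) k) * XZ (m - k) := by
  apply Subtype.ext
  rw [AddSubmonoidClass.coe_finsetSum]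
  change divPow ucX m * divPow ucY n = ∑ k ∈ _, divPow ucY (n - k) *
    (hpZ (bin (2 * k - m - n) k) : UC) * divPow ucX (m - k)
  simp only [coe_hpZ, aeval_bin]
  rcases le_total m n with h | h
  · rw [min_eq_left h]
    exact divPow_mul_divPow ucH_mul_ucX ucH_mul_ucY ucX_mul_ucY m n h
  · rw [min_eq_right h]
    exact divPow_mul_divPow_of_ge ucH_mul_ucX ucH_mul_ucY ucX_mul_ucY m n h

theorem XZ_mul_XZ (m n : ℕ) : XZ m * XZ n = (m + n).choose m • XZ (m + n) :=
  Subtype.ext (divPow_mul_divPow_self ucX m n)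

theorem YZ_mul_YZ (m n : ℕ) : YZ m * YZ n = (m + n).choose m • YZ (m + n) :=
  Subtype.ext (divPow_mul_divPow_self ucY m n)

theorem XZ_zero : XZ 0 = 1 := Subtype.ext (divPow_zero _)

theorem YZ_zero : YZ 0 = 1 := Subtype.ext (divPow_zero _)

section

variable {A : Type*} [Ring A] [Algebra ℂ A]

/-- If `h' x = x h` then `P(h') x^(m) = x^(m) P(h)`, for the shifts of `h`. -/
theorem aeval_mul_divPow {x h : A} (c : ℤ) (hx : h * x = x * (h + (c : A))) (m : ℕ)
    (P : Polynomial ℂ) : Polynomial.aeval h P * divPow x m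
      = divPow x m * Polynomial.aeval (h + ((c * m : ℤ) : A)) P := by
  have h0 : ∀ m : ℕ, h * x ^ m = x ^ m * (h + ((c * m : ℤ) : A)) := by
    intro m
    induction m with
    | zero => simp
    | succ m ih =>
      have c1 := (Int.cast_commute (c * m) x).eq
      rw [pow_succ, ← mul_assoc, ih, mul_assoc, add_mul, hx, c1, ← mul_add, mul_assoc]
      congr 2
      push_cast
      noncomm_ring
  rw [divPow, mul_smul_comm, smul_mul_assoc]
  congr 1
  induction P using Polynomial.induction_on' with
  | add p q hp hq => simp [add_mul, mul_add, hp, hq]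
  | monomial n a =>
    rw [Polynomial.aeval_monomial, Polynomial.aeval_monomial, mul_assoc, ← mul_assoc (x ^ m),
      ← Algebra.commutes a (x ^ m), mul_assoc]
    congr 1
    exact (SemiconjBy.pow_right (show SemiconjBy (x ^ m) _ _ from (h0 m).symm) n).eq.symm

end

theorem coe_hpZ_shift (c : ℤ) (P : intPoly) :
    ((hpZ (shift c P) : UZ) : UC) = Polynomial.aeval (ucH + (c : UC)) P.1 := by
  rw [coe_hpZ]
  change Polynomial.aeval ucH (P.1.comp _) = _
  rw [Polynomial.aeval_comp]
  simp

theorem hpZ_mul_XZ (P : intPoly) (m : ℕ) : hpZ P * XZ m = XZ m * hpZ (shift (2 * m) P) := by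
  apply Subtype.ext
  change ((hpZ P : UZ) : UC) * divPow ucX m = divPow ucX m * ((hpZ (shift (2 * m) P) : UZ) : UC)
  rw [coe_hpZ_shift]
  exact aeval_mul_divPow 2 (by rw [ucH_mul_ucX]; norm_num) m _

theorem hpZ_mul_YZ (P : intPoly) (m : ℕ) : hpZ P * YZ m = YZ m * hpZ (shift (-2 * m) P) := by
  apply Subtype.ext
  change ((hpZ P : UZ) : UC) * divPow ucY m = divPow ucY m * ((hpZ (shift (-2 * m) P) : UZ) : UC)
  rw [coe_hpZ_shift]
  exact aeval_mul_divPow (-2) (by rw [ucH_mul_ucY]; push_cast; rw [sub_eq_add_neg]) m _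

/-- The elements `Y^(m) binom(H, n) X^(m')` of the integral form. -/
def pbwZ (t : ℕ × ℕ × ℕ) : UZ := YZ t.1 * hpZ (bin 0 t.2.1) * XZ t.2.2

theorem YZ_hpZ_XZ_mem_span (m m' : ℕ) (P : intPoly) :
    YZ m * hpZ P * XZ m' ∈ Submodule.span ℤ (Set.range pbwZ) := by
  obtain ⟨c, hc⟩ := exists_newton P _ le_rfl
  rw [hc, map_sum, Finset.mul_sum, Finset.sum_mul]
  refine Submodule.sum_mem _ fun n _ => ?_
  rw [map_zsmul, mul_smul_comm, smul_mul_assoc]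
  exact Submodule.smul_mem _ _ (Submodule.subset_span ⟨(m, n, m'), rfl⟩)

theorem XZ_mul_mem_span (q m m' : ℕ) (P : intPoly) :
    XZ q * (YZ m * hpZ P * XZ m') ∈ Submodule.span ℤ (Set.range pbwZ) := by
  rw [← mul_assoc, ← mul_assoc, XZ_mul_YZ, Finset.sum_mul, Finset.sum_mul]
  refine Submodule.sum_mem _ fun k _ => ?_
  have e : hpZ (shift (-2 * ((q - k : ℕ) : ℤ)) P) * XZ (q - k) = XZ (q - k) * hpZ P := by
    rw [hpZ_mul_XZ, shift_shift, show 2 * ((q - k : ℕ) : ℤ) + -2 * ((q - k : ℕ) : ℤ) = 0 by ring,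
      shift_zero]
  rw [mul_assoc (_ * _) (XZ _), ← e, ← mul_assoc, mul_assoc (YZ _), ← map_mul, mul_assoc (_ * _),
    XZ_mul_XZ, mul_smul_comm]
  exact Submodule.smul_of_tower_mem _ _ (YZ_hpZ_XZ_mem_span _ _ _)

/-- Kostant's theorem for `sl₂`: the products `Y^(m) binom(H, n) X^(m')` span the integral form. -/
theorem span_pbwZ : Submodule.span ℤ (Set.range pbwZ) = ⊤ := by
  set S := Submodule.span ℤ (Set.range pbwZ) with hS
  have hX : ∀ q, ∀ u ∈ S, XZ q * u ∈ S := by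
    intro q u hu
    induction hu using Submodule.span_induction with
    | mem u h => obtain ⟨t, rfl⟩ := h; exact XZ_mul_mem_span _ _ _ _
    | zero => rw [mul_zero]; exact S.zero_mem
    | add u v _ _ hu hv => rw [mul_add]; exact S.add_mem hu hv
    | smul a u _ hu => rw [mul_smul_comm]; exact S.smul_mem _ hu
  have hY : ∀ q, ∀ u ∈ S, YZ q * u ∈ S := by
    intro q u hu
    induction hu using Submodule.span_induction with
    | mem u h =>
      obtain ⟨t, rfl⟩ := h
      rw [pbwZ, ← mul_assoc, ← mul_assoc, YZ_mul_YZ, smul_mul_assoc, smul_mul_assoc]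
      exact Submodule.smul_of_tower_mem _ _ (YZ_hpZ_XZ_mem_span _ _ _)
    | zero => rw [mul_zero]; exact S.zero_mem
    | add u v _ _ hu hv => rw [mul_add]; exact S.add_mem hu hv
    | smul a u _ hu => rw [mul_smul_comm]; exact S.smul_mem _ hu
  have h1 : (1 : UZ) ∈ S := by
    have := YZ_hpZ_XZ_mem_span 0 0 1
    rwa [XZ_zero, YZ_zero, map_one, mul_one, mul_one] at this
  have key : ∀ z (hz : z ∈ UZ), ∀ u ∈ S, (⟨z, hz⟩ : UZ) * u ∈ S := by
    intro z hz
    induction hz using Algebra.adjoin_induction with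
    | mem z h =>
      intro u hu
      rcases h with ⟨q, rfl⟩ | ⟨q, rfl⟩
      · exact hX q u hu
      · exact hY q u hu
    | algebraMap c =>
      intro u hu
      have : (⟨algebraMap ℤ UC c, UZ.algebraMap_mem c⟩ : UZ) = algebraMap ℤ UZ c := rfl
      rw [this, ← Algebra.smul_def]
      exact S.smul_mem _ hu
    | add x y hx hy h1 h2 =>
      intro u hu
      have : (⟨x + y, UZ.add_mem hx hy⟩ : UZ) = ⟨x, hx⟩ + ⟨y, hy⟩ := rfl
      rw [this, add_mul]
      exact S.add_mem (h1 u hu) (h2 u hu)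
    | mul x y hx hy h1 h2 =>
      intro u hu
      have : (⟨x * y, UZ.mul_mem hx hy⟩ : UZ) = ⟨x, hx⟩ * ⟨y, hy⟩ := rfl
      rw [this, mul_assoc]
      exact h1 _ (h2 u hu)
  rw [eq_top_iff]
  rintro ⟨z, hz⟩ -
  simpa using key z hz 1 h1

section Verma

open Polynomial

attribute [local instance] LieRing.ofAssociativeRing

/-- The action of `X` on the Verma module of highest weight `l`, realized on `ℂ[y]`. -/
def vermaX (l : ℂ) : Module.End ℂ ℂ[X] :=
  l • derivative - LinearMap.mulLeft ℂ X * (derivative * derivative)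

/-- The action of `Y` on the Verma module, realized on `ℂ[y]`. -/
def vermaY : Module.End ℂ ℂ[X] := LinearMap.mulLeft ℂ X

/-- The action of `H` on the Verma module of highest weight `l`, realized on `ℂ[y]`. -/
def vermaH (l : ℂ) : Module.End ℂ ℂ[X] := l • 1 - (2 : ℂ) • (LinearMap.mulLeft ℂ X * derivative)

theorem vermaX_apply (l : ℂ) (f : ℂ[X]) :
    vermaX l f = l • derivative f - X * derivative (derivative f) := rfl

theorem vermaY_apply (f : ℂ[X]) : vermaY f = X * f := rfl

theorem vermaH_apply (l : ℂ) (f : ℂ[X]) : vermaH l f = l • f - (2 : ℂ) • (X * derivative f) := rfl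

/-- The Verma module of highest weight `l` as a representation of `sl₂`. -/
def vermaLie (l : ℂ) : LieAlgebra.SpecialLinear.sl (Fin 2) ℂ →ₗ⁅ℂ⁆ Module.End ℂ ℂ[X] where
  toFun M := M.1 0 0 • vermaH l + M.1 0 1 • vermaX l + M.1 1 0 • vermaY
  map_add' M N := by
    have e : ∀ i j, (M + N).1 i j = M.1 i j + N.1 i j := fun _ _ => rfl
    rw [e, e, e, add_smul, add_smul, add_smul]
    abel
  map_smul' c M := by
    have e : ∀ i j, (c • M).1 i j = c * M.1 i j := fun _ _ => rfl
    rw [e, e, e, mul_smul, mul_smul, mul_smul, RingHom.id_apply, smul_add, smul_add]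
  map_lie' {M N} := by
    have tr : ∀ M : LieAlgebra.SpecialLinear.sl (Fin 2) ℂ, M.1 1 1 = - M.1 0 0 := by
      intro M
      have h : Matrix.trace M.1 = 0 := LinearMap.mem_ker.1 M.2
      rw [Matrix.trace_fin_two] at h
      linear_combination h
    have e : ∀ i j, (⁅M, N⁆ : LieAlgebra.SpecialLinear.sl (Fin 2) ℂ).1 i j
        = (M.1 * N.1 - N.1 * M.1) i j := fun _ _ => rfl
    rw [e, e, e, Ring.lie_def]
    simp only [Matrix.sub_apply, Matrix.mul_apply, Fin.sum_univ_two, tr]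
    refine LinearMap.ext fun f => ?_
    simp only [LinearMap.add_apply, LinearMap.sub_apply, LinearMap.smul_apply, Module.End.mul_apply,
      vermaX_apply, vermaY_apply, vermaH_apply, map_add, map_sub, derivative_mul, derivative_X,
      derivative_one, map_zero, smul_eq_C_mul, derivative_C, C_mul, C_neg]
    generalize derivative (derivative (derivative f)) = f3
    generalize derivative (derivative f) = f2
    generalize derivative f = f1
    have e2 : (C 2 : ℂ[X]) = 2 := rfl
    rw [e2]
    ring

/-- The Verma module of highest weight `l` as a representation of the enveloping algebra. -/
def verma (l : ℂ) : UC →ₐ[ℂ] Module.End ℂ ℂ[X] := UniversalEnvelopingAlgebra.lift ℂ (vermaLie l)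

theorem verma_ucX (l : ℂ) : verma l ucX = vermaX l := by
  rw [verma, ucX, UniversalEnvelopingAlgebra.lift_ι_apply]
  change (0 : ℂ) • vermaH l + (1 : ℂ) • vermaX l + (0 : ℂ) • vermaY = _
  simp

theorem verma_ucY (l : ℂ) : verma l ucY = vermaY := by
  rw [verma, ucY, UniversalEnvelopingAlgebra.lift_ι_apply]
  change (0 : ℂ) • vermaH l + (0 : ℂ) • vermaX l + (1 : ℂ) • vermaY = _
  simp

theorem verma_ucH (l : ℂ) : verma l ucH = vermaH l := by
  rw [verma, ucH, UniversalEnvelopingAlgebra.lift_ι_apply]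
  change (1 : ℂ) • vermaH l + (0 : ℂ) • vermaX l + (0 : ℂ) • vermaY = _
  simp

theorem vermaX_pow_apply (l : ℂ) (i m : ℕ) : (vermaX l ^ m) (X ^ i) =
    ((i.descFactorial m : ℂ) * ∏ t ∈ Finset.range m, (l - (i : ℂ) + 1 + t)) • X ^ (i - m) := by
  induction m with
  | zero => simp
  | succ m ih =>
    rw [pow_succ', Module.End.mul_apply, ih, map_smul, vermaX_apply, Nat.descFactorial_succ,
      Finset.prod_range_succ]
    rcases Nat.lt_or_ge m i with h | h
    · obtain ⟨n, rfl⟩ : ∃ n, i = m + 1 + n := ⟨i - (m + 1), by omega⟩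
      rw [show m + 1 + n - m = n + 1 by omega, show m + 1 + n - (m + 1) = n by omega]
      simp only [smul_eq_C_mul, derivative_X_pow, derivative_mul, derivative_C, Nat.add_sub_cancel]
      cases n with
      | zero => simp; ring
      | succ n =>
        rw [Nat.add_sub_cancel]
        simp only [C_mul, map_natCast, C_sub, C_add, C_1]
        push_cast
        ring
    · simp [Nat.sub_eq_zero_of_le h]

theorem vermaY_pow_apply (m : ℕ) : (vermaY ^ m) 1 = X ^ m := by
  induction m with
  | zero => simp
  | succ m ih => rw [pow_succ', Module.End.mul_apply, ih, vermaY_apply, pow_succ']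

theorem aeval_vermaH_apply_one (l : ℂ) (P : ℂ[X]) : aeval (vermaH l) P 1 = P.eval l • 1 := by
  induction P using Polynomial.induction_on' with
  | add p q hp hq => simp [hp, hq, add_smul]
  | monomial n a =>
    have : ∀ n : ℕ, (vermaH l ^ n) 1 = l ^ n • (1 : ℂ[X]) := by
      intro n
      induction n with
      | zero => simp
      | succ n ih =>
        rw [pow_succ', Module.End.mul_apply, ih, map_smul, vermaH_apply]
        simp [smul_smul, pow_succ]
    rw [aeval_monomial, Module.End.mul_apply, this, eval_monomial, Module.algebraMap_end_apply,
      smul_smul]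

theorem map_divPow {A B : Type*} [Ring A] [Ring B] [Algebra ℂ A] [Algebra ℂ B] (f : A →ₐ[ℂ] B)
    (z : A) (m : ℕ) : f (divPow z m) = divPow (f z) m := by
  simp [divPow]

/-- The action of the basis element with last index `i'` on the vector `X ^ i` of the Verma module,
for `i ≤ i'`: it vanishes for `i < i'`. -/
theorem verma_pbwZ (l i : ℕ) (t : ℕ × ℕ × ℕ) (ht : i ≤ t.2.2) (m : ℕ) :
    (verma l (pbwZ t : UC) (X ^ i)).coeff m =
      if t.1 = m ∧ t.2.2 = i then
        (((m.factorial : ℂ)⁻¹ * ∏ s ∈ Finset.range i, ((l : ℂ) - (i : ℂ) + 1 + s)))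
          * ((Ring.choose (l : ℤ) t.2.1 : ℤ) : ℂ)
      else 0 := by
  obtain ⟨m0, n, i'⟩ := t
  simp only at ht ⊢
  have e : ((pbwZ (m0, n, i') : UZ) : UC)
    = divPow ucY m0 * aeval ucH (bin 0 n).1 * divPow ucX i' := rfl
  rw [e, map_mul, map_mul, map_divPow, map_divPow, verma_ucX, verma_ucY, ← aeval_algHom_apply,
    verma_ucH, Module.End.mul_apply, Module.End.mul_apply, divPow, divPow, LinearMap.smul_apply,
    LinearMap.smul_apply, vermaX_pow_apply]
  rcases Nat.lt_or_ge i i' with h | h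
  · rw [if_neg (by omega), Nat.descFactorial_of_lt h]
    simp
  · obtain rfl : i = i' := le_antisymm ht h
    simp only [Nat.sub_self, pow_zero, map_smul]
    rw [aeval_vermaH_apply_one, map_smul, vermaY_pow_apply, Nat.descFactorial_self]
    have h2 : (i.factorial : ℂ) ≠ 0 := by exact_mod_cast i.factorial_ne_zero
    have h3 := cast_val (bin 0 n) l
    rw [val_bin, add_zero] at h3
    simp only [coeff_smul, coeff_X_pow, smul_eq_mul, and_true]
    rw [Int.cast_natCast] at h3
    rw [← h3]
    by_cases hm : m0 = m
    · subst hm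
      rw [if_pos rfl, if_pos rfl]
      field_simp
    · rw [if_neg hm, if_neg (Ne.symm hm)]
      simp

end Verma

/-- The Poincaré–Birkhoff–Witt property: on the Verma module of highest weight `l`, the vector
`X ^ i` detects the coefficients of the basis elements with smallest last index `i`, up to a factor
which is a non-zero function of `l`. -/
theorem linearIndependent_pbwZ : LinearIndependent ℤ pbwZ := by
  rw [linearIndependent_iff']
  intro s g hg
  have key : ∀ i, ∀ t ∈ s, t.2.2 = i → g t = 0 := by
    intro i
    induction i using Nat.strong_induction_on with
    | _ i ih =>
      intro t0 ht0 hi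
      set m := t0.1 with hm
      set s' := s.filter fun t => t.1 = m ∧ t.2.2 = i with hs'
      -- the polynomial whose values are the coefficients of `X ^ m`
      set Q : intPoly := ∑ t ∈ s', g t • bin 0 t.2.1 with hQ
      have hval : ∀ l : ℕ, i ≤ l → val Q l = 0 := by
        intro l hl
        have h1 := congrArg (fun u : UZ => (verma l (u : UC) (Polynomial.X ^ i)).coeff m) hg
        simp only [AddSubmonoidClass.coe_finsetSum, map_sum, LinearMap.sum_apply,
          Polynomial.finsetSum_coeff, ZeroMemClass.coe_zero, map_zero, LinearMap.zero_apply,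
          Polynomial.coeff_zero] at h1
        have hD : (((m.factorial : ℂ)⁻¹ * ∏ s ∈ Finset.range i, ((l : ℂ) - (i : ℂ) + 1 + s))) ≠ 0 := by
          refine mul_ne_zero (inv_ne_zero (by exact_mod_cast m.factorial_ne_zero))
            (Finset.prod_ne_zero_iff.2 fun t _ => ?_)
          rw [← Nat.cast_sub hl]
          have : l - i + 1 + t ≠ 0 := by omega
          exact_mod_cast this
        have h2 : ∀ t ∈ s, (verma l (((g t • pbwZ t : UZ)) : UC) (Polynomial.X ^ i)).coeff m =
            if t.1 = m ∧ t.2.2 = i then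
              (((m.factorial : ℂ)⁻¹ * ∏ s ∈ Finset.range i, ((l : ℂ) - (i : ℂ) + 1 + s)))
                * ((g t * Ring.choose (l : ℤ) t.2.1 : ℤ) : ℂ)
            else 0 := by
          intro t ht
          have e : ((g t • pbwZ t : UZ) : UC) = g t • (pbwZ t : UC) := rfl
          rcases Nat.lt_or_ge t.2.2 i with h | h
          · rw [ih _ h t ht rfl]; simp
          · rw [e, map_zsmul, LinearMap.smul_apply, Polynomial.coeff_smul, verma_pbwZ l i t h m]
            split_ifs
            · push_cast [zsmul_eq_mul]; ring
            · simp
        rw [Finset.sum_congr rfl h2, ← Finset.sum_filter, ← Finset.mul_sum] at h1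
        have h3 := (mul_eq_zero.1 h1).resolve_left hD
        have h4 : ∑ t ∈ s', g t * Ring.choose (l : ℤ) t.2.1 = 0 := by exact_mod_cast h3
        rw [hQ, val_sum]
        refine (Finset.sum_congr rfl fun t _ => ?_).trans h4
        rw [val_zsmul, val_bin, add_zero]
      have hQ0 : Q = 0 := by
        have h0 : shift i Q = 0 := intPoly_ext fun n => by
          have := hval (n + i) (by omega)
          push_cast at this
          simp [this]
        have := congrArg (shift (-i)) h0
        rwa [shift_shift, neg_add_cancel, shift_zero, map_zero] at this
      have hn : ∀ n, ∀ t ∈ s', t.2.1 = n → g t = 0 := by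
        intro n
        induction n using Nat.strong_induction_on with
        | _ n ihn =>
          intro t ht htn
          have hv : val Q n = 0 := by rw [hQ0, val_zero]
          rw [hQ, val_sum, Finset.sum_eq_single t] at hv
          · rw [val_zsmul, val_bin, htn, add_zero, Ring.choose_natCast] at hv
            simpa using hv
          · intro t' ht' hne
            rw [val_zsmul, val_bin, add_zero, Ring.choose_natCast]
            rcases lt_trichotomy t'.2.1 n with h | h | h
            · rw [ihn _ h t' ht' rfl, zero_mul]
            · exfalso
              apply hne
              have a1 := (Finset.mem_filter.1 ht').2
              have a2 := (Finset.mem_filter.1 ht).2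
              exact Prod.ext (a1.1.trans a2.1.symm)
                (Prod.ext (h.trans htn.symm) (a1.2.trans a2.2.symm))
            · rw [Nat.choose_eq_zero_of_lt h]; simp
          · exact fun h => absurd ht h
      exact hn _ t0 (Finset.mem_filter.2 ⟨ht0, rfl, hi⟩) rfl
  exact fun t ht => key _ t ht rfl

/-- The basis of the integral form consisting of the products `Y^(m) binom(H, n) X^(m')`. -/
def basisZ : Module.Basis (ℕ × ℕ × ℕ) ℤ UZ :=
  Module.Basis.mk linearIndependent_pbwZ span_pbwZ.ge

theorem basisZ_apply (t : ℕ × ℕ × ℕ) : basisZ t = pbwZ t := Module.Basis.mk_apply _ _ _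

/-! ### The hyperalgebra: basis, commutation rules and congruences -/

section Hyper

variable (k : Type*) [Field k]

/-- The ring homomorphism `P ↦ P(H)` from integer-valued polynomials to the hyperalgebra. -/
def hp : intPoly →+* U k :=
  (Algebra.TensorProduct.includeRight (R := ℤ) (A := k) (B := UZ)).toRingHom.comp hpZ.toRingHom

theorem hp_eq (P : intPoly) : hp k P = 1 ⊗ₜ[ℤ] hpZ P := rfl

theorem dX_eq (m : ℕ) : dX k m = Algebra.TensorProduct.includeRight (R := ℤ) (XZ m) := rfl

theorem dY_eq (m : ℕ) : dY k m = Algebra.TensorProduct.includeRight (R := ℤ) (YZ m) := rfl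

theorem hp_eq' (P : intPoly) : hp k P = Algebra.TensorProduct.includeRight (R := ℤ) (hpZ P) := rfl

theorem bH_eq (c : ℤ) (n : ℕ) : bH k c n = hp k (bin c n) := by
  rw [hp_eq, hpZ_bin]; rfl

theorem hp_zsmul (c : ℤ) (P : intPoly) : hp k (c • P) = (c : k) • hp k P := by
  rw [map_zsmul, Int.cast_smul_eq_zsmul]

theorem dX_zero : dX k 0 = 1 := by rw [dX_eq, XZ_zero, map_one]

theorem dY_zero : dY k 0 = 1 := by rw [dY_eq, YZ_zero, map_one]

theorem dX_mul_dX (m n : ℕ) : dX k m * dX k n = ((m + n).choose m : k) • dX k (m + n) := by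
  rw [dX_eq, dX_eq, dX_eq, ← map_mul, XZ_mul_XZ, map_nsmul, Nat.cast_smul_eq_nsmul]

theorem dY_mul_dY (m n : ℕ) : dY k m * dY k n = ((m + n).choose m : k) • dY k (m + n) := by
  rw [dY_eq, dY_eq, dY_eq, ← map_mul, YZ_mul_YZ, map_nsmul, Nat.cast_smul_eq_nsmul]

theorem dX_mul_dY (m n : ℕ) : dX k m * dY k n = ∑ i ∈ Finset.range (min m n + 1),
    dY k (n - i) * hp k (bin (2 * i - m - n) i) * dX k (m - i) := by
  rw [dX_eq, dY_eq, ← map_mul, XZ_mul_YZ, map_sum]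
  simp only [map_mul]
  rfl

theorem hp_mul_dX (P : intPoly) (m : ℕ) : hp k P * dX k m = dX k m * hp k (shift (2 * m) P) := by
  rw [hp_eq', hp_eq', dX_eq, ← map_mul, hpZ_mul_XZ, map_mul]

theorem hp_mul_dY (P : intPoly) (m : ℕ) : hp k P * dY k m = dY k m * hp k (shift (-2 * m) P) := by
  rw [hp_eq', hp_eq', dY_eq, ← map_mul, hpZ_mul_YZ, map_mul]

theorem dX_mul_hp (P : intPoly) (m : ℕ) : dX k m * hp k P = hp k (shift (-2 * m) P) * dX k m := by
  rw [hp_mul_dX, shift_shift, show 2 * (m : ℤ) + -2 * m = 0 by ring, shift_zero]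

theorem dY_mul_hp (P : intPoly) (m : ℕ) : dY k m * hp k P = hp k (shift (2 * m) P) * dY k m := by
  rw [hp_mul_dY, shift_shift, show -2 * (m : ℤ) + 2 * m = 0 by ring, shift_zero]

/-- The basis of the hyperalgebra consisting of the elements `Y^(m) (H choose n) X^(m')`. -/
def pbwBasis : Module.Basis (ℕ × ℕ × ℕ) k (U k) := basisZ.baseChange k

theorem pbw_eq (m n m' : ℕ) : pbw k m n m' = dY k m * hp k (bin 0 n) * dX k m' := by
  rw [pbw, bH_eq]

theorem pbwBasis_apply (t : ℕ × ℕ × ℕ) : pbwBasis k t = pbw k t.1 t.2.1 t.2.2 := by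
  rw [pbwBasis, Module.Basis.baseChange_apply, basisZ_apply, pbw_eq, dY_eq, dX_eq, hp_eq',
    ← map_mul, ← map_mul]
  rfl

theorem dY_hp_dX_eq_sum (m m' : ℕ) (P : intPoly) {d : ℕ} {c : ℕ → ℤ}
    (hc : P = ∑ n ∈ Finset.range (d + 1), c n • bin 0 n) :
    dY k m * hp k P * dX k m' = ∑ n ∈ Finset.range (d + 1), (c n : k) • pbw k m n m' := by
  rw [hc, map_sum, Finset.mul_sum, Finset.sum_mul]
  refine Finset.sum_congr rfl fun n _ => ?_
  rw [hp_zsmul, mul_smul_comm, smul_mul_assoc, pbw_eq]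

/-- A `k`-linear property holds on the whole hyperalgebra if it holds for the elements
`Y^(m) P(H) X^(m')`. -/
theorem U_induction {C : U k → Prop} (h0 : C 0) (hadd : ∀ u v, C u → C v → C (u + v))
    (hsmul : ∀ (c : k) u, C u → C (c • u))
    (hmem : ∀ m P m', C (dY k m * hp k P * dX k m')) (u : U k) : C u := by
  have hu : u ∈ Submodule.span k (Set.range (pbwBasis k)) := by
    rw [(pbwBasis k).span_eq]; trivial
  induction hu using Submodule.span_induction with
  | mem u h =>
    obtain ⟨t, rfl⟩ := h
    rw [pbwBasis_apply, pbw_eq]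
    exact hmem _ _ _
  | zero => exact h0
  | add u v _ _ hu hv => exact hadd u v hu hv
  | smul a u _ hu => exact hsmul a u hu

/-- The coefficient of `Y^(m) _ X^(m')`: a `k`-linear map to functions on `ℤ`, which sends
`Y^(m) P(H) X^(m')` to the reduction of the function `P`. -/
def Ev (m m' : ℕ) : U k →ₗ[k] (ℤ → k) :=
  (pbwBasis k).constr k fun t => if t.1 = m ∧ t.2.2 = m' then fun z => (Ring.choose z t.2.1 : ℤ)
    else 0

theorem Ev_pbw (m m' a n b : ℕ) : Ev k m m' (pbw k a n b) =
    if a = m ∧ b = m' then fun z => ((Ring.choose z n : ℤ) : k) else 0 := by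
  have := (pbwBasis k).constr_basis k (fun t => if t.1 = m ∧ t.2.2 = m' then
    fun z => ((Ring.choose z t.2.1 : ℤ) : k) else 0) (a, n, b)
  rw [pbwBasis_apply] at this
  exact this

theorem Ev_dY_hp_dX (m m' a b : ℕ) (P : intPoly) : Ev k m m' (dY k a * hp k P * dX k b) =
    if a = m ∧ b = m' then fun z => (val P z : k) else 0 := by
  obtain ⟨c, hc⟩ := exists_newton P _ le_rfl
  rw [dY_hp_dX_eq_sum k a b P hc, map_sum]
  simp only [map_smul, Ev_pbw]
  split_ifs
  · funext z
    conv_rhs => rw [hc]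
    rw [val_sum, Finset.sum_apply]
    push_cast
    refine Finset.sum_congr rfl fun n _ => ?_
    rw [val_zsmul, val_bin, add_zero, Pi.smul_apply, smul_eq_mul]
    push_cast
    rfl
  · simp

theorem eq_zero_of_Ev {u : U k} (h : ∀ m m', Ev k m m' u = 0) : u = 0 := by
  apply (pbwBasis k).repr.injective
  rw [map_zero]
  ext ⟨m, n, m'⟩
  rw [Finsupp.zero_apply]
  induction n using Nat.strong_induction_on with
  | _ n ih =>
    have h1 := congrFun (h m m') (n : ℤ)
    rw [← (pbwBasis k).linearCombination_repr u, Finsupp.linearCombination_apply, Finsupp.sum,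
      map_sum, Finset.sum_apply, Finset.sum_eq_single (m, n, m')] at h1
    · rw [map_smul, pbwBasis_apply, Ev_pbw, if_pos ⟨rfl, rfl⟩, Pi.smul_apply,
        Ring.choose_natCast] at h1
      simpa using h1
    · rintro ⟨a, l, b⟩ - hne
      rw [map_smul, pbwBasis_apply, Ev_pbw]
      split_ifs with hab
      · obtain ⟨rfl, rfl⟩ := hab
        rw [Pi.smul_apply, Ring.choose_natCast]
        rcases lt_trichotomy l n with hl | rfl | hl
        · rw [ih l hl, zero_smul]
        · exact absurd rfl hne
        · rw [Nat.choose_eq_zero_of_lt hl]; simp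
      · simp
    · intro hn
      rw [Finsupp.notMem_support_iff.1 hn, zero_smul, map_zero]; rfl

theorem Fr'_pbw (p m n m' : ℕ) : Fr' k p (pbw k m n m') = pbw k (m * p) (n * p) (m' * p) := by
  have h : ∃ f : U k →ₗ[k] U k, ∀ m n m' : ℕ, f (pbw k m n m') = pbw k (m * p) (n * p) (m' * p) := by
    refine ⟨(pbwBasis k).constr k fun t => pbw k (t.1 * p) (t.2.1 * p) (t.2.2 * p), ?_⟩
    intro m n m'
    have := (pbwBasis k).constr_basis k
      (fun t => pbw k (t.1 * p) (t.2.1 * p) (t.2.2 * p)) (m, n, m')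
    rwa [pbwBasis_apply] at this
  exact Classical.epsilon_spec h m n m'

theorem exists_zsmul_of_cast_val_eq (p : ℕ) [CharP k p] {P Q : intPoly}
    (h : ∀ n : ℕ, (val P n : k) = val Q n) : ∃ R : intPoly, P = (p : ℤ) • R + Q := by
  obtain ⟨c, hc⟩ := exists_newton_dvd (P - Q) p (fun n => by
    have e : P = (P - Q) + Q := by ring
    have := h n
    rw [e, val_add, Int.cast_add, add_eq_right] at this
    rwa [← CharP.intCast_eq_zero_iff k p])
  exact ⟨_, sub_eq_iff_eq_add.1 hc⟩

/-- The elements `P(H)` of the hyperalgebra depend only on the values of `P` modulo `p`. -/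
theorem hp_congr (p : ℕ) [CharP k p] {P Q : intPoly} (h : ∀ n : ℕ, (val P n : k) = val Q n) :
    hp k P = hp k Q := by
  obtain ⟨R, rfl⟩ := exists_zsmul_of_cast_val_eq k p h
  rw [map_add, hp_zsmul]
  simp

section Lucas

variable (p : ℕ) [Fact p.Prime] [CharP k p]

/-- `binom(z, n)` modulo `p` is periodic in `z` of period `p ^ r` for `n < p ^ r`. -/
theorem cast_choose_add_pow (r : ℕ) (z : ℤ) {n : ℕ} (hn : n < p ^ r) :
    ((Ring.choose (z + (p : ℤ) ^ r) n : ℤ) : k) = (Ring.choose z n : ℤ) := by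
  have hp : p.Prime := Fact.out
  rw [Ring.add_choose_eq n (Commute.all _ _), Int.cast_sum, Finset.sum_eq_single (n, 0)]
  · simp
  · rintro ⟨i, j⟩ hij hne
    have hj : j ≠ 0 := by
      rintro rfl
      rw [Finset.HasAntidiagonal.mem_antidiagonal] at hij
      exact hne (by simp_all)
    have hj' : j ≠ p ^ r := by
      have := Finset.HasAntidiagonal.mem_antidiagonal.1 hij
      simp only at this
      omega
    rw [← Nat.cast_pow, Ring.choose_natCast, Int.cast_mul, Int.cast_natCast,
      (CharP.cast_eq_zero_iff k p _).2 (hp.dvd_choose_pow hj hj'), mul_zero]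
  · intro h; exact absurd (by simp) h

theorem cast_choose_add_mul_pow (r : ℕ) (z : ℤ) {n : ℕ} (hn : n < p ^ r) (t : ℤ) :
    ((Ring.choose (z + t * (p : ℤ) ^ r) n : ℤ) : k) = (Ring.choose z n : ℤ) := by
  induction t with
  | zero => simp
  | succ i ih =>
    rw [← ih, ← cast_choose_add_pow k p r (z + i * (p : ℤ) ^ r) hn]; congr 2; ring
  | pred i ih =>
    rw [← ih, ← cast_choose_add_pow k p r (z + (-(i : ℤ) - 1) * (p : ℤ) ^ r) hn]; congr 2; ring

/-- Lucas' congruence for one digit, with an arbitrary integer on top. -/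
theorem cast_choose_lucas {b n0 : ℕ} (hb : b < p) (hn : n0 < p) (t : ℤ) (N : ℕ) :
    ((Ring.choose (b + p * t) (n0 + p * N) : ℤ) : k)
      = (b.choose n0 : k) * (Ring.choose t N : ℤ) := by
  have hp : p.Prime := Fact.out
  -- it suffices to treat `t ≥ 0`, by periodicity
  obtain ⟨r, hr⟩ : ∃ r, n0 + p * N < p ^ r :=
    ⟨n0 + p * N, Nat.lt_pow_self hp.one_lt⟩
  have hN : N < p ^ r := lt_of_le_of_lt (by nlinarith [hp.pos]) hr
  obtain ⟨s, hs⟩ : ∃ s : ℕ, (s : ℤ) = t + t.natAbs * (p : ℤ) ^ r := by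
    refine ⟨(t + t.natAbs * (p : ℤ) ^ r).toNat, Int.toNat_of_nonneg ?_⟩
    have h1 : (1 : ℤ) ≤ (p : ℤ) ^ r := by exact_mod_cast Nat.one_le_pow _ _ hp.pos
    have h2 : -t ≤ t.natAbs := by omega
    nlinarith [Int.natCast_nonneg t.natAbs]
  have e1 := cast_choose_add_mul_pow k p r (b + p * t) hr (p * t.natAbs)
  have e2 := cast_choose_add_mul_pow k p r t hN t.natAbs
  rw [← e1, ← e2, ← hs, show (b : ℤ) + p * t + p * t.natAbs * (p : ℤ) ^ r = ((b + p * s : ℕ) : ℤ) by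
    rw [Nat.cast_add, Nat.cast_mul, hs]; ring, Ring.choose_natCast, Ring.choose_natCast]
  have l := @Choose.choose_modEq_choose_mod_mul_choose_div_nat (b + p * s) (n0 + p * N) p _
  rw [Nat.add_mul_mod_self_left, Nat.add_mul_mod_self_left, Nat.mod_eq_of_lt hb,
    Nat.mod_eq_of_lt hn, Nat.add_mul_div_left _ _ hp.pos, Nat.add_mul_div_left _ _ hp.pos,
    Nat.div_eq_of_lt hb, Nat.div_eq_of_lt hn, zero_add, zero_add] at l
  have l' := (CharP.cast_eq_iff_mod_eq k p).2 l
  push_cast at l' ⊢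
  exact l'

theorem cast_choose_add_mul_eq_zero {r a b : ℕ} (ha : a < p ^ r) (hb : b < p ^ r)
    (h : p ^ r ≤ a + b) : ((a + b).choose a : k) = 0 := by
  have e := cast_choose_add_pow k p r (((a + b - p ^ r : ℕ)) : ℤ) ha
  rw [show ((a + b - p ^ r : ℕ) : ℤ) + (p : ℤ) ^ r = ((a + b : ℕ) : ℤ) by
    push_cast [Nat.cast_sub h]; ring, Ring.choose_natCast, Ring.choose_natCast,
    Nat.choose_eq_zero_of_lt (n := a + b - p ^ r) (by omega)] at e
  simpa using e

theorem cast_choose_pow_ne_zero {i n : ℕ} (h1 : p ^ i ≤ n) (h2 : n < p ^ (i + 1)) :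
    (n.choose (p ^ i) : k) ≠ 0 := by
  have hp : p.Prime := Fact.out
  induction i generalizing n with
  | zero =>
    rw [pow_zero, Nat.choose_one_right, Ne, CharP.cast_eq_zero_iff k p]
    exact fun h => absurd (Nat.le_of_dvd (by rw [pow_zero] at h1; omega) h) (by simpa using h2)
  | succ i ih =>
    have l := cast_choose_lucas k p (Nat.mod_lt n hp.pos) hp.pos ((n / p : ℕ) : ℤ) (p ^ i)
    rw [Nat.choose_zero_right, zero_add, ← pow_succ',
      show ((n % p : ℕ) : ℤ) + p * ((n / p : ℕ) : ℤ) = (n : ℕ) by exact_mod_cast Nat.mod_add_div n p,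
      Ring.choose_natCast, Ring.choose_natCast] at l
    push_cast at l
    rw [l, one_mul]
    refine ih ?_ ?_
    · rw [Nat.le_div_iff_mul_le hp.pos, ← pow_succ]; exact h1
    · rw [Nat.div_lt_iff_lt_mul hp.pos, ← pow_succ]; exact h2

/-- The value of `Fr'` on `Y^(m) P(H) X^(m')`: the function `P` is replaced by
`z ↦ P (⌊z / p⌋)`. -/
theorem Fr'_dY_hp_dX (m m' : ℕ) {P Q : intPoly}
    (h : ∀ b < p, ∀ t : ℕ, (val Q (b + p * t) : k) = val P t) :
    Fr' k p (dY k m * hp k P * dX k m') = dY k (p * m) * hp k Q * dX k (p * m') := by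
  have hp' : p.Prime := Fact.out
  obtain ⟨c, hc⟩ := exists_newton P _ le_rfl
  generalize P.1.natDegree = d at hc
  have e : hp k Q = hp k (∑ n ∈ Finset.range (d + 1), c n • bin 0 (p * n)) := by
    refine hp_congr k p fun z => ?_
    have hz := Nat.mod_add_div z p
    have hb := Nat.mod_lt z hp'.pos
    have h1 := h (z % p) hb (z / p)
    rw [show (((z % p : ℕ) : ℤ) + p * ((z / p : ℕ) : ℤ)) = (z : ℤ) by exact_mod_cast hz] at h1
    rw [h1, hc, val_sum, val_sum]
    push_cast
    refine Finset.sum_congr rfl fun n _ => ?_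
    rw [val_zsmul, val_zsmul, val_bin, val_bin, add_zero, add_zero]
    have l := cast_choose_lucas k p hb hp'.pos ((z / p : ℕ) : ℤ) n
    rw [show (((z % p : ℕ) : ℤ) + p * ((z / p : ℕ) : ℤ)) = (z : ℤ) by exact_mod_cast hz, zero_add,
      Nat.choose_zero_right, Nat.cast_one, one_mul] at l
    push_cast [l]
    rfl
  rw [dY_hp_dX_eq_sum k m m' P hc, e, map_sum, map_sum, Finset.mul_sum, Finset.sum_mul]
  refine Finset.sum_congr rfl fun n _ => ?_
  rw [map_smul, Fr'_pbw, hp_zsmul, mul_smul_comm, smul_mul_assoc, pbw_eq, mul_comm m, mul_comm n,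
    mul_comm m']

/-- Every function `z ↦ P (⌊z / p⌋)` is, modulo `p`, given by an integer-valued polynomial. -/
theorem exists_frob (P : intPoly) :
    ∃ Q : intPoly, ∀ b < p, ∀ t : ℤ, (val Q (b + p * t) : k) = val P t := by
  have hp' : p.Prime := Fact.out
  obtain ⟨c, hc⟩ := exists_newton P _ le_rfl
  generalize P.1.natDegree = d at hc
  refine ⟨∑ n ∈ Finset.range (d + 1), c n • bin 0 (p * n), fun b hb t => ?_⟩
  conv_rhs => rw [hc]
  rw [val_sum, val_sum]
  push_cast
  refine Finset.sum_congr rfl fun n _ => ?_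
  rw [val_zsmul, val_zsmul, val_bin, val_bin, add_zero, add_zero]
  have l := cast_choose_lucas k p hb hp'.pos t n
  rw [zero_add, Nat.choose_zero_right, Nat.cast_one, one_mul] at l
  push_cast [l]
  rfl

end Lucas

end Hyper

/-! ### The algebra `A_r` as a span of basis elements -/

section Ar

variable (k : Type*) [Field k]

/-- The product of two elements of the form `Y^(m) P(H) X^(m')`. -/
theorem mul_formula (m m' n n' : ℕ) (P Q : intPoly) :
    (dY k m * hp k P * dX k m') * (dY k n * hp k Q * dX k n') =
      ∑ i ∈ Finset.range (min m' n + 1),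
        (((m + (n - i)).choose m : k) * ((m' - i + n').choose (m' - i) : k)) •
          (dY k (m + (n - i)) * hp k (shift (-2 * (n - i : ℕ)) P * bin (2 * i - m' - n) i *
            shift (-2 * (m' - i : ℕ)) Q) * dX k (m' - i + n')) := by
  have e : (dY k m * hp k P * dX k m') * (dY k n * hp k Q * dX k n') =
      dY k m * hp k P * (dX k m' * dY k n) * (hp k Q * dX k n') := by simp only [mul_assoc]
  rw [e, dX_mul_dY, Finset.mul_sum, Finset.sum_mul]
  refine Finset.sum_congr rfl fun i _ => ?_
  have e1 : dY k m * hp k P * (dY k (n - i) * hp k (bin (2 * i - m' - n) i) * dX k (m' - i)) *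
      (hp k Q * dX k n') = dY k m * (hp k P * dY k (n - i)) * hp k (bin (2 * i - m' - n) i) *
        ((dX k (m' - i) * hp k Q) * dX k n') := by simp only [mul_assoc]
  have e2 : dY k m * (dY k (n - i) * hp k (shift (-2 * (n - i : ℕ)) P)) *
      hp k (bin (2 * i - m' - n) i) * ((hp k (shift (-2 * (m' - i : ℕ)) Q) * dX k (m' - i)) * dX k n')
      = (dY k m * dY k (n - i)) * (hp k (shift (-2 * (n - i : ℕ)) P) * hp k (bin (2 * i - m' - n) i)
        * hp k (shift (-2 * (m' - i : ℕ)) Q)) * (dX k (m' - i) * dX k n') := by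
    simp only [mul_assoc]
  rw [e1, hp_mul_dY, dX_mul_hp, e2, dY_mul_dY, dX_mul_dX, ← map_mul, ← map_mul, smul_mul_assoc,
    smul_mul_assoc, mul_smul_comm, smul_smul]

/-- The span of the basis elements with indices in `s`. -/
def pbwSpan (s : Set (ℕ × ℕ × ℕ)) : Submodule k (U k) := Submodule.span k (pbwBasis k '' s)

theorem pbw_mem_pbwSpan {s : Set (ℕ × ℕ × ℕ)} {m n m' : ℕ} (h : (m, n, m') ∈ s) :
    pbw k m n m' ∈ pbwSpan k s :=
  Submodule.subset_span ⟨_, h, pbwBasis_apply k _⟩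

theorem pbwSpan_inter (s t : Set (ℕ × ℕ × ℕ)) {u : U k} (hs : u ∈ pbwSpan k s)
    (ht : u ∈ pbwSpan k t) : u ∈ pbwSpan k (s ∩ t) := by
  rw [pbwSpan, Module.Basis.mem_span_image] at *
  exact Set.subset_inter hs ht

/-- A linear property holds on `pbwSpan k s` if it holds for the basis elements. -/
theorem pbwSpan_induction {s : Set (ℕ × ℕ × ℕ)} {C : U k → Prop} (h0 : C 0)
    (hadd : ∀ u v, C u → C v → C (u + v)) (hsmul : ∀ (c : k) u, C u → C (c • u))
    (hmem : ∀ m n m', (m, n, m') ∈ s → C (dY k m * hp k (bin 0 n) * dX k m')) (u : U k)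
    (hu : u ∈ pbwSpan k s) : C u := by
  induction hu using Submodule.span_induction with
  | mem u h =>
    obtain ⟨t, ht, rfl⟩ := h
    rw [pbwBasis_apply, pbw_eq]
    exact hmem _ _ _ ht
  | zero => exact h0
  | add u v _ _ hu hv => exact hadd u v hu hv
  | smul a u _ hu => exact hsmul a u hu

/-- To see that a span of basis elements is closed under products, it suffices to multiply basis
elements. -/
theorem pbwSpan_mul_mem {s : Set (ℕ × ℕ × ℕ)} (h : ∀ m n m' l q l', (m, n, m') ∈ s →
    (l, q, l') ∈ s → (dY k m * hp k (bin 0 n) * dX k m') * (dY k l * hp k (bin 0 q) * dX k l')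
      ∈ pbwSpan k s) {u v : U k} (hu : u ∈ pbwSpan k s) (hv : v ∈ pbwSpan k s) :
    u * v ∈ pbwSpan k s := by
  refine pbwSpan_induction k (C := fun u => u * v ∈ pbwSpan k s) ?_ ?_ ?_ ?_ u hu
  · rw [zero_mul]; exact zero_mem _
  · intro u v hu hv; rw [add_mul]; exact add_mem hu hv
  · intro c u hu; rw [smul_mul_assoc]; exact Submodule.smul_mem _ _ hu
  intro m n m' hm
  refine pbwSpan_induction k (C := fun v => _ * v ∈ pbwSpan k s) ?_ ?_ ?_ ?_ v hv
  · rw [mul_zero]; exact zero_mem _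
  · intro u v hu hv; rw [mul_add]; exact add_mem hu hv
  · intro c u hu; rw [mul_smul_comm]; exact Submodule.smul_mem _ _ hu
  intro l q l' hl
  exact h m n m' l q l' hm hl

theorem dY_hp_dX_mem_pbwSpan {s : Set (ℕ × ℕ × ℕ)} {m m' : ℕ} (h : ∀ n, (m, n, m') ∈ s)
    (P : intPoly) : dY k m * hp k P * dX k m' ∈ pbwSpan k s := by
  obtain ⟨c, hc⟩ := exists_newton P _ le_rfl
  rw [dY_hp_dX_eq_sum k m m' P hc]
  exact Submodule.sum_mem _ fun n _ => Submodule.smul_mem _ _ (pbw_mem_pbwSpan k (h n))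

/-- The functions `z ↦ P z` which are periodic modulo `p`, of period `N`. -/
def IsPer (N : ℕ) (P : intPoly) : Prop := ∀ z : ℤ, (val P (z + N) : k) = val P z

theorem IsPer.mul {N : ℕ} {P Q : intPoly} (hP : IsPer k N P) (hQ : IsPer k N Q) :
    IsPer k N (P * Q) := fun z => by
  rw [val_mul, val_mul, Int.cast_mul, Int.cast_mul, hP, hQ]

theorem IsPer.shift {N : ℕ} {P : intPoly} (hP : IsPer k N P) (c : ℤ) :
    IsPer k N (shift c P) := fun z => by
  rw [val_shift, val_shift, add_right_comm, hP]

theorem IsPer.add_mul {N : ℕ} {P : intPoly} (hP : IsPer k N P) (z t : ℤ) :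
    (val P (z + N * t) : k) = val P z := by
  induction t with
  | zero => simp
  | succ i ih => rw [← ih, ← hP (z + N * i)]; congr 2; ring
  | pred i ih => rw [← ih, ← hP (z + N * (-i - 1))]; congr 2; ring

/-- The indices of the basis elements of weight zero. -/
def idx0 : Set (ℕ × ℕ × ℕ) := {t | t.1 = t.2.2}

theorem hp_mem_idx0 (P : intPoly) : hp k P ∈ pbwSpan k idx0 := by
  have := dY_hp_dX_mem_pbwSpan k (s := idx0) (m := 0) (m' := 0) (fun n => rfl) P
  rwa [dY_zero, dX_zero, one_mul, mul_one] at this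

theorem idx0_mul_mem {u v : U k} (hu : u ∈ pbwSpan k idx0) (hv : v ∈ pbwSpan k idx0) :
    u * v ∈ pbwSpan k idx0 := by
  refine pbwSpan_mul_mem k (fun m n m' l q l' hm hl => ?_) hu hv
  rw [mul_formula]
  refine Submodule.sum_mem _ fun i hi => ?_
  have hi' : i ≤ min m' l := Nat.lt_succ_iff.1 (Finset.mem_range.1 hi)
  change m = m' at hm
  change l = l' at hl
  exact Submodule.smul_mem _ _ (dY_hp_dX_mem_pbwSpan k (fun n => show m + (l - i) = m' - i + l' by
    omega) _)

theorem subA_le (p : ℕ) {u : U k} (hu : u ∈ subA k p) : u ∈ pbwSpan k idx0 := by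
  induction hu using Algebra.adjoin_induction with
  | mem u h =>
    rcases h with h | ⟨i, rfl⟩
    · induction h using Algebra.adjoin_induction with
      | mem u h =>
        obtain ⟨i, rfl⟩ := h
        rw [bH_eq]
        exact hp_mem_idx0 k _
      | algebraMap c =>
        rw [Algebra.algebraMap_eq_smul_one, ← map_one (hp k)]
        exact Submodule.smul_mem _ _ (hp_mem_idx0 k _)
      | add x y _ _ hx hy => exact add_mem hx hy
      | mul x y _ _ hx hy => exact idx0_mul_mem k hx hy
    · have := dY_hp_dX_mem_pbwSpan k (s := idx0) (m := p ^ i) (m' := p ^ i) (fun n => rfl) 1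
      rwa [map_one, mul_one] at this
  | algebraMap c =>
    rw [Algebra.algebraMap_eq_smul_one, ← map_one (hp k)]
    exact Submodule.smul_mem _ _ (hp_mem_idx0 k _)
  | add x y _ _ hx hy => exact add_mem hx hy
  | mul x y _ _ hx hy => exact idx0_mul_mem k hx hy

variable (p : ℕ) [Fact p.Prime] [CharP k p]

theorem isPer_bin (r : ℕ) (c : ℤ) {n : ℕ} (hn : n < p ^ r) : IsPer k (p ^ r) (bin c n) := fun z => by
  rw [val_bin, val_bin, add_right_comm]
  push_cast
  exact cast_choose_add_pow k p r _ hn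

/-- A function of period `p ^ r` is modulo `p` a combination of the `binom(z, n)`, `n < p ^ r`. -/
theorem IsPer.exists_eq_sum {r : ℕ} {P : intPoly} (hP : IsPer k (p ^ r) P) :
    ∃ c : ℕ → ℤ, hp k P = ∑ n ∈ Finset.range (p ^ r), (c n : k) • hp k (bin 0 n) := by
  have hp' : p.Prime := Fact.out
  have hpos : 0 < p ^ r := Nat.pow_pos hp'.pos
  obtain ⟨c, hc⟩ := exists_newton P (max P.1.natDegree (p ^ r)) (le_max_left _ _)
  generalize hd : max P.1.natDegree (p ^ r) = d at hc
  have hrd : p ^ r ≤ d := by rw [← hd]; exact le_max_right _ _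
  refine ⟨c, ?_⟩
  set Q : intPoly := ∑ n ∈ Finset.range (p ^ r), c n • bin 0 n with hQ
  have hQper : IsPer k (p ^ r) Q := fun z => by
    rw [hQ, val_sum, val_sum]
    push_cast
    refine Finset.sum_congr rfl fun n hn => ?_
    have := isPer_bin k p r 0 (Finset.mem_range.1 hn) z
    push_cast at this
    rw [val_zsmul, val_zsmul, Int.cast_mul, Int.cast_mul, this]
  have hlow : ∀ m < p ^ r, val P (m : ℕ) = val Q (m : ℕ) := by
    intro m hm
    rw [hc, hQ, val_sum, val_sum]
    refine (Finset.sum_subset (Finset.range_mono (by omega)) fun n _ hn => ?_).symm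
    rw [val_zsmul, val_bin, add_zero, Ring.choose_natCast, Nat.choose_eq_zero_of_lt (by
      rw [Finset.mem_range] at hn; omega)]
    simp
  have e : hp k P = hp k Q := hp_congr k p fun m => by
    have h1 := hP.add_mul k ((m % p ^ r : ℕ) : ℤ) ((m / p ^ r : ℕ) : ℤ)
    have h2 := hQper.add_mul k ((m % p ^ r : ℕ) : ℤ) ((m / p ^ r : ℕ) : ℤ)
    have h3 : ((m % p ^ r : ℕ) : ℤ) + ((p ^ r : ℕ) : ℤ) * ((m / p ^ r : ℕ) : ℤ) = (m : ℕ) := by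
      exact_mod_cast Nat.mod_add_div m (p ^ r)
    rw [h3] at h1 h2
    rw [h1, h2, hlow _ (Nat.mod_lt _ hpos)]
  rw [e, hQ, map_sum]
  exact Finset.sum_congr rfl fun n _ => hp_zsmul k _ _

theorem mem_pbwSpan_of_isPer {s : Set (ℕ × ℕ × ℕ)} {r m m' : ℕ} {P : intPoly}
    (hP : IsPer k (p ^ r) P) (h : ∀ n < p ^ r, (m, n, m') ∈ s) :
    dY k m * hp k P * dX k m' ∈ pbwSpan k s := by
  obtain ⟨c, hc⟩ := hP.exists_eq_sum k p
  rw [hc, Finset.mul_sum, Finset.sum_mul]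
  refine Submodule.sum_mem _ fun n hn => ?_
  rw [mul_smul_comm, smul_mul_assoc, ← pbw_eq]
  exact Submodule.smul_mem _ _ (pbw_mem_pbwSpan k (h n (Finset.mem_range.1 hn)))

/-- The indices of the basis elements of `U_r`. -/
def idxU (r : ℕ) : Set (ℕ × ℕ × ℕ) := {t | t.1 < p ^ r ∧ t.2.1 < p ^ r ∧ t.2.2 < p ^ r}

theorem Ur_le (r : ℕ) {u : U k} (hu : u ∈ Ur k p r) : u ∈ pbwSpan k (idxU p r) := by
  have hp' : p.Prime := Fact.out
  have hpos : 0 < p ^ r := Nat.pow_pos hp'.pos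
  have h1 : (1 : U k) ∈ pbwSpan k (idxU p r) := by
    have := pbw_mem_pbwSpan k (s := idxU p r) (m := 0) (n := 0) (m' := 0) ⟨hpos, hpos, hpos⟩
    rwa [pbw_eq, dY_zero, dX_zero, one_mul, mul_one,
      show bin 0 0 = 1 from intPoly_ext fun n => by simp, map_one] at this
  induction hu using Algebra.adjoin_induction with
  | mem u h =>
    obtain ⟨i, hi, h⟩ := h
    have hlt : p ^ i < p ^ r := Nat.pow_lt_pow_right hp'.one_lt hi
    have e : bin 0 0 = 1 := intPoly_ext fun n => by simp
    rcases h with rfl | rfl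
    · have := pbw_mem_pbwSpan k (s := idxU p r) (m := 0) (n := 0) (m' := p ^ i) ⟨hpos, hpos, hlt⟩
      rwa [pbw_eq, dY_zero, one_mul, e, map_one, one_mul] at this
    · have := pbw_mem_pbwSpan k (s := idxU p r) (m := p ^ i) (n := 0) (m' := 0) ⟨hlt, hpos, hpos⟩
      rwa [pbw_eq, dX_zero, mul_one, e, map_one, mul_one] at this
  | algebraMap c => rw [Algebra.algebraMap_eq_smul_one]; exact Submodule.smul_mem _ _ h1
  | add x y _ _ hx hy => exact add_mem hx hy
  | mul x y _ _ hx hy =>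
    refine pbwSpan_mul_mem k (fun m n m' l q l' hm hl => ?_) hx hy
    obtain ⟨hm1, hm2, hm3⟩ := hm
    obtain ⟨hl1, hl2, hl3⟩ := hl
    simp only at hm1 hm2 hm3 hl1 hl2 hl3
    rw [mul_formula]
    refine Submodule.sum_mem _ fun i hi => ?_
    have hi' : i ≤ min m' l := Nat.lt_succ_iff.1 (Finset.mem_range.1 hi)
    by_cases h1 : m + (l - i) < p ^ r
    · by_cases h2 : m' - i + l' < p ^ r
      · refine Submodule.smul_mem _ _ (mem_pbwSpan_of_isPer k p (r := r) ?_ fun n hn => ⟨h1, hn, h2⟩)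
        exact (((isPer_bin k p r 0 hm2).shift k _).mul k (isPer_bin k p r _ (by omega))).mul k
          ((isPer_bin k p r 0 hl2).shift k _)
      · rw [cast_choose_add_mul_eq_zero k p (r := r) (by omega) hl3 (by omega), mul_zero, zero_smul]
        exact zero_mem _
    · rw [cast_choose_add_mul_eq_zero k p (r := r) hm1 (by omega) (by omega), zero_mul, zero_smul]
      exact zero_mem _

/-- If `n > 0` then the divided power of exponent `n` is, up to a unit, the product of those of
exponents `p ^ i` and `n - p ^ i`, where `p ^ i` is the leading power of `p` in `n`. -/
theorem exists_leading_pow {n : ℕ} (hn : n ≠ 0) :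
    ∃ i, p ^ i ≤ n ∧ 0 < p ^ i ∧ (n.choose (p ^ i) : k) ≠ 0 := by
  have hp' : p.Prime := Fact.out
  exact ⟨Nat.log p n, Nat.pow_log_le_self p hn, Nat.pow_pos hp'.pos,
    cast_choose_pow_ne_zero k p (Nat.pow_log_le_self p hn) (Nat.lt_pow_succ_log_self hp'.one_lt n)⟩

theorem hp_mem_of_bin {S : Submodule k (U k)} {n : ℕ} (h : ∀ l ≤ n, hp k (bin 0 l) ∈ S)
    (P : intPoly) (hP : P.1.natDegree ≤ n) : hp k P ∈ S := by
  obtain ⟨c, hc⟩ := exists_newton P n hP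
  rw [hc, map_sum]
  refine Submodule.sum_mem _ fun l hl => ?_
  rw [hp_zsmul]
  exact Submodule.smul_mem _ _ (h l (Nat.lt_succ_iff.1 (Finset.mem_range.1 hl)))

theorem hp_mem_U0 (P : intPoly) : hp k P ∈ U0 k p := by
  have key : ∀ n, hp k (bin 0 n) ∈ U0 k p := by
    intro n
    induction n using Nat.strong_induction_on with
    | _ n ih =>
      rcases eq_or_ne n 0 with rfl | hn
      · rw [show bin 0 0 = 1 from intPoly_ext fun n => by simp, map_one]
        exact one_mem _
      obtain ⟨i, hi, hpos, hne⟩ := exists_leading_pow k p hn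
      have e : ((n.choose (p ^ i) : ℕ) : ℤ) • bin 0 n
          = bin 0 (p ^ i) * bin (-(p ^ i : ℕ)) (n - p ^ i) := by
        refine intPoly_ext fun m => ?_
        rw [val_zsmul, val_mul, val_bin, val_bin, val_bin]
        have := Ring.choose_add_smul_choose ((m : ℤ) + -((p ^ i : ℕ) : ℤ)) (n - p ^ i) (p ^ i)
        rw [Nat.sub_add_cancel hi, neg_add_cancel_right, nsmul_eq_mul] at this
        rw [add_zero]
        exact this
      have e2 := congrArg (hp k) e
      rw [hp_zsmul, map_mul, Int.cast_natCast] at e2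
      rw [← inv_smul_smul₀ hne (hp k (bin 0 n)), e2]
      refine Subalgebra.smul_mem _ (mul_mem ?_ ?_) _
      · exact Algebra.subset_adjoin ⟨i, (bH_eq k 0 _).symm⟩
      · exact hp_mem_of_bin k (S := Subalgebra.toSubmodule (U0 k p)) (n := n - p ^ i)
          (fun l hl => ih l (by omega)) _ (natDegree_bin_le _ _)
  exact hp_mem_of_bin k (S := Subalgebra.toSubmodule (U0 k p)) (fun l _ => key l) _ le_rfl

theorem hp_mem_subA (P : intPoly) : hp k P ∈ subA k p :=
  Algebra.subset_adjoin (Or.inl (hp_mem_U0 k p P))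

theorem dY_mul_dX_mem_subA (m : ℕ) : dY k m * dX k m ∈ subA k p := by
  induction m using Nat.strong_induction_on with
  | _ m ih =>
    rcases eq_or_ne m 0 with rfl | hm
    · rw [dY_zero, dX_zero, one_mul]; exact one_mem _
    obtain ⟨i, hi, hpos, hne⟩ := exists_leading_pow k p hm
    have e := mul_formula k (p ^ i) (p ^ i) (m - p ^ i) (m - p ^ i) 1 1
    simp only [map_one, mul_one, one_mul] at e
    rw [Finset.sum_range_succ', Nat.sub_zero, Nat.sub_zero, Nat.add_sub_cancel' hi,
      show ∀ c, bin c 0 = 1 from fun c => intPoly_ext fun n => by simp, map_one, mul_one] at e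
    have hmem : (((m.choose (p ^ i) : k) * (m.choose (p ^ i) : k))) • (dY k m * dX k m)
        ∈ subA k p := by
      rw [← sub_eq_iff_eq_add'.2 e]
      refine sub_mem (mul_mem (Algebra.subset_adjoin (Or.inr ⟨i, rfl⟩)) (ih _ (by omega)))
        (sum_mem fun j hj => ?_)
      rw [Finset.mem_range] at hj
      rw [show p ^ i - (j + 1) + (m - p ^ i) = p ^ i + (m - p ^ i - (j + 1)) by omega,
        dY_mul_hp, mul_assoc]
      exact Subalgebra.smul_mem _ (mul_mem (hp_mem_subA k p _) (ih _ (by omega))) _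
    rw [← inv_smul_smul₀ (mul_ne_zero hne hne) (dY k m * dX k m)]
    exact Subalgebra.smul_mem _ hmem _

theorem dX_mem_Ur {r m : ℕ} (hm : m < p ^ r) : dX k m ∈ Ur k p r := by
  have hp' : p.Prime := Fact.out
  induction m using Nat.strong_induction_on with
  | _ m ih =>
    rcases eq_or_ne m 0 with rfl | hm0
    · rw [dX_zero]; exact one_mem _
    obtain ⟨i, hi, hpos, hne⟩ := exists_leading_pow k p hm0
    have e := dX_mul_dX k (p ^ i) (m - p ^ i)
    rw [Nat.add_sub_cancel' hi] at e
    rw [← inv_smul_smul₀ hne (dX k m), ← e]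
    exact Subalgebra.smul_mem _ (mul_mem (Algebra.subset_adjoin (s := {u | ∃ i < r, u = dX k (p ^ i) ∨ u = dY k (p ^ i)})
      ⟨i, (Nat.pow_lt_pow_iff_right hp'.one_lt).1 (hi.trans_lt hm), Or.inl rfl⟩)
      (ih _ (by omega) (by omega))) _

theorem dY_mem_Ur {r m : ℕ} (hm : m < p ^ r) : dY k m ∈ Ur k p r := by
  have hp' : p.Prime := Fact.out
  induction m using Nat.strong_induction_on with
  | _ m ih =>
    rcases eq_or_ne m 0 with rfl | hm0
    · rw [dY_zero]; exact one_mem _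
    obtain ⟨i, hi, hpos, hne⟩ := exists_leading_pow k p hm0
    have e := dY_mul_dY k (p ^ i) (m - p ^ i)
    rw [Nat.add_sub_cancel' hi] at e
    rw [← inv_smul_smul₀ hne (dY k m), ← e]
    exact Subalgebra.smul_mem _ (mul_mem (Algebra.subset_adjoin (s := {u | ∃ i < r, u = dX k (p ^ i) ∨ u = dY k (p ^ i)})
      ⟨i, (Nat.pow_lt_pow_iff_right hp'.one_lt).1 (hi.trans_lt hm), Or.inr rfl⟩)
      (ih _ (by omega) (by omega))) _

theorem bin_mem_Ur {r n : ℕ} (hn : n < p ^ r) : hp k (bin 0 n) ∈ Ur k p r := by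
  induction n using Nat.strong_induction_on with
  | _ n ih =>
    have e := dX_mul_dY k n n
    rw [min_self, Finset.sum_range_succ, Nat.sub_self, dX_zero, dY_zero, one_mul, mul_one,
      show (2 * (n : ℤ) - n - n) = 0 by ring] at e
    rw [← sub_eq_iff_eq_add'.2 e]
    refine sub_mem (mul_mem (dX_mem_Ur k p hn) (dY_mem_Ur k p hn)) (sum_mem fun i hi => ?_)
    rw [Finset.mem_range] at hi
    refine mul_mem (mul_mem (dY_mem_Ur k p (by omega)) ?_) (dX_mem_Ur k p (by omega))
    exact hp_mem_of_bin k (S := Subalgebra.toSubmodule (Ur k p r)) (n := i)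
      (fun l hl => ih l (by omega) (by omega)) _ (natDegree_bin_le _ _)

/-- The indices of the basis elements of `A_r`. -/
def idxA (r : ℕ) : Set (ℕ × ℕ × ℕ) := {t | t.1 = t.2.2 ∧ t.1 < p ^ r ∧ t.2.1 < p ^ r}

/-- `A_r` is spanned by the elements `Y^(m) (H choose n) X^(m)` with `m, n < p ^ r`. -/
theorem mem_Ar_iff (r : ℕ) {u : U k} : u ∈ Ar k p r ↔ u ∈ pbwSpan k (idxA p r) := by
  constructor
  · intro hu
    have h1 := subA_le k p hu.1
    have h2 := Ur_le k p r hu.2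
    have h3 := pbwSpan_inter k _ _ h1 h2
    refine Submodule.span_mono (Set.image_mono ?_) h3
    rintro t ⟨h1, h2, h3, h4⟩
    exact ⟨h1, h2, h3⟩
  · intro hu
    refine pbwSpan_induction k (C := fun u => u ∈ Ar k p r) (zero_mem _) (fun u v => add_mem)
      (fun c u hu => Subalgebra.smul_mem _ hu c) ?_ u hu
    rintro m n m' ⟨h1, h2, h3⟩
    change m = m' at h1
    subst h1
    refine ⟨?_, mul_mem (mul_mem (dY_mem_Ur k p h2) (bin_mem_Ur k p h3)) (dX_mem_Ur k p h2)⟩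
    rw [dY_mul_hp, mul_assoc]
    exact mul_mem (hp_mem_subA k p _) (dY_mul_dX_mem_subA k p m)

end Ar

/-! ### The weight-zero part of the first Frobenius kernel -/

theorem commute_of_mem_adjoin {R A : Type*} [CommRing R] [Ring A] [Algebra R A] {s : Set A} {u : A}
    (h : ∀ a ∈ s, a * u = u * a) {w : A} (hw : w ∈ Algebra.adjoin R s) : w * u = u * w := by
  induction hw using Algebra.adjoin_induction with
  | mem a ha => exact h a ha
  | algebraMap c => exact Algebra.commutes c u
  | add a b _ _ ha hb => rw [add_mul, mul_add, ha, hb]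
  | mul a b _ _ ha hb => rw [mul_assoc, hb, ← mul_assoc, ha, mul_assoc]

section WeightZero

variable (k : Type*) [Field k]

theorem smul_eq_algebraMap_mul (c : k) (u : U k) : c • u = algebraMap k (U k) c * u :=
  Algebra.smul_def c u

theorem dX_comm (m n : ℕ) : dX k m * dX k n = dX k n * dX k m := by
  rw [dX_mul_dX, dX_mul_dX, add_comm n m, Nat.choose_symm_add]

theorem dY_comm (m n : ℕ) : dY k m * dY k n = dY k n * dY k m := by
  rw [dY_mul_dY, dY_mul_dY, add_comm n m, Nat.choose_symm_add]

theorem dX_one_pow (m : ℕ) : dX k 1 ^ m = (m.factorial : k) • dX k m := by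
  induction m with
  | zero => simp [dX_zero]
  | succ m ih =>
    rw [pow_succ, ih, smul_mul_assoc, dX_mul_dX, smul_smul, Nat.choose_succ_self_right,
      Nat.factorial_succ]
    push_cast
    rw [mul_comm]

theorem dY_one_pow (m : ℕ) : dY k 1 ^ m = (m.factorial : k) • dY k m := by
  induction m with
  | zero => simp [dY_zero]
  | succ m ih =>
    rw [pow_succ, ih, smul_mul_assoc, dY_mul_dY, smul_smul, Nat.choose_succ_self_right,
      Nat.factorial_succ]
    push_cast
    rw [mul_comm]

theorem dX_comm_pow (m s : ℕ) : dX k m * dX k 1 ^ s = dX k 1 ^ s * dX k m := by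
  rw [dX_one_pow, mul_smul_comm, smul_mul_assoc, dX_comm]

theorem dY_comm_pow (m s : ℕ) : dY k m * dY k 1 ^ s = dY k 1 ^ s * dY k m := by
  rw [dY_one_pow, mul_smul_comm, smul_mul_assoc, dY_comm]

/-- The element `H`. -/
def eH : U k := hp k (bin 0 1)

/-- The element `YX`. -/
def eT : U k := dY k 1 * dX k 1

theorem dX_mul_dY_one : dX k 1 * dY k 1 = eT k + eH k := by
  rw [dX_mul_dY, min_self, Finset.sum_range_succ, Finset.sum_range_one, eT, eH]
  simp [dX_zero, dY_zero, show ∀ c, bin c 0 = 1 from fun c => intPoly_ext fun n => by simp]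

theorem shift_bin_one (c : ℤ) : shift c (bin 0 1) = bin 0 1 + c • 1 :=
  intPoly_ext fun n => by
    rw [val_add, val_zsmul, val_shift, val_bin, val_bin]
    simp

theorem eH_mul_dX : eH k * dX k 1 = dX k 1 * (eH k + 2) := by
  rw [eH, hp_mul_dX, shift_bin_one, map_add, map_zsmul, map_one]
  congr 2
  norm_num

theorem dY_mul_eH : dY k 1 * eH k = (eH k + 2) * dY k 1 := by
  rw [eH, dY_mul_hp, shift_bin_one, map_add, map_zsmul, map_one]
  congr 2
  norm_num

theorem eT_mul_dX : eT k * dX k 1 = dX k 1 * (eT k - eH k - 2) := by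
  have e1 : dX k 1 * eT k = (eT k + eH k) * dX k 1 := by
    rw [← dX_mul_dY_one, eT, mul_assoc]
  rw [sub_sub, mul_sub, e1, ← eH_mul_dX]
  noncomm_ring

theorem dY_mul_eT : dY k 1 * eT k = (eT k - eH k - 2) * dY k 1 := by
  have e1 : eT k * dY k 1 = dY k 1 * (eT k + eH k) := by
    rw [← dX_mul_dY_one, eT, mul_assoc]
  rw [sub_sub, sub_mul, e1, ← dY_mul_eH]
  noncomm_ring

theorem hp_mul_eT (P : intPoly) : hp k P * eT k = eT k * hp k P := by
  rw [eT, ← mul_assoc, hp_mul_dY, mul_assoc, hp_mul_dX, shift_shift, mul_assoc]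
  simp [shift_zero]

variable (p : ℕ) [Fact p.Prime] [CharP k p]

/-- The subalgebra generated by `YX` and the `P(H)` which are periodic of period `p`; it is the
weight-zero part of `U_1`. -/
def algD (p : ℕ) : Subalgebra k (U k) :=
  Algebra.adjoin k ({eT k} ∪ {u | ∃ P, IsPer k p P ∧ u = hp k P})

variable {k p} in
theorem hp_mem_algD {p : ℕ} {P : intPoly} (hP : IsPer k p P) : hp k P ∈ algD k p :=
  Algebra.subset_adjoin (Or.inr ⟨P, hP, rfl⟩)

theorem eT_mem_algD (p : ℕ) : eT k ∈ algD k p := Algebra.subset_adjoin (Or.inl rfl)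

theorem isPer_bin_one (c : ℤ) {n : ℕ} (hn : n < p) : IsPer k p (bin c n) := by
  have := isPer_bin k p 1 c (n := n) (by rwa [pow_one])
  rwa [pow_one] at this

theorem eH_mem_algD : eH k ∈ algD k p :=
  hp_mem_algD (isPer_bin_one k p 0 (Fact.out : p.Prime).one_lt)

theorem algD_comm {p : ℕ} {u v : U k} (hu : u ∈ algD k p) (hv : v ∈ algD k p) : u * v = v * u := by
  refine commute_of_mem_adjoin (fun a ha => ?_) hu
  refine (commute_of_mem_adjoin (fun b hb => ?_) hv).symm
  rcases ha with rfl | ⟨P, -, rfl⟩ <;> rcases hb with rfl | ⟨Q, -, rfl⟩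
  · rfl
  · exact hp_mul_eT k Q
  · exact (hp_mul_eT k P).symm
  · rw [← map_mul, ← map_mul, mul_comm]

theorem hp_mul_dX_of_isPer (p : ℕ) [CharP k p] {P : intPoly} (hP : IsPer k p P) (M : ℕ) :
    hp k P * dX k (p * M) = dX k (p * M) * hp k P := by
  rw [hp_mul_dX]
  congr 1
  refine hp_congr k p fun n => ?_
  rw [val_shift, ← hP.add_mul k n (2 * M)]
  congr 2
  push_cast
  ring

theorem hp_mul_dY_of_isPer (p : ℕ) [CharP k p] {P : intPoly} (hP : IsPer k p P) (M : ℕ) :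
    hp k P * dY k (p * M) = dY k (p * M) * hp k P := by
  rw [hp_mul_dY]
  congr 1
  refine hp_congr k p fun n => ?_
  rw [val_shift, ← hP.add_mul k n (-2 * M)]
  congr 2
  push_cast
  ring

theorem algD_mul_dX (p : ℕ) [CharP k p] {w : U k} (hw : w ∈ algD k p) (M : ℕ) :
    w * dX k (p * M) = dX k (p * M) * w := by
  refine commute_of_mem_adjoin (fun a ha => ?_) hw
  rcases ha with rfl | ⟨P, hP, rfl⟩
  · rcases Nat.eq_zero_or_pos (p * M) with h | h
    · rw [h, dX_zero, one_mul, mul_one]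
    have e := dX_mul_dY k (p * M) 1
    rw [min_eq_right h, Finset.sum_range_succ, Finset.sum_range_one, Nat.sub_zero,
      show ∀ c, bin c 0 = 1 from fun c => intPoly_ext fun n => by simp, map_one, mul_one,
      Nat.sub_zero] at e
    have e2 : dX k (p * M - 1) * dX k 1 = 0 := by
      rw [dX_mul_dX, Nat.sub_add_cancel h, Nat.choose_symm (show 1 ≤ p * M from h),
        Nat.choose_one_right, Nat.cast_mul, CharP.cast_eq_zero, zero_mul, zero_smul]
    rw [eT, ← mul_assoc, e, add_mul, mul_assoc _ (dX k (p * M - 1)), e2, mul_zero, add_zero,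
      mul_assoc, mul_assoc, dX_comm]
  · exact hp_mul_dX_of_isPer k p hP M

theorem algD_mul_dY (p : ℕ) [CharP k p] {w : U k} (hw : w ∈ algD k p) (M : ℕ) :
    w * dY k (p * M) = dY k (p * M) * w := by
  refine commute_of_mem_adjoin (fun a ha => ?_) hw
  rcases ha with rfl | ⟨P, hP, rfl⟩
  · rcases Nat.eq_zero_or_pos (p * M) with h | h
    · rw [h, dY_zero, one_mul, mul_one]
    have e := dX_mul_dY k 1 (p * M)
    rw [min_eq_left h, Finset.sum_range_succ, Finset.sum_range_one, Nat.sub_zero,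
      show ∀ c, bin c 0 = 1 from fun c => intPoly_ext fun n => by simp, map_one, mul_one,
      Nat.sub_zero] at e
    have e2 : dY k 1 * dY k (p * M - 1) = 0 := by
      rw [dY_mul_dY, Nat.add_sub_cancel' h, Nat.choose_one_right, Nat.cast_mul, CharP.cast_eq_zero,
        zero_mul, zero_smul]
    rw [eT, mul_assoc, e, mul_add, ← mul_assoc, ← mul_assoc, ← mul_assoc, e2, zero_mul, zero_mul,
      add_zero, ← mul_assoc, dY_comm]
  · exact hp_mul_dY_of_isPer k p hP M

/-- Moving an element of `algD` across `Y`, and back across `X`. -/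
theorem exists_algD_shift {w : U k} (hw : w ∈ algD k p) : ∃ w' ∈ algD k p,
    w * dY k 1 = dY k 1 * w' ∧ w' * dX k 1 = dX k 1 * w := by
  induction hw using Algebra.adjoin_induction with
  | mem a ha =>
    rcases ha with rfl | ⟨P, hP, rfl⟩
    · refine ⟨dX k 1 * dY k 1, ?_, ?_, ?_⟩
      · rw [dX_mul_dY_one]
        exact add_mem (eT_mem_algD k p) (eH_mem_algD k p)
      · rw [eT, mul_assoc]
      · rw [eT, mul_assoc]
    · exact ⟨_, hp_mem_algD (hP.shift k (-2 * (1 : ℕ))), hp_mul_dY k P 1, (dX_mul_hp k P 1).symm⟩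
  | algebraMap c =>
    exact ⟨algebraMap k _ c, Subalgebra.algebraMap_mem _ c, Algebra.commutes _ _,
      Algebra.commutes _ _⟩
  | add a b _ _ ha hb =>
    obtain ⟨a', ha', h1, h2⟩ := ha
    obtain ⟨b', hb', h3, h4⟩ := hb
    exact ⟨a' + b', add_mem ha' hb', by rw [add_mul, mul_add, h1, h3],
      by rw [add_mul, mul_add, h2, h4]⟩
  | mul a b hma hmb ha hb =>
    obtain ⟨a', ha', h1, h2⟩ := ha
    obtain ⟨b', hb', h3, h4⟩ := hb
    refine ⟨a' * b', mul_mem ha' hb', ?_, ?_⟩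
    · rw [mul_assoc, h3, ← mul_assoc, h1, mul_assoc]
    · rw [mul_assoc, h4, ← mul_assoc, h2, mul_assoc]

/-- Moving an element of `algD` across `X`, and back across `Y`. -/
theorem exists_algD_unshift {w : U k} (hw : w ∈ algD k p) : ∃ w' ∈ algD k p,
    w' * dY k 1 = dY k 1 * w ∧ w * dX k 1 = dX k 1 * w' := by
  induction hw using Algebra.adjoin_induction with
  | mem a ha =>
    rcases ha with rfl | ⟨P, hP, rfl⟩
    · refine ⟨eT k - eH k - 2, ?_, (dY_mul_eT k).symm, eT_mul_dX k⟩
      exact sub_mem (sub_mem (eT_mem_algD k p) (eH_mem_algD k p)) (ofNat_mem _ 2)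
    · exact ⟨_, hp_mem_algD (hP.shift k (2 * (1 : ℕ))), (dY_mul_hp k P 1).symm, hp_mul_dX k P 1⟩
  | algebraMap c =>
    exact ⟨algebraMap k _ c, Subalgebra.algebraMap_mem _ c, Algebra.commutes _ _,
      Algebra.commutes _ _⟩
  | add a b _ _ ha hb =>
    obtain ⟨a', ha', h1, h2⟩ := ha
    obtain ⟨b', hb', h3, h4⟩ := hb
    exact ⟨a' + b', add_mem ha' hb', by rw [add_mul, mul_add, h1, h3],
      by rw [add_mul, mul_add, h2, h4]⟩
  | mul a b hma hmb ha hb =>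
    obtain ⟨a', ha', h1, h2⟩ := ha
    obtain ⟨b', hb', h3, h4⟩ := hb
    refine ⟨a' * b', mul_mem ha' hb', ?_, ?_⟩
    · rw [mul_assoc, h3, ← mul_assoc, h1, mul_assoc]
    · rw [mul_assoc, h4, ← mul_assoc, h2, mul_assoc]

theorem exists_algD_shift_pow {w : U k} (hw : w ∈ algD k p) (s : ℕ) : ∃ w' ∈ algD k p,
    w * dY k 1 ^ s = dY k 1 ^ s * w' ∧ w' * dX k 1 ^ s = dX k 1 ^ s * w := by
  induction s with
  | zero => exact ⟨w, hw, by simp, by simp⟩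
  | succ s ih =>
    obtain ⟨a, ha, h1, h2⟩ := ih
    obtain ⟨b, hb, h3, h4⟩ := exists_algD_shift k p ha
    refine ⟨b, hb, ?_, ?_⟩
    · rw [pow_succ, ← mul_assoc, h1, mul_assoc, h3, mul_assoc]
    · rw [pow_succ', ← mul_assoc, h4, mul_assoc, h2, mul_assoc]

theorem dY_mul_algD_mul_dX {w : U k} (hw : w ∈ algD k p) (s : ℕ) :
    dY k 1 ^ s * w * dX k 1 ^ s ∈ algD k p := by
  induction s generalizing w with
  | zero => simpa using hw
  | succ s ih =>
    obtain ⟨b, hb, h3, h4⟩ := exists_algD_unshift k p hw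
    have e : dY k 1 ^ (s + 1) * w * dX k 1 ^ (s + 1) = dY k 1 ^ s * (eT k * b) * dX k 1 ^ s := by
      rw [pow_succ, pow_succ' (dX k 1)]
      simp only [eT, mul_assoc]
      rw [← mul_assoc w, h4, mul_assoc]
    rw [e]
    exact ih (mul_mem (eT_mem_algD k p) hb)

theorem dX_mul_algD_mul_dY {w : U k} (hw : w ∈ algD k p) (s : ℕ) :
    dX k 1 ^ s * w * dY k 1 ^ s ∈ algD k p := by
  induction s generalizing w with
  | zero => simpa using hw
  | succ s ih =>
    obtain ⟨b, hb, h3, h4⟩ := exists_algD_shift k p hw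
    have e : dX k 1 ^ (s + 1) * w * dY k 1 ^ (s + 1)
        = dX k 1 ^ s * ((eT k + eH k) * b) * dY k 1 ^ s := by
      rw [pow_succ, pow_succ' (dY k 1), ← dX_mul_dY_one]
      simp only [mul_assoc]
      rw [← mul_assoc w, h3, mul_assoc]
    rw [e]
    exact ih (mul_mem (add_mem (eT_mem_algD k p) (eH_mem_algD k p)) hb)

/-! ### The idempotents `μ_a` -/

theorem mu_eq (p : ℕ) (a : ℤ) : mu k p a = hp k (bin (-a - 1) (p - 1)) := bH_eq k _ _

theorem isPer_mu (a : ℤ) : IsPer k p (bin (-a - 1) (p - 1)) :=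
  isPer_bin_one k p _ (Nat.sub_lt (Fact.out : p.Prime).pos one_pos)

theorem mu_mem_algD (a : ℤ) : mu k p a ∈ algD k p := by
  rw [mu_eq]; exact hp_mem_algD (isPer_mu k p a)

/-- `μ_a` corresponds to the indicator function of the residue class of `a`. -/
theorem val_mu (a z : ℤ) :
    (val (bin (-a - 1) (p - 1)) z : k) = if (p : ℤ) ∣ z - a then 1 else 0 := by
  have hp' : p.Prime := Fact.out
  have hp0 : (0 : ℤ) < p := by exact_mod_cast hp'.pos
  obtain ⟨b, hb⟩ : ∃ b : ℕ, (b : ℤ) = (z - a - 1) % p :=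
    ⟨((z - a - 1) % p).toNat, Int.toNat_of_nonneg (Int.emod_nonneg _ hp0.ne')⟩
  have hbp : b < p := by
    have := Int.emod_lt_of_pos (z - a - 1) hp0
    rw [← hb] at this
    exact_mod_cast this
  have h1 := Int.emod_add_mul_ediv (z - a - 1) p
  rw [← hb] at h1
  have l := cast_choose_lucas k p hbp (Nat.sub_lt hp'.pos one_pos) ((z - a - 1) / p) 0
  rw [mul_zero, add_zero, Ring.choose_zero_right, h1] at l
  rw [val_bin, show z + (-a - 1) = z - a - 1 by ring, l, Int.cast_one, mul_one]
  have hz : z - a = p * ((z - a - 1) / p) + (b + 1) := by linarith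
  split_ifs with h
  · have : (p : ℤ) ∣ (b + 1 : ℕ) := by
      push_cast
      rw [hz] at h
      exact (Int.dvd_add_right (dvd_mul_right _ _)).1 h
    have h3 := Nat.le_of_dvd (Nat.succ_pos b) (Int.natCast_dvd_natCast.1 this)
    rw [show b = p - 1 by omega, Nat.choose_self, Nat.cast_one]
  · have : b ≠ p - 1 := by
      rintro rfl
      apply h
      rw [hz, show (((p - 1 : ℕ) : ℤ) + 1) = p by rw [Nat.cast_sub hp'.one_lt.le]; ring]
      exact dvd_add (dvd_mul_right _ _) dvd_rfl
    rw [Nat.choose_eq_zero_of_lt (by omega), Nat.cast_zero]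

theorem hp_mul_mu_congr {a : ℤ} {P Q : intPoly}
    (h : ∀ z : ℤ, (p : ℤ) ∣ z - a → (val P z : k) = val Q z) :
    hp k P * mu k p a = hp k Q * mu k p a := by
  rw [mu_eq, ← map_mul, ← map_mul]
  refine hp_congr k p fun n => ?_
  rw [val_mul, val_mul, Int.cast_mul, Int.cast_mul, val_mu]
  split_ifs with hd
  · rw [h _ hd]
  · simp

theorem mu_congr {a b : ℤ} (h : (p : ℤ) ∣ a - b) : mu k p a = mu k p b := by
  rw [mu_eq, mu_eq]
  refine hp_congr k p fun n => ?_
  rw [val_mu, val_mu, show (n : ℤ) - b = n - a + (a - b) by ring]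
  exact if_congr (Int.dvd_add_left h).symm rfl rfl

theorem mu_mul_self (a : ℤ) : mu k p a * mu k p a = mu k p a := by
  have := hp_mul_mu_congr k p (a := a) (P := bin (-a - 1) (p - 1)) (Q := 1) (fun z hz => by
    rw [val_mu, if_pos hz]; simp)
  rwa [map_one, one_mul, ← mu_eq] at this

theorem hp_mul_mu {P : intPoly} (hP : IsPer k p P) (a : ℤ) :
    hp k P * mu k p a = (val P a : k) • mu k p a := by
  have := hp_mul_mu_congr k p (a := a) (P := P) (Q := val P a • 1) (fun z hz => by
    obtain ⟨t, ht⟩ := hz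
    rw [show z = a + p * t by linarith, hP.add_mul, val_zsmul, val_one, mul_one])
  rw [this, hp_zsmul, map_one, smul_mul_assoc, one_mul]

theorem eH_mul_mu (a : ℤ) : eH k * mu k p a = (a : k) • mu k p a := by
  rw [eH, hp_mul_mu k p (isPer_bin_one k p 0 (Fact.out : p.Prime).one_lt), val_bin]
  simp

theorem dX_mul_mu (p : ℕ) (a : ℤ) (m : ℕ) : dX k m * mu k p a = mu k p (a + 2 * m) * dX k m := by
  rw [mu_eq, dX_mul_hp, shift_bin, mu_eq]
  congr 3; ring

theorem mu_mul_dY (p : ℕ) (a : ℤ) (m : ℕ) : mu k p a * dY k m = dY k m * mu k p (a + 2 * m) := by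
  rw [mu_eq, hp_mul_dY, shift_bin, mu_eq]
  congr 3; ring

theorem dX_pow_mul_mu (p : ℕ) (a : ℤ) (m : ℕ) :
    dX k 1 ^ m * mu k p a = mu k p (a + 2 * m) * dX k 1 ^ m := by
  rw [dX_one_pow, smul_mul_assoc, dX_mul_mu, mul_smul_comm]

theorem mu_mul_dY_pow (p : ℕ) (a : ℤ) (m : ℕ) :
    mu k p a * dY k 1 ^ m = dY k 1 ^ m * mu k p (a + 2 * m) := by
  rw [dY_one_pow, mul_smul_comm, mu_mul_dY, smul_mul_assoc]

theorem aeval_eT_mem (p : ℕ) (g : Polynomial k) : Polynomial.aeval (eT k) g ∈ algD k p := by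
  induction g using Polynomial.induction_on' with
  | add f g hf hg => rw [map_add]; exact add_mem hf hg
  | monomial n a =>
    rw [Polynomial.aeval_monomial]
    exact mul_mem (Subalgebra.algebraMap_mem _ _) (pow_mem (eT_mem_algD k p) n)

/-- On the weight `a`, every element of `algD` is a polynomial in `YX`. -/
theorem exists_aeval_mul_mu {w : U k} (hw : w ∈ algD k p) (a : ℤ) :
    ∃ g : Polynomial k, w * mu k p a = Polynomial.aeval (eT k) g * mu k p a := by
  induction hw using Algebra.adjoin_induction with
  | mem u hu =>
    rcases hu with rfl | ⟨P, hP, rfl⟩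
    · exact ⟨Polynomial.X, by rw [Polynomial.aeval_X]⟩
    · exact ⟨Polynomial.C (val P a : k), by
        rw [hp_mul_mu k p hP, Polynomial.aeval_C, smul_eq_algebraMap_mul]⟩
  | algebraMap c => exact ⟨Polynomial.C c, by rw [Polynomial.aeval_C]⟩
  | add u v _ _ hu hv =>
    obtain ⟨f, hf⟩ := hu
    obtain ⟨g, hg⟩ := hv
    exact ⟨f + g, by rw [add_mul, hf, hg, map_add, add_mul]⟩
  | mul u v hmu hmv hu hv =>
    obtain ⟨f, hf⟩ := hu
    obtain ⟨g, hg⟩ := hv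
    refine ⟨g * f, ?_⟩
    rw [mul_assoc, hg, ← mul_assoc, algD_comm k hmu (aeval_eT_mem k p g), mul_assoc, hf, map_mul,
      mul_assoc]

theorem eT_mul_dX_pow_mul_mu (a : ℤ) (l : ℕ) : eT k * dX k 1 ^ l * mu k p a =
    dX k 1 ^ l * (eT k - algebraMap k (U k) (l * (l + a + 1))) * mu k p a := by
  induction l with
  | zero => simp
  | succ l ih =>
    have e1 : eT k * dX k 1 ^ (l + 1) * mu k p a
        = dX k 1 * (eT k * dX k 1 ^ l * mu k p a - eH k * (dX k 1 ^ l * mu k p a)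
          - 2 * (dX k 1 ^ l * mu k p a)) := by
      rw [pow_succ', ← mul_assoc, eT_mul_dX, mul_assoc, mul_assoc, mul_assoc, sub_mul, sub_mul]
    have e2 : eH k * (dX k 1 ^ l * mu k p a)
        = dX k 1 ^ l * algebraMap k (U k) (a + 2 * l) * mu k p a := by
      rw [dX_pow_mul_mu, ← mul_assoc, eH_mul_mu, smul_mul_assoc, ← dX_pow_mul_mu,
        smul_eq_algebraMap_mul,
        ← mul_assoc, Algebra.commutes]
      push_cast
      rfl
    rw [e1, ih, e2, pow_succ', show algebraMap k (U k) (((l + 1 : ℕ) : k) * ((l + 1 : ℕ) + a + 1))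
      = algebraMap k (U k) (l * (l + a + 1)) + algebraMap k (U k) (a + 2 * l) + 2 by
        rw [show (2 : U k) = algebraMap k (U k) 2 from (map_ofNat _ 2).symm, ← map_add, ← map_add]
        congr 1; push_cast; ring]
    have c2 : (2 : U k) * (dX k 1 ^ l * mu k p a) = dX k 1 ^ l * 2 * mu k p a := by
      rw [← mul_assoc, (Commute.ofNat_left 2 (dX k 1 ^ l)).eq]
    rw [c2]
    simp only [mul_sub, sub_mul, mul_add, add_mul, mul_assoc]
    abel

open Polynomial in
/-- The polynomial `∏ (x - i (i + a + 1))` over `s ≤ i < s + n`. -/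
def phiFrom (a : ℤ) (s n : ℕ) : k[X] :=
  ∏ i ∈ Finset.range n, (X - C (((s + i : ℕ) : k) * (((s + i : ℕ) : k) + a + 1)))

theorem phiFrom_add (a : ℤ) (s m n : ℕ) :
    phiFrom k a s (m + n) = phiFrom k a s m * phiFrom k a (s + m) n := by
  rw [phiFrom, Finset.prod_range_add, phiFrom, phiFrom]
  simp only [add_assoc]

theorem natDegree_phiFrom (a : ℤ) (s n : ℕ) : (phiFrom k a s n).natDegree = n := by
  rw [phiFrom, Polynomial.natDegree_finsetProd_X_sub_C_eq_card, Finset.card_range]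

theorem monic_phiFrom (a : ℤ) (s n : ℕ) : (phiFrom k a s n).Monic :=
  Polynomial.monic_prod_X_sub_C _ _

/-- On the weight `a`, the products `Y^n X^n` are polynomials in `YX`. -/
theorem dY_pow_mul_dX_pow_mul_mu (a : ℤ) (s n : ℕ) :
    dY k 1 ^ n * dX k 1 ^ n * dX k 1 ^ s * mu k p a
      = dX k 1 ^ s * Polynomial.aeval (eT k) (phiFrom k a s n) * mu k p a := by
  induction n with
  | zero => simp [phiFrom]
  | succ n ih =>
    have e : dY k 1 ^ (n + 1) * dX k 1 ^ (n + 1) * dX k 1 ^ s * mu k p a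
        = dY k 1 ^ n * (eT k * dX k 1 ^ (s + n) * mu k p a) := by
      rw [pow_succ, pow_succ' (dX k 1), add_comm s n, pow_add, eT]
      noncomm_ring
    set w := eT k - algebraMap k (U k) (((s + n : ℕ) : k) * (((s + n : ℕ) : k) + a + 1)) with hw
    have hwm : w ∈ algD k p := sub_mem (eT_mem_algD k p) (Subalgebra.algebraMap_mem _ _)
    have e2 : dY k 1 ^ n * (dX k 1 ^ (s + n) * w * mu k p a)
        = dY k 1 ^ n * dX k 1 ^ n * dX k 1 ^ s * mu k p a * w := by
      rw [mul_assoc _ w, algD_comm k hwm (mu_mem_algD k p a), add_comm s n, pow_add]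
      simp only [mul_assoc]
    rw [e, eT_mul_dX_pow_mul_mu, e2, ih, phiFrom_add, map_mul, phiFrom, phiFrom,
      Finset.prod_range_one, map_sub, Polynomial.aeval_X, Polynomial.aeval_C, add_zero, ← hw,
      mul_assoc _ (mu k p a), ← algD_comm k hwm (mu_mem_algD k p a)]
    simp only [mul_assoc]

end WeightZero

/-! ### Multiplicativity of `Fr'` -/

section Frob

variable (k : Type*) [Field k] (p : ℕ)

/-- The function of `Q` is, modulo `p`, the function of `P` composed with `z ↦ ⌊z / p⌋`. -/
def IsFrob (P Q : intPoly) : Prop := ∀ b < p, ∀ t : ℤ, (val Q (b + p * t) : k) = val P t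

variable {k p}

theorem IsFrob.mul {P Q P' Q' : intPoly} (h : IsFrob k p P Q) (h' : IsFrob k p P' Q') :
    IsFrob k p (P * P') (Q * Q') := fun b hb t => by
  rw [val_mul, val_mul, Int.cast_mul, Int.cast_mul, h b hb, h' b hb]

theorem IsFrob.shift {P Q : intPoly} (h : IsFrob k p P Q) (c : ℤ) :
    IsFrob k p (shift c P) (shift (p * c) Q) := fun b hb t => by
  rw [val_shift, val_shift, add_assoc, ← mul_add, h b hb]

variable (k p)

theorem isFrob_one : IsFrob k p 1 1 := fun b _ t => by rw [val_one, val_one]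

variable [Fact p.Prime] [CharP k p]

theorem isFrob_bin (c : ℤ) (n : ℕ) : IsFrob k p (bin c n) (bin (p * c) (p * n)) := fun b hb t => by
  have l := cast_choose_lucas k p hb (Fact.out : p.Prime).pos (t + c) n
  rw [zero_add, Nat.choose_zero_right, Nat.cast_one, one_mul] at l
  rw [val_bin, val_bin, add_assoc, ← mul_add, l]

theorem Fr'_of_isFrob (m m' : ℕ) {P Q : intPoly} (h : IsFrob k p P Q) :
    Fr' k p (dY k m * hp k P * dX k m') = dY k (p * m) * hp k Q * dX k (p * m') :=
  Fr'_dY_hp_dX k p m m' fun b hb t => h b hb t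

theorem cast_choose_mul_mul (a b : ℕ) :
    ((p * a).choose (p * b) : k) = (a.choose b : k) := by
  have l := cast_choose_lucas k p (b := 0) (Fact.out : p.Prime).pos (Fact.out : p.Prime).pos a b
  rw [Nat.choose_self, zero_add, Nat.cast_zero, zero_add, ← Nat.cast_mul, Ring.choose_natCast,
    Ring.choose_natCast] at l
  simpa using l

/-- The divided power of exponent `m₀ + p M`, for `m₀ < p`, is a product. -/
theorem dX_add_mul {m0 : ℕ} (h : m0 < p) (M : ℕ) :
    dX k (m0 + p * M) = dX k m0 * dX k (p * M) := by
  rw [dX_mul_dX]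
  have l := cast_choose_lucas k p h h M 0
  rw [mul_zero, add_zero, Nat.choose_self, Ring.choose_zero_right, ← Nat.cast_mul, ← Nat.cast_add,
    Ring.choose_natCast, Int.cast_natCast] at l
  rw [l]
  simp

theorem dY_add_mul {m0 : ℕ} (h : m0 < p) (M : ℕ) :
    dY k (m0 + p * M) = dY k (p * M) * dY k m0 := by
  rw [← dY_comm, dY_mul_dY]
  have l := cast_choose_lucas k p h h M 0
  rw [mul_zero, add_zero, Nat.choose_self, Ring.choose_zero_right, ← Nat.cast_mul, ← Nat.cast_add,
    Ring.choose_natCast, Int.cast_natCast] at l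
  rw [l]
  simp

theorem Fr'_one : Fr' k p 1 = 1 := by
  have := Fr'_of_isFrob k p 0 0 (isFrob_one k p)
  simpa [dX_zero, dY_zero] using this

theorem Fr'_dY_mul (M : ℕ) (u : U k) : Fr' k p (dY k M * u) = dY k (p * M) * Fr' k p u := by
  refine U_induction k (C := fun u => Fr' k p (dY k M * u) = dY k (p * M) * Fr' k p u)
    (by simp) (fun u v hu hv => by rw [mul_add, map_add, hu, hv, map_add, mul_add])
    (fun c u hu => by rw [mul_smul_comm, map_smul, hu, map_smul, mul_smul_comm]) ?_ u
  intro m P m'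
  obtain ⟨Q, hQ⟩ := exists_frob k p P
  rw [← mul_assoc, ← mul_assoc, dY_mul_dY, smul_mul_assoc, smul_mul_assoc, map_smul,
    Fr'_of_isFrob k p _ _ hQ, Fr'_of_isFrob k p _ _ hQ, ← mul_assoc, ← mul_assoc, dY_mul_dY,
    ← mul_add, cast_choose_mul_mul, smul_mul_assoc, smul_mul_assoc]

theorem Fr'_hp_mul {P Q : intPoly} (h : IsFrob k p P Q) (u : U k) :
    Fr' k p (hp k P * u) = hp k Q * Fr' k p u := by
  refine U_induction k (C := fun u => Fr' k p (hp k P * u) = hp k Q * Fr' k p u)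
    (by simp) (fun u v hu hv => by rw [mul_add, map_add, hu, hv, map_add, mul_add])
    (fun c u hu => by rw [mul_smul_comm, map_smul, hu, map_smul, mul_smul_comm]) ?_ u
  intro m P' m'
  obtain ⟨Q', hQ'⟩ := exists_frob k p P'
  rw [Fr'_of_isFrob k p _ _ hQ', ← mul_assoc, ← mul_assoc, ← mul_assoc, ← mul_assoc, hp_mul_dY,
    hp_mul_dY, mul_assoc (dY k m), mul_assoc (dY k (p * m)), ← map_mul, ← map_mul]
  refine Fr'_of_isFrob k p m m' (IsFrob.mul ?_ hQ')
  have := h.shift (-2 * m)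
  rwa [show (p : ℤ) * (-2 * m) = -2 * ((p * m : ℕ) : ℤ) by push_cast; ring] at this

theorem Fr'_dX_hp_dX (m m' : ℕ) {P Q : intPoly} (h : IsFrob k p P Q) :
    Fr' k p (dX k m * hp k P * dX k m') = dX k (p * m) * hp k Q * dX k (p * m') := by
  have h' := h.shift (-2 * m)
  rw [show (p : ℤ) * (-2 * m) = -2 * ((p * m : ℕ) : ℤ) by push_cast; ring] at h'
  have e := Fr'_of_isFrob k p 0 (m + m') h'
  rw [dX_mul_hp, dX_mul_hp, mul_assoc, mul_assoc, dX_mul_dX, dX_mul_dX, mul_smul_comm,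
    mul_smul_comm, map_smul, ← mul_add, cast_choose_mul_mul]
  congr 1
  simpa [dY_zero] using e

variable {k p}

/-- The terms in the commutation formula for `X^(pM)` and `Y^(pn)` which do not come from the
commutation formula for `X^(M)` and `Y^(n)` vanish on suitable elements `y` of weight `b`. -/
theorem commutator_term_eq_zero {b : ℕ} (hb : b < p) {y : U k} (hμ : mu k p b * y = y)
    (hX : ∀ M, dX k (p * M) * y = y * dX k (p * M))
    (hY : ∀ m, p - b ≤ m → m < p → dY k m * dX k m * y = 0) (M n n' i : ℕ) (hiM : i ≤ p * M)
    (hin : i ≤ p * n) (hi : ¬ p ∣ i) (Q : intPoly) :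
    dY k (p * n - i) * hp k (bin (2 * i - (p * M : ℕ) - (p * n : ℕ)) i) * dX k (p * M - i) *
      (hp k Q * dX k (p * n') * y) = 0 := by
  have hp' : p.Prime := Fact.out
  -- `i = k₀ + p j` with `0 < k₀ < p`, and `m₀ = p - k₀`
  obtain ⟨j, k0, hk0, hk0p, rfl⟩ : ∃ j k0, 0 < k0 ∧ k0 < p ∧ i = k0 + p * j :=
    ⟨i / p, i % p, Nat.pos_of_ne_zero fun h => hi (Nat.dvd_of_mod_eq_zero h), Nat.mod_lt _ hp'.pos,
      (Nat.mod_add_div i p).symm⟩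
  have quot : ∀ N, k0 + p * j ≤ p * N → ∃ J, p * N - (k0 + p * j) = (p - k0) + p * J := by
    intro N hN
    have hj : j + 1 ≤ N := by
      by_contra h
      have : p * N ≤ p * j := Nat.mul_le_mul_left p (by omega)
      omega
    obtain ⟨J, rfl⟩ := Nat.exists_eq_add_of_le hj
    refine ⟨J, ?_⟩
    rw [mul_add, mul_add, mul_one]
    omega
  obtain ⟨J, hJ⟩ := quot M hiM
  obtain ⟨J', hJ'⟩ := quot n hin
  set m0 := p - k0 with hm0
  have hm0p : m0 < p := by omega
  set c : ℤ := 2 * (k0 + p * j : ℕ) - (p * M : ℕ) - (p * n : ℕ) with hc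
  have hkey : ∀ R : intPoly, dY k m0 * hp k (bin c (k0 + p * j)) * hp k R * dX k m0 * y = 0 := by
    intro R
    have e : dY k m0 * hp k (bin c (k0 + p * j)) * hp k R * dX k m0 * y
        = hp k (shift (2 * m0) R) * (hp k (bin (2 * m0 + c) (k0 + p * j))
          * (dY k m0 * dX k m0 * y)) := by
      rw [mul_assoc (dY k m0), ← map_mul, mul_comm (bin _ _), dY_mul_hp, map_mul, shift_bin,
        map_mul]
      simp only [mul_assoc]
    rw [e]
    rcases Nat.lt_or_ge b k0 with h | h
    · have e1 : dY k m0 * dX k m0 * y = mu k p b * (dY k m0 * dX k m0 * y) := by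
        have e2 : dY k m0 * dX k m0 * mu k p b = mu k p b * (dY k m0 * dX k m0) := by
          rw [mul_assoc, dX_mul_mu, ← mul_assoc, ← mul_assoc, mu_mul_dY]
        rw [← mul_assoc, ← e2, mul_assoc _ (mu k p b), hμ]
      have e3 : hp k (bin (2 * m0 + c) (k0 + p * j)) * mu k p b = 0 := by
        have := hp_mul_mu_congr k p (a := b) (P := bin (2 * m0 + c) (k0 + p * j)) (Q := 0)
          (fun z hz => by
            obtain ⟨t, ht⟩ := hz
            have hc' : 2 * (m0 : ℤ) + c = p * (2 * (j + 1) - M - n) := by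
              rw [hc, hm0, Nat.cast_sub hk0p.le]; push_cast; ring
            rw [val_bin, hc', show z = b + p * t by linarith, add_assoc, ← mul_add,
              cast_choose_lucas k p hb hk0p, Nat.choose_eq_zero_of_lt h]
            simp)
        rwa [map_zero, zero_mul] at this
      rw [e1, ← mul_assoc (hp k (bin _ _)), e3, zero_mul, mul_zero]
    · rw [hY m0 (by omega) hm0p, mul_zero, mul_zero]
  rw [hJ, hJ', dX_add_mul k p hm0p, dY_add_mul k p hm0p]
  have e : dY k (p * J') * dY k m0 * hp k (bin c (k0 + p * j)) * (dX k m0 * dX k (p * J)) *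
      (hp k Q * dX k (p * n') * y) =
      dY k (p * J') * (dY k m0 * hp k (bin c (k0 + p * j)) *
        hp k (shift (-2 * (m0 + p * J : ℕ)) Q) * dX k m0 * y) * dX k (p * J) * dX k (p * n') := by
    have e1 : dX k m0 * dX k (p * J) * hp k Q
        = hp k (shift (-2 * (m0 + p * J : ℕ)) Q) * (dX k m0 * dX k (p * J)) := by
      rw [← dX_add_mul k p hm0p, dX_mul_hp]
    calc _ = dY k (p * J') * dY k m0 * hp k (bin c (k0 + p * j)) *
          ((dX k m0 * dX k (p * J) * hp k Q) * (dX k (p * n') * y)) := by simp only [mul_assoc]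
      _ = _ := by
        rw [e1, hX]
        simp only [mul_assoc]
        rw [← mul_assoc (dX k (p * J)) y, hX, mul_assoc]
  rw [e, hkey, mul_zero, zero_mul, zero_mul]

theorem sum_range_mul_eq {A : Type*} [AddCommMonoid A] (f : ℕ → A) (K : ℕ)
    (h : ∀ i ≤ p * K, ¬ p ∣ i → f i = 0) :
    ∑ i ∈ Finset.range (p * K + 1), f i = ∑ j ∈ Finset.range (K + 1), f (p * j) := by
  have hpos : 0 < p := (Fact.out : p.Prime).pos
  have hinj : Function.Injective (fun j : ℕ => p * j) := fun a b hab =>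
    Nat.eq_of_mul_eq_mul_left hpos hab
  rw [← Finset.sum_image (s := Finset.range (K + 1)) (g := fun j : ℕ => p * j)
    (fun a _ b _ hab => hinj hab)]
  refine (Finset.sum_subset ?_ ?_).symm
  · intro i hi
    obtain ⟨j, hj, rfl⟩ := Finset.mem_image.1 hi
    have := Nat.mul_le_mul_left p (Nat.lt_succ_iff.1 (Finset.mem_range.1 hj))
    exact Finset.mem_range.2 (Nat.lt_succ_of_le this)
  · intro i hi hni
    refine h i (Nat.lt_succ_iff.1 (Finset.mem_range.1 hi)) ?_
    rintro ⟨j, rfl⟩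
    refine hni (Finset.mem_image.2 ⟨j, Finset.mem_range.2 (Nat.lt_succ_of_le ?_), rfl⟩)
    exact Nat.le_of_mul_le_mul_left (Nat.lt_succ_iff.1 (Finset.mem_range.1 hi)) hpos

theorem Fr'_dX_mul_mul {b : ℕ} (hb : b < p) {y : U k} (hμ : mu k p b * y = y)
    (hX : ∀ M, dX k (p * M) * y = y * dX k (p * M))
    (hY : ∀ m, p - b ≤ m → m < p → dY k m * dX k m * y = 0) (M : ℕ) (u : U k) :
    Fr' k p (dX k M * u) * y = dX k (p * M) * Fr' k p u * y := by
  refine U_induction k (C := fun u => Fr' k p (dX k M * u) * y = dX k (p * M) * Fr' k p u * y)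
    (by simp) (fun u v hu hv => by rw [mul_add, map_add, add_mul, hu, hv, map_add, mul_add, add_mul])
    (fun c u hu => by
      rw [mul_smul_comm, map_smul, smul_mul_assoc, hu, map_smul, mul_smul_comm, smul_mul_assoc])
    ?_ u
  intro n P n'
  obtain ⟨Q, hQ⟩ := exists_frob k p P
  have hl : Fr' k p (dX k M * (dY k n * hp k P * dX k n')) =
      ∑ j ∈ Finset.range (min M n + 1), dY k (p * n - p * j) *
        hp k (bin (2 * (p * j : ℕ) - (p * M : ℕ) - (p * n : ℕ)) (p * j)) *
        dX k (p * M - p * j) * (hp k Q * dX k (p * n')) := by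
    have e : dX k M * (dY k n * hp k P * dX k n') = (dX k M * dY k n) * (hp k P * dX k n') := by
      simp only [mul_assoc]
    rw [e, dX_mul_dY, Finset.sum_mul, map_sum]
    refine Finset.sum_congr rfl fun j _ => ?_
    have hbin := isFrob_bin k p (2 * j - M - n) j
    rw [show (p : ℤ) * (2 * j - M - n) = 2 * (p * j : ℕ) - (p * M : ℕ) - (p * n : ℕ) by
      push_cast; ring] at hbin
    rw [mul_assoc, mul_assoc, Fr'_dY_mul, Fr'_hp_mul k p hbin, ← mul_assoc (dX k (M - j)),
      Fr'_dX_hp_dX k p _ _ hQ, Nat.mul_sub, Nat.mul_sub]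
    simp only [mul_assoc]
  have e : dX k (p * M) * (dY k (p * n) * hp k Q * dX k (p * n')) * y
      = (dX k (p * M) * dY k (p * n)) * (hp k Q * dX k (p * n') * y) := by
    simp only [mul_assoc]
  rw [hl, Fr'_of_isFrob k p n n' hQ, e, dX_mul_dY, Finset.sum_mul, Finset.sum_mul,
    Nat.mul_min_mul_left, sum_range_mul_eq]
  · exact Finset.sum_congr rfl fun j _ => by simp only [mul_assoc]
  · intro i hi hpi
    rw [← Nat.mul_min_mul_left] at hi
    exact commutator_term_eq_zero hb hμ hX hY M n n' i (hi.trans (min_le_left _ _))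
      (hi.trans (min_le_right _ _)) hpi Q

/-- `Fr'` is multiplicative up to elements killed by suitable `y` of weight `b`. -/
theorem Fr'_mul_mul {b : ℕ} (hb : b < p) {y : U k} (hμ : mu k p b * y = y)
    (hX : ∀ M, dX k (p * M) * y = y * dX k (p * M))
    (hY : ∀ m, p - b ≤ m → m < p → dY k m * dX k m * y = 0) (z z' : U k) :
    Fr' k p (z * z') * y = Fr' k p z * Fr' k p z' * y := by
  refine U_induction k (C := fun z => Fr' k p (z * z') * y = Fr' k p z * Fr' k p z' * y)
    (by simp) (fun u v hu hv => by rw [add_mul, map_add, add_mul, hu, hv, map_add, add_mul, add_mul])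
    (fun c u hu => by
      rw [smul_mul_assoc, map_smul, smul_mul_assoc, hu, map_smul, smul_mul_assoc, smul_mul_assoc])
    ?_ z
  intro n P n'
  obtain ⟨Q, hQ⟩ := exists_frob k p P
  rw [Fr'_of_isFrob k p n n' hQ, mul_assoc, mul_assoc, Fr'_dY_mul, Fr'_hp_mul k p hQ, mul_assoc,
    mul_assoc, Fr'_dX_mul_mul hb hμ hX hY]
  simp only [mul_assoc]

theorem algD_mul_hp {p : ℕ} {w : U k} (hw : w ∈ algD k p) (P : intPoly) :
    w * hp k P = hp k P * w := by
  refine commute_of_mem_adjoin (fun a ha => ?_) hw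
  rcases ha with rfl | ⟨Q, -, rfl⟩
  · exact (hp_mul_eT k P).symm
  · rw [← map_mul, ← map_mul, mul_comm]

theorem algD_mul_Fr' {w : U k} (hw : w ∈ algD k p) (z : U k) :
    w * Fr' k p z = Fr' k p z * w := by
  refine U_induction k (C := fun z => w * Fr' k p z = Fr' k p z * w)
    (by simp) (fun u v hu hv => by rw [map_add, mul_add, add_mul, hu, hv])
    (fun c u hu => by rw [map_smul, mul_smul_comm, smul_mul_assoc, hu]) ?_ z
  intro n P n'
  obtain ⟨Q, hQ⟩ := exists_frob k p P
  rw [Fr'_of_isFrob k p n n' hQ, mul_assoc _ _ w, ← algD_mul_dX k p hw, ← mul_assoc w, ← mul_assoc w,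
    algD_mul_dY k p hw, mul_assoc (dY k _) w, algD_mul_hp hw]
  simp only [mul_assoc]

end Frob

/-! ### Twisted Frobenius images -/

section Twist

variable (k : Type*) [Field k] (p : ℕ)

/-- The element `Y^s Fr'(z) X^s`. -/
def twist (s : ℕ) (z : U k) : U k := dY k 1 ^ s * Fr' k p z * dX k 1 ^ s

/-- The element `g(YX) μ_a`. -/
def elt (a : ℤ) (g : Polynomial k) : U k := Polynomial.aeval (eT k) g * mu k p a

theorem twist_add (s : ℕ) (z z' : U k) : twist k p s (z + z') = twist k p s z + twist k p s z' := by
  rw [twist, map_add, mul_add, add_mul]; rfl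

theorem twist_smul (s : ℕ) (c : k) (z : U k) : twist k p s (c • z) = c • twist k p s z := by
  rw [twist, map_smul, mul_smul_comm, smul_mul_assoc]; rfl

theorem elt_add (a : ℤ) (f g : Polynomial k) : elt k p a (f + g) = elt k p a f + elt k p a g := by
  rw [elt, map_add, add_mul]; rfl

theorem elt_smul (a : ℤ) (c : k) (g : Polynomial k) : elt k p a (c • g) = c • elt k p a g := by
  rw [elt, map_smul, smul_mul_assoc]; rfl

variable [Fact p.Prime] [CharP k p]

theorem elt_mem_algD (a : ℤ) (g : Polynomial k) : elt k p a g ∈ algD k p :=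
  mul_mem (aeval_eT_mem k p g) (mu_mem_algD k p a)

theorem elt_mul_elt (a : ℤ) (f g : Polynomial k) :
    elt k p a f * elt k p a g = elt k p a (f * g) := by
  rw [elt, elt, mul_assoc, ← mul_assoc (mu k p a), ← algD_comm k (aeval_eT_mem k p g)
    (mu_mem_algD k p a), mul_assoc, mu_mul_self, elt, map_mul, mul_assoc]

theorem algD_mul_twist {w : U k} (hw : w ∈ algD k p) (s : ℕ) (z : U k) :
    w * twist k p s z = twist k p s z * w := by
  obtain ⟨w', hw', h1, h2⟩ := exists_algD_shift_pow k p hw s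
  rw [twist, ← mul_assoc, ← mul_assoc, h1, mul_assoc (_ ^ s) w', algD_mul_Fr' hw', mul_assoc,
    mul_assoc (Fr' k p z) w', h2]
  simp only [mul_assoc]

theorem dX_pow_mul_elt (a : ℤ) (s : ℕ) (g : Polynomial k) :
    mu k p (a + 2 * s) * (dX k 1 ^ s * elt k p a g) = dX k 1 ^ s * elt k p a g := by
  rw [← mul_assoc, ← dX_pow_mul_mu, elt, algD_comm k (aeval_eT_mem k p g) (mu_mem_algD k p a),
    mul_assoc, ← mul_assoc (mu k p a), mu_mul_self]

theorem dX_pow_eq_zero {l : ℕ} (h : p ≤ l) : dX k 1 ^ l = 0 := by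
  rw [dX_one_pow, (CharP.cast_eq_zero_iff k p _).2 ((Fact.out : p.Prime).dvd_factorial.2 h),
    zero_smul]

theorem dY_pow_mul_dX_pow_mem (n : ℕ) : dY k 1 ^ n * dX k 1 ^ n ∈ algD k p := by
  simpa using dY_mul_algD_mul_dX k p (one_mem _) n

theorem dX_pow_mul_dY_pow_mem (n : ℕ) : dX k 1 ^ n * dY k 1 ^ n ∈ algD k p := by
  simpa using dX_mul_algD_mul_dY k p (one_mem _) n

theorem twist_mul_elt_phiFrom (a : ℤ) (s n : ℕ) (z : U k) (g : Polynomial k) :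
    twist k p s z * elt k p a (phiFrom k a s n * g)
      = dY k 1 ^ s * Fr' k p z * (dY k 1 ^ n * dX k 1 ^ n * dX k 1 ^ s) * elt k p a g := by
  have e : dX k 1 ^ s * elt k p a (phiFrom k a s n * g)
      = dY k 1 ^ n * dX k 1 ^ n * dX k 1 ^ s * elt k p a g := by
    have h := dY_pow_mul_dX_pow_mul_mu k p a s n
    rw [elt, elt, map_mul, algD_comm k (aeval_eT_mem k p g) (mu_mem_algD k p a), ← mul_assoc _ (mu k p a),
      h, mul_assoc _ (mu k p a), ← algD_comm k (aeval_eT_mem k p g) (mu_mem_algD k p a)]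
    simp only [mul_assoc]
  rw [twist, mul_assoc, e]
  simp only [mul_assoc]

theorem elt_phiFrom (a : ℤ) (s : ℕ) (g : Polynomial k) :
    elt k p a (phiFrom k a 0 s * g) = dY k 1 ^ s * dX k 1 ^ s * elt k p a g := by
  have h := twist_mul_elt_phiFrom k p a 0 s 1 g
  simpa [twist, Fr'_one] using h

/-- The element `Y^s Fr'(z) X^s g(YX) μ_a` vanishes if `Y^s X^s g(YX) μ_a` is zero for the obvious
reason. -/
theorem twist_mul_elt_eq_zero {a : ℤ} {s : ℕ} (hs : s < p) {g : Polynomial k}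
    (hg : phiFrom k a 0 p ∣ phiFrom k a 0 s * g) (z : U k) : twist k p s z * elt k p a g = 0 := by
  have e := phiFrom_add k a 0 s (p - s)
  rw [Nat.add_sub_cancel' hs.le, zero_add] at e
  rw [e] at hg
  obtain ⟨h, rfl⟩ := (mul_dvd_mul_iff_left (monic_phiFrom k a 0 s).ne_zero).1 hg
  rw [twist_mul_elt_phiFrom, mul_assoc (dY k 1 ^ (p - s)), ← pow_add,
    dX_pow_eq_zero k p (by omega), mul_zero, mul_zero, zero_mul]

theorem twist_mul_elt_congr {a : ℤ} {s : ℕ} (hs : s < p) {f g : Polynomial k}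
    (hg : phiFrom k a 0 p ∣ phiFrom k a 0 s * (f - g)) (z : U k) :
    twist k p s z * elt k p a f = twist k p s z * elt k p a g := by
  have e : f = (f - g) + g := by ring
  rw [e, elt_add, mul_add, twist_mul_elt_eq_zero k p hs hg, zero_add]

/-- The conditions under which `z ↦ Y^s Fr'(z) X^s` is multiplicative, up to the factor `Y^s X^s`,
on the weight `a` and on multiples of `Q(YX)`: with `b` the residue of the weight `a + 2 s` of `X^s μ_a`, the
elements `Y^l X^l` with `p - b ≤ l < p` have to kill `X^s Y^s X^s Q(YX) μ_a`. -/
def IsGood (a : ℤ) (s : ℕ) (Q : Polynomial k) : Prop :=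
  ∃ b : ℕ, b < p ∧ (p : ℤ) ∣ a + 2 * s - b ∧ ∀ l, p - b ≤ l → l < p →
    p ≤ l + s ∨ (s = 0 ∧ phiFrom k a 0 p ∣ phiFrom k a 0 l * Q)

/-- For good data, the twists multiply like the elements `z` themselves, up to the factor `Y^s X^s`. -/
theorem twist_mul_twist {a : ℤ} {s : ℕ} {Q : Polynomial k} (hQ : IsGood k p a s Q)
    {g : Polynomial k} (hg : Q ∣ g) (z z' : U k) :
    twist k p s z * (twist k p s z' * elt k p a g)
      = twist k p s (z * z') * elt k p a (phiFrom k a 0 s * g) := by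
  obtain ⟨b, hb, hab, hl⟩ := hQ
  set y := dX k 1 ^ s * elt k p a (phiFrom k a 0 s * g) with hy
  have e1 : twist k p s z * (twist k p s z' * elt k p a g)
      = dY k 1 ^ s * (Fr' k p z * Fr' k p z' * y) := by
    have c := algD_mul_Fr' (dX_pow_mul_dY_pow_mem k p s) z'
    calc _ = dY k 1 ^ s * Fr' k p z * ((dX k 1 ^ s * dY k 1 ^ s) * Fr' k p z')
          * (dX k 1 ^ s * elt k p a g) := by simp only [twist, mul_assoc]
      _ = _ := by rw [c, hy, elt_phiFrom]; simp only [mul_assoc]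
  have e2 : twist k p s (z * z') * elt k p a (phiFrom k a 0 s * g)
      = dY k 1 ^ s * (Fr' k p (z * z') * y) := by simp only [twist, hy, mul_assoc]
  rw [e1, e2]
  congr 1
  refine (Fr'_mul_mul hb ?_ ?_ ?_ z z').symm
  · rw [← mu_congr k p hab, hy, dX_pow_mul_elt]
  · intro M
    rw [hy, ← mul_assoc, dX_comm_pow, mul_assoc, mul_assoc,
      algD_mul_dX k p (elt_mem_algD k p a _)]
  · intro l hl1 hl2
    have hf : (l.factorial : k) ≠ 0 := by
      rw [Ne, CharP.cast_eq_zero_iff k p, (Fact.out : p.Prime).dvd_factorial]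
      omega
    have e3 : dY k l * dX k l * y = ((l.factorial : k)⁻¹ * (l.factorial : k)⁻¹) •
        (dY k 1 ^ l * dX k 1 ^ l * y) := by
      rw [dY_one_pow, dX_one_pow, smul_mul_smul_comm, smul_mul_assoc, smul_smul,
        mul_mul_mul_comm, inv_mul_cancel₀ hf, one_mul, one_smul]
    rw [e3]
    rcases hl l hl1 hl2 with h | ⟨rfl, h⟩
    · rw [hy, mul_assoc (dY k 1 ^ l), ← mul_assoc (dX k 1 ^ l), ← pow_add,
        dX_pow_eq_zero k p h, zero_mul, mul_zero, smul_zero]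
    · rw [hy, pow_zero, one_mul, ← elt_phiFrom]
      have := twist_mul_elt_eq_zero k p (a := a) (s := 0) (by omega)
        (g := phiFrom k a 0 l * (phiFrom k a 0 0 * g)) (by
          refine h.trans ?_
          obtain ⟨f, rfl⟩ := hg
          exact ⟨f, by simp [phiFrom]; ring⟩) 1
      rw [twist, Fr'_one] at this
      simp only [pow_zero, one_mul] at this
      rw [this, smul_zero]

theorem cast_choose_floor (x : ℤ) (N : ℕ) :
    ((Ring.choose x (p * N) : ℤ) : k) = (Ring.choose (x / p) N : ℤ) := by
  have hp' : p.Prime := Fact.out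
  have hp0 : (0 : ℤ) < p := by exact_mod_cast hp'.pos
  obtain ⟨b, hb⟩ : ∃ b : ℕ, (b : ℤ) = x % p :=
    ⟨(x % p).toNat, Int.toNat_of_nonneg (Int.emod_nonneg _ hp0.ne')⟩
  have hbp : b < p := by
    have := Int.emod_lt_of_pos x hp0
    rw [← hb] at this
    exact_mod_cast this
  have h1 := Int.emod_add_mul_ediv x p
  rw [← hb] at h1
  have l := cast_choose_lucas k p hbp hp'.pos (x / p) N
  rwa [h1, zero_add, Nat.choose_zero_right, Nat.cast_one, one_mul] at l

theorem hp_bin_add_mul (n0 N : ℕ) (h : n0 < p) :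
    hp k (bin 0 (n0 + p * N)) = hp k (bin 0 (p * N)) * hp k (bin 0 n0) := by
  rw [← map_mul]
  refine hp_congr k p fun z => ?_
  have hp' : p.Prime := Fact.out
  have hb := Nat.mod_lt z hp'.pos
  have l1 := cast_choose_lucas k p hb h ((z / p : ℕ) : ℤ) N
  have l2 := cast_choose_lucas k p hb h ((z / p : ℕ) : ℤ) 0
  have l3 := cast_choose_lucas k p hb hp'.pos ((z / p : ℕ) : ℤ) N
  rw [show ((z % p : ℕ) : ℤ) + p * ((z / p : ℕ) : ℤ) = (z : ℕ) by
    exact_mod_cast Nat.mod_add_div z p] at l1 l2 l3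
  rw [mul_zero, add_zero, Ring.choose_zero_right, Int.cast_one, mul_one] at l2
  rw [zero_add, Nat.choose_zero_right, Nat.cast_one, one_mul] at l3
  rw [val_mul, val_bin, val_bin, val_bin, add_zero, l1, Int.cast_mul, l2, l3, mul_comm]

/-- A basis element of `A_{r+1}`, times `Y^s X^s μ_a`, is the twist of an element of `A_r` times an
element of weight zero of `U_1`. -/
theorem pbw_mul_twist_one (r : ℕ) (a : ℤ) (s : ℕ) {m n : ℕ} (hm : m < p ^ (r + 1))
    (hn : n < p ^ (r + 1)) : ∃ z ∈ Ar k p r, ∃ h : Polynomial k, ∀ g : Polynomial k,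
      dY k m * hp k (bin 0 n) * dX k m * (twist k p s 1 * elt k p a g)
        = twist k p s z * elt k p a (h * g) := by
  have hp' : p.Prime := Fact.out
  obtain ⟨m0, M, hm0, hM, rfl⟩ : ∃ m0 M, m0 < p ∧ M < p ^ r ∧ m = m0 + p * M :=
    ⟨m % p, m / p, Nat.mod_lt _ hp'.pos, by
      rw [Nat.div_lt_iff_lt_mul hp'.pos, ← pow_succ]; exact hm, (Nat.mod_add_div m p).symm⟩
  obtain ⟨n0, N, hn0, hN, rfl⟩ : ∃ n0 N, n0 < p ∧ N < p ^ r ∧ n = n0 + p * N :=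
    ⟨n % p, n / p, Nat.mod_lt _ hp'.pos, by
      rw [Nat.div_lt_iff_lt_mul hp'.pos, ← pow_succ]; exact hn, (Nat.mod_add_div n p).symm⟩
  have hf : (m0.factorial : k) ≠ 0 := by
    rw [Ne, CharP.cast_eq_zero_iff k p, hp'.dvd_factorial]
    omega
  -- the part of the basis element in `U_1`
  set a1 := dY k m0 * hp k (bin 0 n0) * dX k m0 with ha1
  have ha1D : a1 ∈ algD k p := by
    have h := dY_mul_algD_mul_dX k p (hp_mem_algD (isPer_bin_one k p 0 hn0)) m0
    rw [dY_one_pow, dX_one_pow, smul_mul_assoc, smul_mul_smul_comm, ← ha1] at h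
    rw [← inv_smul_smul₀ (mul_ne_zero hf hf) a1]
    exact Subalgebra.smul_mem _ h _
  obtain ⟨h, hh⟩ := exists_aeval_mul_mu k p ha1D a
  set e : ℤ := 2 * m0 - 2 * s with he
  set a' : ℤ := a + 2 * s with ha'
  set C : ℤ := (a' + e) / p - a' / p with hC
  refine ⟨dY k M * hp k (bin C N) * dX k M, ?_, h, fun g => ?_⟩
  · rw [mem_Ar_iff]
    exact mem_pbwSpan_of_isPer k p (isPer_bin k p r C hN) fun n hn => ⟨rfl, hM, hn⟩
  have hw : dY k (m0 + p * M) * hp k (bin 0 (n0 + p * N)) * dX k (m0 + p * M)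
      = dY k (p * M) * hp k (bin (2 * m0) (p * N)) * dX k (p * M) * a1 := by
    have e1 : dY k m0 * hp k (bin 0 (p * N)) = hp k (bin (2 * m0) (p * N)) * dY k m0 := by
      rw [dY_mul_hp, shift_bin, add_zero]
    calc _ = dY k (p * M) * (dY k m0 * hp k (bin 0 (p * N))) * hp k (bin 0 n0) * dX k m0
          * dX k (p * M) := by
          rw [dX_add_mul k p hm0, dY_add_mul k p hm0, hp_bin_add_mul k p n0 N hn0]
          simp only [mul_assoc]
      _ = dY k (p * M) * hp k (bin (2 * m0) (p * N)) * (a1 * dX k (p * M)) := by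
          rw [e1]; simp only [ha1, mul_assoc]
      _ = _ := by rw [algD_mul_dX k p ha1D]; simp only [mul_assoc]
  have hag : a1 * elt k p a g = elt k p a (h * g) := by
    rw [elt, elt, map_mul, algD_comm k (aeval_eT_mem k p g) (mu_mem_algD k p a), ← mul_assoc, hh,
      mul_assoc, mul_assoc, algD_comm k (aeval_eT_mem k p g) (mu_mem_algD k p a)]
  have hF := Fr'_of_isFrob k p M M (isFrob_bin k p C N)
  have hv := dY_pow_mul_dX_pow_mem k p s
  set v := elt k p a (h * g) with hvdef
  -- the weight of `X^s v` allows one to replace the binomial by a Frobenius lift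
  have hμ : hp k (bin e (p * N)) * (dX k (p * M) * (dX k 1 ^ s * v))
      = hp k (bin (p * C) (p * N)) * (dX k (p * M) * (dX k 1 ^ s * v)) := by
    have h1 : dX k (p * M) * (dX k 1 ^ s * v) = mu k p a' * (dX k (p * M) * (dX k 1 ^ s * v)) := by
      conv_lhs => rw [hvdef, ← dX_pow_mul_elt, ← mul_assoc, ← algD_mul_dX k p (mu_mem_algD k p _),
        mul_assoc]
    rw [h1, ← mul_assoc, ← mul_assoc (hp k (bin (p * C) _)), hp_mul_mu_congr k p (a := a')
      (P := bin e (p * N)) (Q := bin (p * C) (p * N))]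
    intro z hz
    obtain ⟨t, ht⟩ := hz
    have hp0 : (p : ℤ) ≠ 0 := by exact_mod_cast hp'.ne_zero
    rw [val_bin, val_bin, cast_choose_floor, cast_choose_floor, show z = a' + p * t by linarith,
      show a' + p * t + e = (a' + e) + p * t by ring, show a' + p * t + p * C = a' + p * (t + C) by ring,
      Int.add_mul_ediv_left _ _ hp0, Int.add_mul_ediv_left _ _ hp0, hC,
      show (a' + e) / p + t = a' / p + (t + ((a' + e) / p - a' / p)) by ring]
  have hc : hp k (bin (2 * m0) (p * N)) * dY k 1 ^ s = dY k 1 ^ s * hp k (bin e (p * N)) := by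
    rw [dY_one_pow, mul_smul_comm, smul_mul_assoc, hp_mul_dY, shift_bin,
      show -2 * (s : ℤ) + 2 * m0 = e by rw [he]; ring]
  rw [hw, twist, Fr'_one, mul_one, twist, hF]
  calc dY k (p * M) * hp k (bin (2 * m0) (p * N)) * dX k (p * M) * a1 *
        (dY k 1 ^ s * dX k 1 ^ s * elt k p a g)
      = dY k (p * M) * hp k (bin (2 * m0) (p * N)) * dX k (p * M) *
          ((a1 * (dY k 1 ^ s * dX k 1 ^ s)) * elt k p a g) := by simp only [mul_assoc]
    _ = dY k (p * M) * hp k (bin (2 * m0) (p * N)) * (dX k (p * M) *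
          (dY k 1 ^ s * dX k 1 ^ s)) * v := by
        rw [algD_comm k ha1D hv, mul_assoc _ a1, hag]; simp only [mul_assoc]
    _ = dY k (p * M) * (hp k (bin (2 * m0) (p * N)) * dY k 1 ^ s) *
          ((dX k 1 ^ s * dX k (p * M)) * v) := by
        rw [← algD_mul_dX k p hv]; simp only [mul_assoc]
    _ = dY k (p * M) * dY k 1 ^ s * (hp k (bin e (p * N)) * (dX k (p * M) * (dX k 1 ^ s * v))) := by
        rw [hc, ← dX_comm_pow]; simp only [mul_assoc]
    _ = _ := by
        rw [hμ, dY_comm_pow]; simp only [mul_assoc]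

end Twist

/-! ### Injectivity of the twists -/

section Injectivity

variable (k : Type*) [Field k] (p : ℕ)

theorem exists_phiFrom_expansion (a : ℤ) (s N : ℕ) (f : Polynomial k) (hf : f.degree < N) :
    ∃ c : ℕ → k, f = ∑ n ∈ Finset.range N, c n • phiFrom k a s n := by
  induction N generalizing f with
  | zero =>
    refine ⟨0, ?_⟩
    rw [Finset.range_zero, Finset.sum_empty]
    exact Polynomial.degree_eq_bot.1 (Nat.WithBot.lt_zero_iff.1 hf)
  | succ N ih =>
    obtain ⟨c, hc⟩ := ih (f - f.coeff N • phiFrom k a s N) (by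
      rw [Polynomial.degree_lt_iff_coeff_zero] at hf ⊢
      intro m hm
      rw [Polynomial.coeff_sub, Polynomial.coeff_smul]
      rcases hm.eq_or_lt with rfl | h
      · have := (monic_phiFrom k a s N).coeff_natDegree
        rw [natDegree_phiFrom] at this
        rw [this, smul_eq_mul, mul_one, sub_self]
      · rw [hf m h, Polynomial.coeff_eq_zero_of_natDegree_lt (p := phiFrom k a s N)
          (by rwa [natDegree_phiFrom]), smul_zero, sub_zero])
    refine ⟨fun n => if n = N then f.coeff N else c n, ?_⟩
    rw [Finset.sum_range_succ, Finset.sum_congr rfl (g := fun n => c n • phiFrom k a s n)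
      (fun n hn => by simp only; rw [if_neg (Finset.mem_range.1 hn).ne]), ← hc]
    simp only [if_true, sub_add_cancel]

variable [Fact p.Prime]

variable {k p} in
theorem IsFrob.val_eq {P Q : intPoly} (h : IsFrob k p P Q) (x : ℤ) :
    (val Q x : k) = val P (x / p) := by
  have hp0 : (0 : ℤ) < p := by exact_mod_cast (Fact.out : p.Prime).pos
  obtain ⟨b, hb⟩ : ∃ b : ℕ, (b : ℤ) = x % p :=
    ⟨(x % p).toNat, Int.toNat_of_nonneg (Int.emod_nonneg _ hp0.ne')⟩
  have hbp : b < p := by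
    have := Int.emod_lt_of_pos x hp0
    rw [← hb] at this
    exact_mod_cast this
  have h1 := Int.emod_add_mul_ediv x p
  rw [← hb] at h1
  rw [← h b hbp, h1]

variable [CharP k p]

/-- The twist of a basis element, times `∏ (YX - i (i + a + 1)) μ_a`, is again of the form
`Y^(m) P(H) X^(m')`. -/
theorem twist_pbw_mul_elt_phiFrom (a : ℤ) {s n : ℕ} (h : s + n < p) (M M' : ℕ) {P Q : intPoly}
    (hQ : IsFrob k p P Q) :
    twist k p s (dY k M * hp k P * dX k M') * elt k p a (phiFrom k a s n) =
      (((s + n).factorial : k) * ((s + n).factorial : k)) • (dY k (s + n + p * M) *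
        hp k (shift (-2 * n) Q * bin (-(a + 2 * (s + n : ℕ)) - 1) (p - 1)) *
          dX k (s + n + p * M')) := by
  have h1 := twist_mul_elt_phiFrom k p a s n (dY k M * hp k P * dX k M') 1
  rw [mul_one] at h1
  have h2 : elt k p a 1 = mu k p a := by rw [elt, map_one, one_mul]
  have h3 : hp k Q * dY k 1 ^ n = dY k 1 ^ n * hp k (shift (-2 * n) Q) := by
    rw [dY_one_pow, mul_smul_comm, smul_mul_assoc, hp_mul_dY]
  have hD := dY_pow_mul_dX_pow_mem k p n
  rw [h1, h2, Fr'_of_isFrob k p M M' hQ, dY_add_mul k p h, dX_add_mul k p h, map_mul, ← mu_eq]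
  calc dY k 1 ^ s * (dY k (p * M) * hp k Q * dX k (p * M')) *
        (dY k 1 ^ n * dX k 1 ^ n * dX k 1 ^ s) * mu k p a
      = (dY k 1 ^ s * dY k (p * M)) * hp k Q * (dX k (p * M') * (dY k 1 ^ n * dX k 1 ^ n)) *
          dX k 1 ^ s * mu k p a := by simp only [mul_assoc]
    _ = dY k (p * M) * dY k 1 ^ s * (hp k Q * dY k 1 ^ n) * dX k 1 ^ n * (dX k (p * M') *
          dX k 1 ^ s) * mu k p a := by
        rw [← algD_mul_dX k p hD, dY_comm_pow]; simp only [mul_assoc]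
    _ = dY k (p * M) * (dY k 1 ^ s * dY k 1 ^ n) * hp k (shift (-2 * n) Q) *
          ((dX k 1 ^ n * dX k 1 ^ s) * (dX k (p * M') * mu k p a)) := by
        rw [h3, dX_comm_pow]; simp only [mul_assoc]
    _ = dY k (p * M) * dY k 1 ^ (s + n) * hp k (shift (-2 * n) Q) *
          (dX k 1 ^ (s + n) * mu k p a * dX k (p * M')) := by
        rw [← pow_add, ← pow_add, add_comm n s, ← algD_mul_dX k p (mu_mem_algD k p a)]
        simp only [mul_assoc]
    _ = _ := by
        rw [dX_pow_mul_mu, dX_one_pow, dY_one_pow]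
        simp only [mul_smul_comm, smul_mul_assoc, smul_smul, mul_assoc]

theorem Ev_twist (a : ℤ) {s n c : ℕ} (h : s + n < p) (hc : c < p) (A A' : ℕ) (z : U k) :
    Ev k (c + p * A) (c + p * A') (twist k p s z * elt k p a (phiFrom k a s n)) =
      if s + n = c then fun x => ((c.factorial : k) * (c.factorial : k)) *
        (if (p : ℤ) ∣ x - (a + 2 * c) then Ev k A A' z ((x - 2 * n) / p) else 0) else 0 := by
  have hp0 : 0 < p := (Fact.out : p.Prime).pos
  refine U_induction k (C := fun z => Ev k (c + p * A) (c + p * A')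
    (twist k p s z * elt k p a (phiFrom k a s n)) =
      if s + n = c then fun x => ((c.factorial : k) * (c.factorial : k)) *
        (if (p : ℤ) ∣ x - (a + 2 * c) then Ev k A A' z ((x - 2 * n) / p) else 0) else 0)
    ?_ ?_ ?_ ?_ z
  · simp only [twist, map_zero, mul_zero, zero_mul]
    split_ifs
    · funext x; simp
    · rfl
  · intro u v hu hv
    rw [twist_add, add_mul, map_add, hu, hv]
    split_ifs
    · funext x
      simp only [Pi.add_apply, map_add]
      split_ifs <;> ring
    · simp
  · intro b u hu
    rw [twist_smul, smul_mul_assoc, map_smul, hu]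
    split_ifs
    · funext x
      simp only [Pi.smul_apply, map_smul, smul_eq_mul]
      split_ifs <;> ring
    · simp
  · intro M P M'
    obtain ⟨Q, hQ⟩ := exists_frob k p P
    rw [twist_pbw_mul_elt_phiFrom k p a h M M' hQ, map_smul, Ev_dY_hp_dX]
    by_cases hsn : s + n = c
    · rw [hsn, if_pos rfl]
      have hiff : (c + p * M = c + p * A ∧ c + p * M' = c + p * A') ↔ (M = A ∧ M' = A') := by
        rw [Nat.add_left_cancel_iff, Nat.add_left_cancel_iff, Nat.mul_right_inj hp0.ne',
          Nat.mul_right_inj hp0.ne']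
      rw [Ev_dY_hp_dX]
      funext x
      by_cases hM : M = A ∧ M' = A'
      · rw [if_pos hM, if_pos (hiff.2 hM), Pi.smul_apply, smul_eq_mul, val_mul, Int.cast_mul, val_mu,
          val_shift, IsFrob.val_eq hQ, show x + -2 * (n : ℤ) = x - 2 * n by ring]
        split_ifs <;> ring
      · rw [if_neg hM, if_neg (fun h => hM (hiff.1 h))]
        simp
    · rw [if_neg hsn, if_neg, smul_zero]
      rintro ⟨h1, -⟩
      have := congrArg (· % p) h1
      simp only [Nat.add_mul_mod_self_left, Nat.mod_eq_of_lt h, Nat.mod_eq_of_lt hc] at this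
      exact hsn this

/-- The twist by `Y^s X^s g(YX) μ_a` is injective if `g` misses just one root: the top coefficient
recovers all coefficients of `z`. -/
theorem twist_injective {a : ℤ} {s : ℕ} {g : Polynomial k} (hs : s < p) {c : k}
    (hg : phiFrom k a 0 s * g * (Polynomial.X - Polynomial.C c) = phiFrom k a 0 p) {z : U k}
    (hz : twist k p s z * elt k p a g = 0) : z = 0 := by
  have hp' : p.Prime := Fact.out
  set d := p - 1 - s with hd
  have hmonic : g.Monic :=
    (monic_phiFrom k a 0 s).of_mul_monic_left
      ((Polynomial.monic_X_sub_C c).of_mul_monic_right (hg ▸ monic_phiFrom k a 0 p))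
  have hdeg : g.natDegree = d := by
    have h1 := congrArg Polynomial.natDegree hg
    rw [((monic_phiFrom k a 0 s).mul hmonic).natDegree_mul (Polynomial.monic_X_sub_C c),
      (monic_phiFrom k a 0 s).natDegree_mul hmonic, natDegree_phiFrom, natDegree_phiFrom,
      Polynomial.natDegree_X_sub_C] at h1
    omega
  obtain ⟨e, he⟩ := exists_phiFrom_expansion k a s d (g - phiFrom k a s d) (by
    have h1 : g.degree = d := by rw [Polynomial.degree_eq_natDegree hmonic.ne_zero, hdeg]
    have h2 : (phiFrom k a s d).degree = d := by
      rw [Polynomial.degree_eq_natDegree (monic_phiFrom k a s d).ne_zero, natDegree_phiFrom]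
    have := Polynomial.degree_sub_lt_left (h1.trans h2.symm) hmonic.ne_zero
      (by rw [hmonic.leadingCoeff, (monic_phiFrom k a s d).leadingCoeff])
    rwa [h1] at this)
  rw [sub_eq_iff_eq_add] at he
  have hf : ((p - 1).factorial : k) ≠ 0 := by
    rw [Ne, CharP.cast_eq_zero_iff k p, hp'.dvd_factorial]
    have := hp'.pos
    omega
  refine eq_zero_of_Ev k fun A A' => ?_
  funext t
  have h0 := congrArg (Ev k ((p - 1) + p * A) ((p - 1) + p * A')) hz
  have esum : elt k p a g = ∑ n ∈ Finset.range d, e n • elt k p a (phiFrom k a s n)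
      + elt k p a (phiFrom k a s d) := by
    conv_lhs => rw [he]
    rw [elt_add]
    congr 1
    simp only [elt, map_sum, map_smul, Finset.sum_mul, smul_mul_assoc]
  have hlt : p - 1 < p := Nat.sub_lt hp'.pos one_pos
  rw [esum, mul_add, Finset.mul_sum, map_add, map_sum, map_zero, Finset.sum_eq_zero, zero_add,
    Ev_twist k p a (by omega) hlt, if_pos (by omega)] at h0
  · -- evaluate at the point of the right residue class lying over `t`
    set x : ℤ := (a + 2 * (p - 1 : ℕ)) + p * (t - (a + 2 * (p - 1 : ℕ) - 2 * d) / p) with hx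
    have h1 := congrFun h0 x
    have hp0 : (p : ℤ) ≠ 0 := by exact_mod_cast hp'.ne_zero
    simp only [Pi.zero_apply] at h1
    rw [if_pos ⟨t - (a + 2 * (p - 1 : ℕ) - 2 * d) / p, by rw [hx]; ring⟩, show x - 2 * d = (a + 2 * (p - 1 : ℕ) - 2 * d) +
      p * (t - (a + 2 * (p - 1 : ℕ) - 2 * d) / p) by rw [hx]; ring,
      Int.add_mul_ediv_left _ _ hp0] at h1
    rw [add_sub_cancel] at h1
    exact (mul_eq_zero.1 h1).resolve_left (mul_ne_zero hf hf)
  · intro n hn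
    have := Finset.mem_range.1 hn
    rw [mul_smul_comm, map_smul, Ev_twist k p a (by omega) hlt, if_neg (by omega), smul_zero]

/-- The minimal polynomial of `YX` on the weight `a` of `U_1`. -/
theorem dvd_of_elt_eq_zero {a : ℤ} {h : Polynomial k} (hh : elt k p a h = 0) :
    phiFrom k a 0 p ∣ h := by
  have hp' : p.Prime := Fact.out
  set f := h %ₘ phiFrom k a 0 p with hf
  have hmon := monic_phiFrom k a 0 p
  have hdvd : phiFrom k a 0 p ∣ h - f :=
    ⟨h /ₘ phiFrom k a 0 p, sub_eq_iff_eq_add'.2 (Polynomial.modByMonic_add_div h _).symm⟩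
  have hf0 : elt k p a f = 0 := by
    have := twist_mul_elt_congr k p (a := a) (s := 0) hp'.pos (f := h) (g := f)
      (by simpa [phiFrom] using hdvd) 1
    simp only [twist, Fr'_one, pow_zero, one_mul] at this
    rw [← this, hh]
  have hdeg : f.degree < p := by
    have := Polynomial.degree_modByMonic_lt h hmon
    rwa [Polynomial.degree_eq_natDegree hmon.ne_zero, natDegree_phiFrom] at this
  obtain ⟨c, hc⟩ := exists_phiFrom_expansion k a 0 p f hdeg
  have hzero : ∀ n < p, c n = 0 := by
    intro n hn
    have e : elt k p a f = ∑ m ∈ Finset.range p, c m • (twist k p 0 1 * elt k p a (phiFrom k a 0 m)) := by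
      rw [hc]
      simp only [elt, twist, Fr'_one, pow_zero, one_mul, map_sum, map_smul, Finset.sum_mul,
        smul_mul_assoc]
    rw [hf0] at e
    have h1 := congrFun (congrArg (Ev k (n + p * 0) (n + p * 0)) e.symm) (a + 2 * n)
    rw [map_zero, map_sum, Finset.sum_apply, Finset.sum_eq_single n] at h1
    · rw [map_smul, Ev_twist k p a (by omega) hn, if_pos (by omega), Pi.smul_apply,
        if_pos (by simp)] at h1
      have h2 : Ev k 0 0 (1 : U k) ((a + 2 * n - 2 * n) / p) = 1 := by
        have h3 := Ev_dY_hp_dX k 0 0 0 0 1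
        rw [map_one, dX_zero, dY_zero, mul_one, mul_one, if_pos ⟨rfl, rfl⟩] at h3
        simp only [h3, val_one, Int.cast_one]
      rw [h2, Pi.zero_apply, smul_eq_mul, mul_one] at h1
      have hfac : (n.factorial : k) ≠ 0 := by
        rw [Ne, CharP.cast_eq_zero_iff k p, hp'.dvd_factorial]
        omega
      exact (mul_eq_zero.1 h1).resolve_right (mul_ne_zero hfac hfac)
    · intro m hm hne
      rw [map_smul, Ev_twist k p a (by have := Finset.mem_range.1 hm; omega) hn,
        if_neg (by omega), smul_zero]
      rfl
    · intro h; exact absurd (Finset.mem_range.2 hn) h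
  have : f = 0 := by
    rw [hc]
    exact Finset.sum_eq_zero fun n hn => by rw [hzero n (Finset.mem_range.1 hn), zero_smul]
  rwa [this, sub_zero] at hdvd

end Injectivity

/-! ### The action of `A_{r+1}` on a twist -/

section Action

variable (k : Type*) [Field k] (p : ℕ)

theorem mem_ArMod {r : ℕ} {b x : U k} : x ∈ ArMod k p r b ↔ ∃ w ∈ Ar k p r, w * b = x := by
  rw [ArMod, Submodule.restrictScalars_mem, Submodule.mem_span_singleton]
  constructor
  · rintro ⟨w, rfl⟩
    exact ⟨w, w.2, rfl⟩
  · rintro ⟨w, hw, rfl⟩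
    exact ⟨⟨w, hw⟩, rfl⟩

variable [Fact p.Prime] [CharP k p]

theorem algD_le_Ar (r : ℕ) : algD k p ≤ Ar k p (r + 1) := by
  have hp' : p.Prime := Fact.out
  have hlt : 1 < p ^ (r + 1) := Nat.one_lt_pow (Nat.succ_ne_zero r) hp'.one_lt
  refine Algebra.adjoin_le ?_
  rintro _ (rfl | ⟨P, hP, rfl⟩)
  · have := pbw_mem_pbwSpan k (s := idxA p (r + 1)) (m := 1) (n := 0) (m' := 1)
      ⟨rfl, hlt, by simp only; omega⟩
    rw [pbw_eq, show bin 0 0 = 1 from intPoly_ext fun n => by simp, map_one, mul_one] at this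
    exact (mem_Ar_iff k p _).2 this
  · have hP' : IsPer k (p ^ (r + 1)) P := fun z => by
      rw [← hP.add_mul k z (p ^ r)]
      congr 2
      push_cast
      ring
    have := mem_pbwSpan_of_isPer k p (s := idxA p (r + 1)) (m := 0) (m' := 0) hP'
      (fun n hn => ⟨rfl, by simp only; omega, hn⟩)
    rw [dX_zero, dY_zero, mul_one, one_mul] at this
    exact (mem_Ar_iff k p _).2 this

theorem twist_mem_Ar {r s : ℕ} (hs : s < p) {z : U k} (hz : z ∈ Ar k p r) :
    twist k p s z ∈ Ar k p (r + 1) := by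
  have hp' : p.Prime := Fact.out
  rw [mem_Ar_iff] at hz
  refine pbwSpan_induction k (C := fun z => twist k p s z ∈ Ar k p (r + 1)) ?_ ?_ ?_ ?_ z hz
  · rw [twist, map_zero, mul_zero, zero_mul]; exact zero_mem _
  · intro u v hu hv; rw [twist_add]; exact add_mem hu hv
  · intro c u hu; rw [twist_smul]; exact Subalgebra.smul_mem _ hu _
  rintro m n m' ⟨h1, h2, h3⟩
  change m = m' at h1
  change m < p ^ r at h2
  change n < p ^ r at h3
  subst h1
  have hm : s + p * m < p ^ (r + 1) := by
    have := Nat.mul_le_mul_left p (Nat.succ_le_of_lt h2)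
    rw [← pow_succ', Nat.mul_succ] at this
    omega
  have hn : p * n < p ^ (r + 1) := by
    rw [pow_succ']; exact Nat.mul_lt_mul_of_pos_left h3 hp'.pos
  have hF := Fr'_of_isFrob k p m m (isFrob_bin k p 0 n)
  have e : twist k p s (dY k m * hp k (bin 0 n) * dX k m) = ((s.factorial : k) * (s.factorial : k)) •
      (dY k (s + p * m) * hp k (bin (p * 0) (p * n)) * dX k (s + p * m)) := by
    rw [twist, hF, ← mul_assoc, ← mul_assoc, ← dY_comm_pow, mul_assoc _ (dX k _), dX_comm_pow,
      dY_add_mul k p hs, dX_add_mul k p hs, dX_one_pow, dY_one_pow]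
    simp only [mul_smul_comm, smul_mul_assoc, smul_smul, mul_assoc]
  rw [e, mul_zero, ← pbw_eq]
  exact Subalgebra.smul_mem _ ((mem_Ar_iff k p _).2 (pbw_mem_pbwSpan k ⟨rfl, hm, hn⟩)) _

/-- The data attached to a pair `(a, j)`: `Q` is the product of the factors of the polynomial
`∏ (x - i (i + a + 1))` which do not belong to the block of `(a, j)` and do not come from `Y^s X^s`,
and `m` is the factor belonging to the block. -/
structure IsBlock (a : ℤ) (s : ℕ) (Q m : Polynomial k) : Prop where
  lt : s < p
  fac : phiFrom k a 0 p = phiFrom k a 0 s * Q * m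
  coprime : IsCoprime (phiFrom k a 0 s) m
  good : IsGood k p a s Q

variable {k p}

theorem IsBlock.twist_congr {a : ℤ} {s : ℕ} {Q m : Polynomial k} (hB : IsBlock k p a s Q m)
    {f g : Polynomial k} (h : m * Q ∣ f - g) (z : U k) :
    twist k p s z * elt k p a f = twist k p s z * elt k p a g := by
  refine twist_mul_elt_congr k p hB.lt ?_ z
  obtain ⟨c, hc⟩ := h
  rw [hc, hB.fac]
  exact ⟨c, by ring⟩

/-- The factor `Y^s X^s` is invertible on the block, so that twists can be multiplied freely there. -/
theorem IsBlock.exists_inverse {a : ℤ} {s : ℕ} {Q m : Polynomial k} (hB : IsBlock k p a s Q m) :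
    ∃ g0 : Polynomial k, ∀ (z z' : U k) (h g : Polynomial k), Q ∣ g →
      twist k p s z * elt k p a (h * g0) * (twist k p s z' * elt k p a g)
        = twist k p s (z * z') * elt k p a (h * g) := by
  obtain ⟨g0, v, hv⟩ := hB.coprime
  refine ⟨g0, fun z z' h g hg => ?_⟩
  have e : twist k p s z * elt k p a (h * g0) * (twist k p s z' * elt k p a g)
      = twist k p s z * (twist k p s z' * elt k p a (h * g0 * g)) := by
    rw [mul_assoc, ← mul_assoc (elt k p a _), algD_mul_twist k p (elt_mem_algD k p a _), mul_assoc,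
      elt_mul_elt]
  rw [e, twist_mul_twist k p hB.good (hg.mul_left _)]
  refine hB.twist_congr ?_ _
  obtain ⟨c, rfl⟩ := hg
  refine ⟨- v * h * c, ?_⟩
  have : phiFrom k a 0 s * (h * g0 * (Q * c)) - h * (Q * c)
      = h * (Q * c) * ((g0 * phiFrom k a 0 s + v * m) - 1 - v * m) := by ring
  rw [this, hv]
  ring

/-- The `A_{r+1}`-module generated by `Y^s Fr'(z) X^s g(YX) μ_a`. -/
theorem IsBlock.ArMod_twist {a : ℤ} {s : ℕ} {Q m : Polynomial k} (hB : IsBlock k p a s Q m) (r : ℕ)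
    (z : U k) {g : Polynomial k} (hg : Q ∣ g) :
    ArMod k p (r + 1) (twist k p s z * elt k p a g) = Submodule.span k
      {x | ∃ z' ∈ ArMod k p r z, ∃ h, x = twist k p s z' * elt k p a (h * g)} := by
  obtain ⟨g0, hg0⟩ := hB.exists_inverse
  apply le_antisymm
  · intro x hx
    obtain ⟨w, hw, rfl⟩ := (mem_ArMod k p).1 hx
    rw [mem_Ar_iff] at hw
    refine pbwSpan_induction k (C := fun w => w * _ ∈ Submodule.span k _) ?_ ?_ ?_ ?_ w hw
    · rw [zero_mul]; exact zero_mem _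
    · intro u v hu hv; rw [add_mul]; exact add_mem hu hv
    · intro c u hu; rw [smul_mul_assoc]; exact Submodule.smul_mem _ _ hu
    rintro l n l' ⟨h1, h2, h3⟩
    change l = l' at h1
    subst h1
    obtain ⟨z', hz', h, hh⟩ := pbw_mul_twist_one k p r a s h2 h3
    refine Submodule.subset_span ⟨z' * z, (mem_ArMod k p).2 ⟨z', hz', rfl⟩, h, ?_⟩
    have e := hg0 1 z 1 g hg
    rw [one_mul, one_mul, one_mul] at e
    rw [← e, ← mul_assoc, hh, hg0 z' z h g hg]
  · refine Submodule.span_le.2 ?_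
    rintro _ ⟨_, hz', h, rfl⟩
    obtain ⟨w, hw, rfl⟩ := (mem_ArMod k p).1 hz'
    refine (mem_ArMod k p).2 ⟨twist k p s w * elt k p a (h * g0), ?_, hg0 w z h g hg⟩
    exact mul_mem (twist_mem_Ar k p hB.lt hw) (algD_le_Ar k p r (elt_mem_algD k p a _))

end Action

/-! ### The step from `r` to `r + 1` pairs -/

section Step

variable (k : Type*) [Field k] (p : ℕ)

/-- The linear map `z ↦ Y^s Fr'(z) X^s g(YX) μ_a`. -/
def stepMap (a : ℤ) (s : ℕ) (g : Polynomial k) : U k →ₗ[k] U k where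
  toFun z := twist k p s z * elt k p a g
  map_add' u v := by rw [twist_add, add_mul]
  map_smul' c u := by rw [twist_smul, smul_mul_assoc, RingHom.id_apply]

theorem stepMap_apply (a : ℤ) (s : ℕ) (g : Polynomial k) (z : U k) :
    stepMap k p a s g z = twist k p s z * elt k p a g := rfl

theorem stepMap_smul (a : ℤ) (s : ℕ) (c : k) (g : Polynomial k) (z : U k) :
    stepMap k p a s (Polynomial.C c * g) z = stepMap k p a s g (c • z) := by
  rw [stepMap_apply, ← Polynomial.smul_eq_C_mul, elt_smul, mul_smul_comm, map_smul, stepMap_apply]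

variable [Fact p.Prime] [CharP k p] {k p}
variable {a : ℤ} {s : ℕ} {Q : Polynomial k} {c : k}

/-- In a block with a simple root, `A_{r+1}` acts through `A_r`: weight-zero elements of `U_1` act by
scalars. -/
theorem IsBlock.ArMod_stepMap (hB : IsBlock k p a s Q (Polynomial.X - Polynomial.C c)) (r : ℕ)
    (z : U k) :
    ArMod k p (r + 1) (stepMap k p a s Q z) = (ArMod k p r z).map (stepMap k p a s Q) := by
  rw [stepMap_apply, hB.ArMod_twist r z dvd_rfl]
  apply le_antisymm
  · refine Submodule.span_le.2 ?_
    rintro _ ⟨z', hz', h, rfl⟩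
    obtain ⟨d, hd⟩ := Polynomial.X_sub_C_dvd_sub_C_eval (a := c) (p := h)
    rw [hB.twist_congr (f := h * Q) (g := Polynomial.C (h.eval c) * Q)
      ⟨d, by rw [← sub_mul, hd]; ring⟩, ← stepMap_apply, stepMap_smul]
    exact Submodule.mem_map_of_mem (Submodule.smul_mem _ _ hz')
  · rintro _ ⟨z', hz', rfl⟩
    exact Submodule.subset_span ⟨z', hz', 1, by rw [one_mul, stepMap_apply]⟩

theorem IsBlock.stepMap_injective (hB : IsBlock k p a s Q (Polynomial.X - Polynomial.C c)) :
    Function.Injective (stepMap k p a s Q) := by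
  rw [← LinearMap.ker_eq_bot, LinearMap.ker_eq_bot']
  exact fun z hz => twist_injective k p hB.lt hB.fac.symm hz

/-- In a block with a double root `c`, the element divisible by `x - c` generates only what `A_r`
generates: `x` acts on it by the scalar `c`. -/
theorem IsBlock.ArMod_stepMap_socle
    (hB : IsBlock k p a s Q ((Polynomial.X - Polynomial.C c) ^ 2)) (r : ℕ) (z : U k) :
    ArMod k p (r + 1) (stepMap k p a s ((Polynomial.X - Polynomial.C c) * Q) z) =
      (ArMod k p r z).map (stepMap k p a s ((Polynomial.X - Polynomial.C c) * Q)) := by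
  rw [stepMap_apply, hB.ArMod_twist r z (dvd_mul_left _ _)]
  apply le_antisymm
  · refine Submodule.span_le.2 ?_
    rintro _ ⟨z', hz', h, rfl⟩
    obtain ⟨d, hd⟩ := Polynomial.X_sub_C_dvd_sub_C_eval (a := c) (p := h)
    rw [hB.twist_congr (g := Polynomial.C (h.eval c) * ((Polynomial.X - Polynomial.C c) * Q))
      ⟨d, by rw [← sub_mul, hd]; ring⟩, ← stepMap_apply, stepMap_smul]
    exact Submodule.mem_map_of_mem (Submodule.smul_mem _ _ hz')
  · rintro _ ⟨z', hz', rfl⟩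
    exact Submodule.subset_span ⟨z', hz', 1, by rw [one_mul, stepMap_apply]⟩

/-- In a block with a double root `c`, a generator not divisible by `x - c` gives both summands. -/
theorem IsBlock.ArMod_stepMap_sup
    (hB : IsBlock k p a s Q ((Polynomial.X - Polynomial.C c) ^ 2)) {u : Polynomial k}
    (hu : u.eval c ≠ 0) (r : ℕ) (z : U k) :
    ArMod k p (r + 1) (stepMap k p a s (u * Q) z) =
      (ArMod k p r z).map (stepMap k p a s (u * Q)) ⊔
        (ArMod k p r z).map (stepMap k p a s ((Polynomial.X - Polynomial.C c) * Q)) := by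
  rw [stepMap_apply, hB.ArMod_twist r z (dvd_mul_left _ _)]
  obtain ⟨e, he⟩ := Polynomial.X_sub_C_dvd_sub_C_eval (a := c) (p := u)
  apply le_antisymm
  · refine Submodule.span_le.2 ?_
    rintro _ ⟨z', hz', h, rfl⟩
    -- `h = h(c) + (x - c) d` and `d u` may be replaced by its value at `c`
    obtain ⟨d, hd⟩ := Polynomial.X_sub_C_dvd_sub_C_eval (a := c) (p := h)
    obtain ⟨f, hf⟩ := Polynomial.X_sub_C_dvd_sub_C_eval (a := c) (p := d * u)
    rw [hB.twist_congr (g := Polynomial.C (h.eval c) * (u * Q) +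
      Polynomial.C ((d * u).eval c) * ((Polynomial.X - Polynomial.C c) * Q))
      ⟨f, by linear_combination u * Q * hd + (Polynomial.X - Polynomial.C c) * Q * hf⟩,
      elt_add, mul_add, ← stepMap_apply, ← stepMap_apply, stepMap_smul, stepMap_smul]
    exact Submodule.add_mem_sup (Submodule.mem_map_of_mem (Submodule.smul_mem _ _ hz'))
      (Submodule.mem_map_of_mem (Submodule.smul_mem _ _ hz'))
  · refine sup_le ?_ ?_
    · rintro _ ⟨z', hz', rfl⟩
      exact Submodule.subset_span ⟨z', hz', 1, by rw [one_mul, stepMap_apply]⟩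
    · rintro _ ⟨z', hz', rfl⟩
      refine Submodule.subset_span ⟨z', hz',
        Polynomial.C (u.eval c)⁻¹ * (Polynomial.X - Polynomial.C c), ?_⟩
      rw [stepMap_apply]
      have h1 : Polynomial.C (u.eval c)⁻¹ * Polynomial.C (u.eval c) = (1 : Polynomial k) := by
        rw [← Polynomial.C_mul, inv_mul_cancel₀ hu, Polynomial.C_1]
      refine hB.twist_congr ⟨- Polynomial.C (u.eval c)⁻¹ * e, ?_⟩ z'
      linear_combination -(Polynomial.C (u.eval c)⁻¹ * (Polynomial.X - Polynomial.C c) * Q * he) -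
        (Polynomial.X - Polynomial.C c) * Q * h1

/-- The factors of `φ_{a,p}` other than one copy of `x - c` do not kill any coefficient of `z`. -/
theorem IsBlock.stepMap_socle_injective
    (hB : IsBlock k p a s Q ((Polynomial.X - Polynomial.C c) ^ 2)) {z : U k}
    (hz : stepMap k p a s ((Polynomial.X - Polynomial.C c) * Q) z = 0) : z = 0 :=
  twist_injective k p (g := (Polynomial.X - Polynomial.C c) * Q) hB.lt (c := c)
    (by rw [hB.fac]; ring) hz

theorem IsBlock.stepMap_add_eq_zero
    (hB : IsBlock k p a s Q ((Polynomial.X - Polynomial.C c) ^ 2)) {u : Polynomial k}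
    (hu : u.eval c ≠ 0) {z w : U k}
    (h : stepMap k p a s (u * Q) z +
      stepMap k p a s ((Polynomial.X - Polynomial.C c) * Q) w = 0) : z = 0 ∧ w = 0 := by
  obtain ⟨e, he⟩ := Polynomial.X_sub_C_dvd_sub_C_eval (a := c) (p := u)
  have hz : z = 0 := by
    -- multiplication by `(x - c)` on the right kills the second summand
    have h1 := congrArg (· * elt k p a (Polynomial.X - Polynomial.C c)) h
    simp only [zero_mul, add_mul, stepMap_apply, mul_assoc, elt_mul_elt] at h1
    rw [hB.twist_congr (g := Polynomial.C (u.eval c) * ((Polynomial.X - Polynomial.C c) * Q))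
        ⟨e, by linear_combination (Polynomial.X - Polynomial.C c) * Q * he⟩,
      hB.twist_congr (g := 0) (z := w) ⟨1, by ring⟩,
      show elt k p a 0 = 0 by rw [elt, map_zero, zero_mul], mul_zero, add_zero, ← stepMap_apply,
      stepMap_smul] at h1
    rw [← inv_smul_smul₀ hu z, hB.stepMap_socle_injective h1, smul_zero]
  refine ⟨hz, hB.stepMap_socle_injective ?_⟩
  rwa [hz, map_zero, zero_add] at h

end Step

/-! ### The elements `Z` as values of step maps -/

section ZElements

variable (k : Type*) [Field k] (p : ℕ)

theorem elt_sum (a : ℤ) {ι : Type*} (S : Finset ι) (g : ι → Polynomial k) :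
    elt k p a (∑ i ∈ S, g i) = ∑ i ∈ S, elt k p a (g i) := by
  rw [elt, map_sum, Finset.sum_mul]; rfl

theorem elt_one (a : ℤ) : elt k p a 1 = mu k p a := by rw [elt, map_one, one_mul]

variable [Fact p.Prime] [CharP k p]

/-- The embedding of `𝔽_p` into `k`. -/
abbrev modHom : ZMod p →+* k := ZMod.castHom (dvd_refl p) k

theorem phi_eq_phiFrom (a : ℤ) (m : ℕ) : phi p a m = phiFrom (ZMod p) a 0 m := by
  simp [phi, phiFrom]

theorem map_phiFrom (a : ℤ) (s m : ℕ) :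
    (phiFrom (ZMod p) a s m).map (modHom k p) = phiFrom k a s m := by
  simp [phiFrom, Polynomial.map_prod]

theorem mu_mul_dY_pow_mul_dX_pow (a : ℤ) (m : ℕ) :
    mu k p a * (dY k 1 ^ m * dX k 1 ^ m) = elt k p a (phiFrom k a 0 m) := by
  rw [← mul_one (phiFrom k a 0 m), elt_phiFrom, elt_one,
    algD_comm k (mu_mem_algD k p a) (dY_pow_mul_dX_pow_mem k p m)]

/-- The expression of `g(YX) μ_a` by the `Y^m X^m` with `n ≤ m < p`, if `φ_{a,n}` divides `g`. -/
theorem exists_coeff {a : ℤ} {n : ℕ} {G : Polynomial (ZMod p)} (hG : phi p a n ∣ G) :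
    ∃ c : ℕ → ZMod p, elt k p a (G.map (modHom k p)) = mu k p a *
      ∑ m ∈ Finset.Icc n (p - 1), modHom k p (c m) • (dY k 1 ^ m * dX k 1 ^ m) := by
  have hp' : p.Prime := Fact.out
  have hcongr : ∀ f g : Polynomial (ZMod p), phiFrom (ZMod p) a 0 p ∣ f - g →
      elt k p a (f.map (modHom k p)) = elt k p a (g.map (modHom k p)) := by
    intro f g h
    have h' := Polynomial.map_dvd (modHom k p) h
    rw [map_phiFrom, Polynomial.map_sub] at h'
    have := twist_mul_elt_congr k p (a := a) (s := 0) hp'.pos (by simpa [phiFrom] using h') 1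
    simpa [twist, Fr'_one] using this
  rw [phi_eq_phiFrom] at hG
  obtain ⟨H, rfl⟩ := hG
  rcases lt_or_ge n p with hn | hn
  · obtain ⟨d, hd⟩ : ∃ d, p = n + d := ⟨p - n, by omega⟩
    have hsplit : phiFrom (ZMod p) a 0 p = phiFrom (ZMod p) a 0 n * phiFrom (ZMod p) a n d := by
      have := phiFrom_add (ZMod p) a 0 n d
      rwa [← hd, zero_add] at this
    have hmon := monic_phiFrom (ZMod p) a n d
    obtain ⟨c, hc⟩ := exists_phiFrom_expansion (ZMod p) a n d (H %ₘ phiFrom (ZMod p) a n d) (by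
      have := Polynomial.degree_modByMonic_lt H hmon
      rwa [Polynomial.degree_eq_natDegree hmon.ne_zero, natDegree_phiFrom] at this)
    refine ⟨fun m => c (m - n), ?_⟩
    rw [hcongr _ (phiFrom (ZMod p) a 0 n * (H %ₘ phiFrom (ZMod p) a n d)) (by
      rw [← mul_sub, hsplit]
      refine mul_dvd_mul_left _ ⟨H /ₘ phiFrom (ZMod p) a n d, ?_⟩
      rw [sub_eq_iff_eq_add', Polynomial.modByMonic_add_div H]), hc, Finset.mul_sum,
      Polynomial.map_sum, elt_sum, Finset.mul_sum]
    refine Finset.sum_bij (fun i _ => n + i) ?_ ?_ ?_ ?_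
    · intro i hi
      have := Finset.mem_range.1 hi
      rw [Finset.mem_Icc]
      omega
    · intro i _ j _ h
      exact Nat.add_left_cancel h
    · intro m hm
      have := Finset.mem_Icc.1 hm
      exact ⟨m - n, Finset.mem_range.2 (by omega), by omega⟩
    · intro i _
      simp only
      rw [Nat.add_sub_cancel_left, mul_smul_comm, mul_smul_comm (modHom k p (c i)),
        mu_mul_dY_pow_mul_dX_pow,
        Polynomial.smul_eq_C_mul, Polynomial.map_mul, Polynomial.map_C, ← Polynomial.smul_eq_C_mul,
        elt_smul]
      congr 2
      rw [Polynomial.map_mul, map_phiFrom, map_phiFrom, phiFrom_add, zero_add]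
  · refine ⟨0, ?_⟩
    obtain ⟨d, hd⟩ := Nat.exists_eq_add_of_le hn
    rw [hcongr _ 0 (by
      rw [sub_zero, hd, phiFrom_add, mul_assoc]
      exact dvd_mul_right _ _), Finset.Icc_eq_empty (by have := hp'.pos; omega), Finset.sum_empty,
      mul_zero, Polynomial.map_zero, elt, map_zero, zero_mul]

theorem mu_mul_dY_pow_mul_Fr'_mul_dX_pow (a : ℤ) {s m : ℕ} (h : s ≤ m) (z : U k) :
    mu k p a * (dY k 1 ^ m * dX k 1 ^ (m - s) * Fr' k p z * dX k 1 ^ s) =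
      stepMap k p a s (phiFrom k a s (m - s)) z := by
  obtain ⟨n, rfl⟩ := Nat.exists_eq_add_of_le h
  have h1 := twist_mul_elt_phiFrom k p a s n z 1
  have h2 := dY_pow_mul_dX_pow_mem k p n
  have h3 := mu_mem_algD k p (a + 2 * s)
  rw [mul_one, elt_one] at h1
  rw [Nat.add_sub_cancel_left, stepMap_apply, h1]
  calc mu k p a * (dY k 1 ^ (s + n) * dX k 1 ^ n * Fr' k p z * dX k 1 ^ s)
      = mu k p a * dY k 1 ^ s * ((dY k 1 ^ n * dX k 1 ^ n) * Fr' k p z) * dX k 1 ^ s := by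
        rw [pow_add]; simp only [mul_assoc]
    _ = dY k 1 ^ s * (mu k p (a + 2 * s) * Fr' k p z * (dY k 1 ^ n * dX k 1 ^ n)) * dX k 1 ^ s := by
        rw [mu_mul_dY_pow, algD_mul_Fr' h2]; simp only [mul_assoc]
    _ = dY k 1 ^ s * (Fr' k p z * ((dY k 1 ^ n * dX k 1 ^ n) * mu k p (a + 2 * s))) *
          dX k 1 ^ s := by
        rw [algD_mul_Fr' h3, algD_comm k h2 h3]; simp only [mul_assoc]
    _ = dY k 1 ^ s * Fr' k p z * (dY k 1 ^ n * dX k 1 ^ n) * (mu k p (a + 2 * s) *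
          dX k 1 ^ s) := by simp only [mul_assoc]
    _ = _ := by rw [← dX_pow_mul_mu]; simp only [mul_assoc]

/-- For the pairs of types A and C, the element `Z(z; (a, j))` is `Y^s Fr'(z) X^s g(YX) μ_a`, where
`g` is the quotient of the polynomial of `B(a, j)` by that of `Y^s X^s`. -/
theorem Z_eq_stepMap {ε : Fin 2} {q : ℕ × ℚ} (hAC : condAC p q) {G : Polynomial (ZMod p)}
    (hB : B₁ k p ε q = elt k p q.1 (G.map (modHom k p))) (hG : phi p q.1 (nE p ε q) ∣ G)
    (hsn : sInt p q ≤ nE p ε q) (hs : sInt p q < p) {g : Polynomial k}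
    (hg : phiFrom k q.1 0 (sInt p q) * g = G.map (modHom k p)) (z : U k) :
    Z k p ε z q = stepMap k p q.1 (sInt p q) g z := by
  have hspec : B₁ k p ε q = mu k p q.1 * ∑ m ∈ Finset.Icc (nE p ε q) (p - 1),
      ZMod.castHom (dvd_refl p) k (coeffB k p ε q m) • (dY k 1 ^ m * dX k 1 ^ m) :=
    Classical.epsilon_spec (p := fun c : ℕ → ZMod p =>
      B₁ k p ε q = mu k p q.1 * ∑ m ∈ Finset.Icc (nE p ε q) (p - 1),
        ZMod.castHom (dvd_refl p) k (c m) • (dY k 1 ^ m * dX k 1 ^ m)) (by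
      rw [hB]
      exact exists_coeff k p hG)
  set c := coeffB k p ε q with hc
  set f : Polynomial k := ∑ m ∈ Finset.Icc (nE p ε q) (p - 1),
    modHom k p (c m) • phiFrom k q.1 (sInt p q) (m - sInt p q) with hf
  have h1 : Z k p ε z q = stepMap k p q.1 (sInt p q) f z := by
    rw [Z, if_pos hAC, Finset.mul_sum, stepMap_apply, hf, elt_sum, Finset.mul_sum]
    refine Finset.sum_congr rfl fun m hm => ?_
    rw [mul_smul_comm, mu_mul_dY_pow_mul_Fr'_mul_dX_pow k p _
      (hsn.trans (Finset.mem_Icc.1 hm).1), elt_smul, mul_smul_comm, stepMap_apply]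
  have h2 : elt k p q.1 (phiFrom k q.1 0 (sInt p q) * f) = B₁ k p ε q := by
    rw [hspec, hf, Finset.mul_sum, elt_sum, Finset.mul_sum]
    refine Finset.sum_congr rfl fun m hm => ?_
    have := hsn.trans (Finset.mem_Icc.1 hm).1
    rw [mul_smul_comm, elt_smul, mul_smul_comm, mu_mul_dY_pow_mul_dX_pow]
    congr 2
    have e := phiFrom_add k q.1 0 (sInt p q) (m - sInt p q)
    rw [zero_add, Nat.add_sub_cancel' this] at e
    exact e.symm
  rw [h1, stepMap_apply, stepMap_apply]
  refine twist_mul_elt_congr k p hs ?_ z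
  refine dvd_of_elt_eq_zero k p ?_
  rw [mul_sub, sub_eq_add_neg, elt_add, hg, h2, hB, ← neg_one_smul k, elt_smul, neg_one_smul,
    add_neg_cancel]

/-- For the pairs of types B and D. -/
theorem Z_eq_stepMap_zero {ε : Fin 2} {q : ℕ × ℚ} (hAC : ¬ condAC p q) {g : Polynomial k}
    (hB : B₁ k p ε q = elt k p q.1 g) (z : U k) : Z k p ε z q = stepMap k p q.1 0 g z := by
  rw [Z, if_neg hAC, stepMap_apply, hB, twist, pow_zero, pow_zero, one_mul, mul_one]

theorem Z_one {ε : Fin 2} {q : ℕ × ℚ} {G : Polynomial (ZMod p)}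
    (hB : B₁ k p ε q = elt k p q.1 (G.map (modHom k p))) (hG : phi p q.1 (nE p ε q) ∣ G)
    (hsn : condAC p q → sInt p q ≤ nE p ε q) : Z k p ε 1 q = B₁ k p ε q := by
  by_cases hAC : condAC p q
  · have hspec : B₁ k p ε q = mu k p q.1 * ∑ m ∈ Finset.Icc (nE p ε q) (p - 1),
        ZMod.castHom (dvd_refl p) k (coeffB k p ε q m) • (dY k 1 ^ m * dX k 1 ^ m) :=
      Classical.epsilon_spec (p := fun c : ℕ → ZMod p =>
        B₁ k p ε q = mu k p q.1 * ∑ m ∈ Finset.Icc (nE p ε q) (p - 1),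
          ZMod.castHom (dvd_refl p) k (c m) • (dY k 1 ^ m * dX k 1 ^ m)) (by
        rw [hB]
        exact exists_coeff k p hG)
    conv_rhs => rw [hspec]
    rw [Z, if_pos hAC]
    congr 1
    refine Finset.sum_congr rfl fun m hm => ?_
    have := (hsn hAC).trans (Finset.mem_Icc.1 hm).1
    rw [Fr'_one, mul_one, mul_assoc, ← pow_add, Nat.sub_add_cancel this]
  · rw [Z, if_neg hAC, Fr'_one, one_mul]

end ZElements

/-! ### The polynomials attached to a pair, for odd `p` -/

section OddPolynomials

open Polynomial

variable (p : ℕ) [Fact p.Prime]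

/-- The linear factor `x + c² - t²`; for `c = (a + 1) / 2` and `t = i + c` this is
`x - i (i + a + 1)`. -/
def linFac (c t : ZMod p) : (ZMod p)[X] := X - C (t ^ 2 - c ^ 2)

/-- The product of the factors `x + c² - t²` with `t ≠ ±j`. -/
def outerProd (c j : ZMod p) : (ZMod p)[X] :=
  ∏ t ∈ (Finset.univ : Finset (ZMod p)) \ {j, -j}, linFac p c t

/-- The elements `c, c + 1, …, c + n - 1` of `𝔽_p`. -/
def segment (c : ZMod p) (n : ℕ) : Finset (ZMod p) :=
  (Finset.range n).image fun i : ℕ => (i : ZMod p) + c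

variable {p}

theorem linFac_neg (c t : ZMod p) : linFac p c (-t) = linFac p c t := by
  rw [linFac, linFac, neg_sq]

theorem linFac_ne_zero (c t : ZMod p) : linFac p c t ≠ 0 := X_sub_C_ne_zero _

theorem linFac_zero (c : ZMod p) : linFac p c 0 = X + C (c ^ 2) := by
  rw [linFac, zero_pow two_ne_zero, zero_sub, C_neg, sub_neg_eq_add]

theorem comp_eq_linFac (c t : ZMod p) : (X - C (t ^ 2)).comp (X + C (c ^ 2)) = linFac p c t := by
  rw [linFac, sub_comp, X_comp, C_comp, C_sub]
  ring

theorem prod_comp_eq (c : ZMod p) (S : Finset (ZMod p)) :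
    (∏ t ∈ S, (X - C (t ^ 2))).comp (X + C (c ^ 2)) = ∏ t ∈ S, linFac p c t := by
  rw [prod_comp]
  exact Finset.prod_congr rfl fun t _ => comp_eq_linFac c t

theorem outerProd_ne_zero (c j : ZMod p) : outerProd p c j ≠ 0 :=
  Finset.prod_ne_zero_iff.2 fun t _ => linFac_ne_zero c t

theorem cast_injOn_range {s : ℕ} (hs : s ≤ p) (c : ZMod p) :
    Set.InjOn (fun i : ℕ => (i : ZMod p) + c) (Finset.range s : Set ℕ) := by
  intro i hi i' hi' h
  have h1 : ((i : ℕ) : ZMod p) = i' := add_right_cancel h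
  rw [ZMod.natCast_eq_natCast_iff'] at h1
  have hi := Finset.mem_range.1 (Finset.mem_coe.1 hi)
  have hi' := Finset.mem_range.1 (Finset.mem_coe.1 hi')
  rwa [Nat.mod_eq_of_lt (by omega), Nat.mod_eq_of_lt (by omega)] at h1

theorem segment_p (c : ZMod p) : segment p c p = Finset.univ := by
  refine Finset.eq_univ_of_card _ ?_
  rw [segment, Finset.card_image_of_injOn (cast_injOn_range le_rfl c), Finset.card_range, ZMod.card]

theorem phiFrom_eq_prod_linFac {a : ℤ} {c : ZMod p} (hc : 2 * c = a + 1) {s : ℕ} (hs : s ≤ p) :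
    phiFrom (ZMod p) a 0 s = ∏ t ∈ segment p c s, linFac p c t := by
  rw [segment, Finset.prod_image (cast_injOn_range hs c), phiFrom]
  refine Finset.prod_congr rfl fun i _ => ?_
  rw [linFac, zero_add]
  congr 2
  linear_combination (-(i : ZMod p)) * hc

/-- As `i` runs through `𝔽_p`, so does `t = i + c`; hence `φ_{a,p}` is the product of all the factors
`x + c² - t²`. -/
theorem phiFrom_eq_mul {a : ℤ} {c : ZMod p} (hc : 2 * c = a + 1) (j : ZMod p) :
    phiFrom (ZMod p) a 0 p = outerProd p c j * ∏ t ∈ {j, -j}, linFac p c t := by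
  rw [phiFrom_eq_prod_linFac hc le_rfl, segment_p, outerProd,
    Finset.prod_sdiff (Finset.subset_univ _)]

theorem exists_phiFrom_mul_eq_outerProd {a : ℤ} {c j : ZMod p} (hc : 2 * c = a + 1) {s : ℕ}
    (hs : s ≤ p) (h : ∀ i < s, (i : ZMod p) + c ≠ j ∧ (i : ZMod p) + c ≠ -j) :
    ∃ Q, phiFrom (ZMod p) a 0 s * Q = outerProd p c j := by
  refine ⟨∏ t ∈ (Finset.univ \ {j, -j}) \ segment p c s, linFac p c t, ?_⟩
  rw [phiFrom_eq_prod_linFac hc hs, mul_comm, outerProd, Finset.prod_sdiff]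
  intro t ht
  obtain ⟨i, hi, rfl⟩ := Finset.mem_image.1 ht
  have := h i (Finset.mem_range.1 hi)
  simp only [Finset.mem_sdiff, Finset.mem_univ, true_and, Finset.mem_insert, Finset.mem_singleton,
    not_or]
  exact this

theorem isCoprime_phiFrom_linFac {a : ℤ} {c j : ZMod p} (hc : 2 * c = a + 1) {s : ℕ}
    (hs : s ≤ p) (h : ∀ i < s, (i : ZMod p) + c ≠ j ∧ (i : ZMod p) + c ≠ -j) :
    IsCoprime (phiFrom (ZMod p) a 0 s) (linFac p c j) := by
  rw [phiFrom_eq_prod_linFac hc hs]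
  refine IsCoprime.prod_left fun t ht => ?_
  obtain ⟨i, hi, rfl⟩ := Finset.mem_image.1 ht
  have h1 := h i (Finset.mem_range.1 hi)
  refine isCoprime_X_sub_C_of_isUnit_sub (IsUnit.mk0 _ ?_)
  rw [sub_sub_sub_cancel_right, sub_ne_zero, Ne, sq_eq_sq_iff_eq_or_eq_neg, not_or]
  exact h1

theorem prod_linFac_dvd_phiFrom {a : ℤ} {c j : ZMod p} (hc : 2 * c = a + 1) {l : ℕ} (hl : l ≤ p)
    (h1 : ∃ i < l, (i : ZMod p) + c = j) (h2 : ∃ i < l, (i : ZMod p) + c = -j) :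
    ∏ t ∈ {j, -j}, linFac p c t ∣ phiFrom (ZMod p) a 0 l := by
  rw [phiFrom_eq_prod_linFac hc hl]
  refine Finset.prod_dvd_prod_of_subset _ _ _ ?_
  obtain ⟨i, hi, h1⟩ := h1
  obtain ⟨i', hi', h2⟩ := h2
  intro t ht
  rw [Finset.mem_insert, Finset.mem_singleton] at ht
  rcases ht with rfl | rfl
  · exact Finset.mem_image.2 ⟨i, Finset.mem_range.2 hi, h1⟩
  · exact Finset.mem_image.2 ⟨i', Finset.mem_range.2 hi', h2⟩

theorem two_ne_zero_of_odd (hp2 : p ≠ 2) : (2 : ZMod p) ≠ 0 := by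
  have : ((2 : ℕ) : ZMod p) ≠ 0 := by
    rw [Ne, ZMod.natCast_eq_zero_iff]
    exact fun h => hp2 ((Nat.prime_dvd_prime_iff_eq Fact.out Nat.prime_two).1 h)
  exact_mod_cast this

theorem neg_ne_self_of_odd (hp2 : p ≠ 2) {j : ZMod p} (hj : j ≠ 0) : j ≠ -j := by
  intro h
  rw [eq_neg_iff_add_eq_zero, ← two_mul] at h
  exact (mul_ne_zero (two_ne_zero_of_odd hp2) hj) h

theorem prod_pair_linFac (hp2 : p ≠ 2) (c : ZMod p) {j : ZMod p} (hj : j ≠ 0) :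
    ∏ t ∈ {j, -j}, linFac p c t = linFac p c j ^ 2 := by
  rw [Finset.prod_pair (neg_ne_self_of_odd hp2 hj), linFac_neg, sq]

theorem prod_pair_linFac_zero (c : ZMod p) :
    ∏ t ∈ {(0 : ZMod p), -0}, linFac p c t = linFac p c 0 := by
  rw [neg_zero, Finset.pair_eq_singleton, Finset.prod_singleton]

theorem psi_div_comp (c j : ZMod p) :
    (psi p / (X - C (j ^ 2))).comp (X + C (c ^ 2)) = ∏ t ∈ Finset.univ \ {j}, linFac p c t := by
  have e : psi p = (X - C (j ^ 2)) * ∏ t ∈ Finset.univ \ {j}, (X - C (t ^ 2)) := by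
    rw [psi, ← Finset.prod_sdiff (Finset.subset_univ {j}), Finset.prod_singleton, mul_comm]
  rw [e, mul_div_cancel_left₀ _ (X_sub_C_ne_zero _), prod_comp_eq]

theorem psiShift_of_eq_zero (ε : Fin 2) {q : ℕ × ℚ} (hj : (q.2 : ZMod p) = 0) :
    psiShift p ε q = outerProd p (((q.1 : ZMod p) + 1) / 2) 0 := by
  rw [psiShift, hj, outerProd, neg_zero, Finset.pair_eq_singleton, psiE]
  by_cases hε : ε = 1
  · rw [if_pos hε, psi_div_comp]
  · rw [if_neg hε, if_pos rfl, prod_comp_eq]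

theorem psiShift_one (hp2 : p ≠ 2) {q : ℕ × ℚ} (hj : (q.2 : ZMod p) ≠ 0) :
    psiShift p 1 q = linFac p (((q.1 : ZMod p) + 1) / 2) q.2 *
      outerProd p (((q.1 : ZMod p) + 1) / 2) q.2 := by
  have hne := neg_ne_self_of_odd hp2 hj
  have e : (Finset.univ : Finset (ZMod p)) \ {(q.2 : ZMod p)} =
      insert (-(q.2 : ZMod p)) (Finset.univ \ {(q.2 : ZMod p), -(q.2 : ZMod p)}) := by
    ext t
    simp only [Finset.mem_sdiff, Finset.mem_univ, true_and, Finset.mem_insert, Finset.mem_singleton,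
      not_or]
    constructor
    · intro h
      by_cases h' : t = -(q.2 : ZMod p)
      · exact Or.inl h'
      · exact Or.inr ⟨h, h'⟩
    · rintro (rfl | h)
      · exact hne.symm
      · exact h.1
  rw [psiShift, psiE, if_pos rfl, psi_div_comp, e, Finset.prod_insert (by simp), linFac_neg,
    outerProd]

theorem psiShift_zero {q : ℕ × ℚ} (hj : (q.2 : ZMod p) ≠ 0) :
    psiShift p 0 q = 2 * (X + C ((((q.1 : ZMod p) + 1) / 2) ^ 2 + (q.2 : ZMod p) ^ 2)) *
      outerProd p (((q.1 : ZMod p) + 1) / 2) q.2 := by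
  have e : (Finset.univ : Finset (ZMod p)) \ {(q.2 : ZMod p), -(q.2 : ZMod p)} =
      insert 0 (Finset.univ \ {0, (q.2 : ZMod p), -(q.2 : ZMod p)}) := by
    ext t
    simp only [Finset.mem_sdiff, Finset.mem_univ, true_and, Finset.mem_insert, Finset.mem_singleton,
      not_or]
    constructor
    · intro h
      by_cases h' : t = 0
      · exact Or.inl h'
      · exact Or.inr ⟨h', h⟩
    · rintro (rfl | h)
      · exact ⟨hj.symm, fun h => hj (by rw [eq_comm, neg_eq_zero] at h; exact h)⟩
      · exact h.2
  rw [psiShift, psiE, if_neg (by decide), if_neg hj, outerProd, e, Finset.prod_insert (by simp),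
    linFac_zero, mul_comp, prod_comp_eq]
  simp only [mul_comp, add_comp, X_comp, C_comp, ofNat_comp, C_add]
  ring

theorem outerProd_dvd_psiShift (hp2 : p ≠ 2) (ε : Fin 2) (q : ℕ × ℚ) :
    outerProd p (((q.1 : ZMod p) + 1) / 2) q.2 ∣ psiShift p ε q := by
  by_cases hj : (q.2 : ZMod p) = 0
  · rw [psiShift_of_eq_zero ε hj, hj]
  · obtain rfl | rfl : ε = 0 ∨ ε = 1 := by omega
    · rw [psiShift_zero hj]; exact dvd_mul_left _ _
    · rw [psiShift_one hp2 hj]; exact dvd_mul_left _ _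

theorem psiShift_ne_zero (hp2 : p ≠ 2) (ε : Fin 2) (q : ℕ × ℚ) : psiShift p ε q ≠ 0 := by
  have h2 := two_ne_zero_of_odd hp2
  by_cases hj : (q.2 : ZMod p) = 0
  · rw [psiShift_of_eq_zero ε hj]
    exact outerProd_ne_zero _ _
  · obtain rfl | rfl : ε = 0 ∨ ε = 1 := by omega
    · rw [psiShift_zero hj]
      refine mul_ne_zero (mul_ne_zero ?_ (X_add_C_ne_zero _)) (outerProd_ne_zero _ _)
      rw [← C_ofNat]
      exact C_ne_zero.2 h2
    · rw [psiShift_one hp2 hj]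
      exact mul_ne_zero (linFac_ne_zero _ _) (outerProd_ne_zero _ _)

theorem bddAbove_phi_dvd {a : ℤ} {G : (ZMod p)[X]} (hG : G ≠ 0) :
    BddAbove {n : ℕ | phi p a n ∣ G} := by
  refine ⟨G.natDegree, fun n hn => ?_⟩
  have := natDegree_le_of_dvd hn hG
  rwa [phi_eq_phiFrom, natDegree_phiFrom] at this

theorem phi_nE_dvd (hp2 : p ≠ 2) (ε : Fin 2) (q : ℕ × ℚ) :
    phi p q.1 (nE p ε q) ∣ psiShift p ε q := by
  rw [nE, if_neg hp2]
  exact Nat.sSup_mem ⟨0, by simp [phi]⟩ (bddAbove_phi_dvd (psiShift_ne_zero hp2 ε q))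

theorem le_nE (hp2 : p ≠ 2) (ε : Fin 2) (q : ℕ × ℚ) {n : ℕ} (h : phi p q.1 n ∣ psiShift p ε q) :
    n ≤ nE p ε q := by
  rw [nE, if_neg hp2]
  exact le_csSup (bddAbove_phi_dvd (psiShift_ne_zero hp2 ε q)) h

end OddPolynomials

/-! ### The block of a pair, for odd `p` -/

section OddBlocks

open Polynomial

variable {p : ℕ}

theorem condAC_iff_of_odd {a j : ℕ} (hj : 2 * j < p) :
    condAC p (a, (j : ℚ)) ↔ (Even a ∧ p + 1 ≤ a + 2 * j) ∨ (Odd a ∧ 2 * j + 1 ≤ a) := by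
  have h1 : ((p : ℚ) - a + 1) / 2 ≤ j ↔ p + 1 ≤ a + 2 * j := by
    rw [div_le_iff₀ two_pos, ← Nat.cast_le (α := ℚ)]
    push_cast
    constructor <;> intro h <;> linarith
  have h2 : (j : ℚ) ≤ ((p : ℚ) - 1) / 2 := by
    rw [le_div_iff₀ two_pos]
    have : ((2 * j + 1 : ℕ) : ℚ) ≤ p := Nat.cast_le.2 hj
    push_cast at this
    linarith
  have h3 : (j : ℚ) ≤ ((a : ℚ) - 1) / 2 ↔ 2 * j + 1 ≤ a := by
    rw [le_div_iff₀ two_pos, ← Nat.cast_le (α := ℚ)]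
    push_cast
    constructor <;> intro h <;> linarith
  simp only [condAC, h1, h2, h3, and_true, Nat.cast_nonneg, true_and]

variable [Fact p.Prime]

theorem cast_add_half_eq_iff (hp2 : p ≠ 2) (a i : ℕ) (x : ℤ) :
    (i : ZMod p) + ((a : ZMod p) + 1) / 2 = x ↔ (p : ℤ) ∣ 2 * i + a + 1 - 2 * x := by
  have h2 := two_ne_zero_of_odd hp2
  rw [← ZMod.intCast_zmod_eq_zero_iff_dvd]
  push_cast
  constructor
  · intro h
    rw [← h]
    field_simp
    ring
  · intro h
    field_simp
    linear_combination h

theorem not_dvd_of_lt {x : ℤ} (h0 : x ≠ 0) (h1 : -(p : ℤ) < x) (h2 : x < 2 * p) (h3 : x ≠ p) :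
    ¬ (p : ℤ) ∣ x := by
  rintro ⟨t, rfl⟩
  have hp0 : (0 : ℤ) < p := by exact_mod_cast (Fact.out : p.Prime).pos
  have ht1 : -1 < t := by nlinarith
  have ht2 : t < 2 := by nlinarith
  obtain rfl | rfl : t = 0 ∨ t = 1 := by omega
  · exact h0 (mul_zero _)
  · exact h3 (mul_one _)

/-- The data attached to a pair: the exponent `s` (which is `0` for the types B and D) and the
cofactor `Q`. -/
theorem exists_block_of_odd (hp2 : p ≠ 2) {a j : ℕ} (ha : a < p) (hj : 2 * j < p) :
    ∃ (s : ℕ) (Q : (ZMod p)[X]), (condAC p (a, (j : ℚ)) → s = sInt p (a, (j : ℚ))) ∧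
      (¬ condAC p (a, (j : ℚ)) → s = 0) ∧ s < p ∧
      phiFrom (ZMod p) a 0 s * Q = outerProd p (((a : ZMod p) + 1) / 2) j ∧
      IsCoprime (phiFrom (ZMod p) a 0 s) (linFac p (((a : ZMod p) + 1) / 2) j) ∧
      IsGood (ZMod p) p a s Q := by
  have hodd : Odd p := (Fact.out : p.Prime).odd_of_ne_two hp2
  have hc : 2 * (((a : ZMod p) + 1) / 2) = ((a : ℤ) : ZMod p) + 1 := by
    rw [mul_div_cancel₀ _ (two_ne_zero_of_odd hp2), Int.cast_natCast]
  have e1 : (((j : ℤ)) : ZMod p) = j := Int.cast_natCast j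
  have e2 : (((-(j : ℤ) : ℤ)) : ZMod p) = -j := by push_cast; rfl
  rw [condAC_iff_of_odd hj]
  have hs : sInt p (a, (j : ℚ)) = if Even a then (p - a + 1) / 2 else (p - a) / 2 := by
    rw [sInt, if_neg hp2]
  rw [hs]
  by_cases hAC : (Even a ∧ p + 1 ≤ a + 2 * j) ∨ (Odd a ∧ 2 * j + 1 ≤ a)
  · obtain ⟨s, hs, hsp, b, hbp, hdvd, hbs, hroots⟩ : ∃ s : ℕ,
        s = (if Even a then (p - a + 1) / 2 else (p - a) / 2) ∧ s < p ∧ ∃ b : ℕ, b < p ∧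
        (p : ℤ) ∣ a + 2 * s - b ∧ b ≤ s ∧ ∀ i < s,
          ¬ (p : ℤ) ∣ 2 * i + a + 1 - 2 * j ∧ ¬ (p : ℤ) ∣ 2 * i + a + 1 - 2 * (-j) := by
      obtain ⟨n, hn⟩ := hodd
      rcases hAC with ⟨h, h'⟩ | ⟨h, h'⟩
      · rw [if_pos h]
        obtain ⟨m, hm⟩ := h
        refine ⟨_, rfl, by omega, 1, by omega, ⟨1, by omega⟩, by omega, fun i hi => ?_⟩
        exact ⟨not_dvd_of_lt (by omega) (by omega) (by omega) (by omega),
          not_dvd_of_lt (by omega) (by omega) (by omega) (by omega)⟩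
      · rw [if_neg (Nat.not_even_iff_odd.2 h)]
        obtain ⟨m, hm⟩ := h
        refine ⟨_, rfl, by omega, 0, by omega, ⟨1, by omega⟩, by omega, fun i hi => ?_⟩
        exact ⟨not_dvd_of_lt (by omega) (by omega) (by omega) (by omega),
          not_dvd_of_lt (by omega) (by omega) (by omega) (by omega)⟩
    have hroots' : ∀ i < s, (i : ZMod p) + ((a : ZMod p) + 1) / 2 ≠ j ∧
        (i : ZMod p) + ((a : ZMod p) + 1) / 2 ≠ -j := by
      intro i hi
      rw [← e2, ← e1, Ne, Ne, cast_add_half_eq_iff hp2, cast_add_half_eq_iff hp2]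
      exact hroots i hi
    obtain ⟨Q, hQ⟩ := exists_phiFrom_mul_eq_outerProd hc hsp.le hroots'
    exact ⟨s, Q, fun _ => hs, fun h => absurd hAC h, hsp, hQ,
      isCoprime_phiFrom_linFac hc hsp.le hroots', b, hbp, hdvd,
      fun l hl _ => Or.inl (by omega)⟩
  · refine ⟨0, outerProd p (((a : ZMod p) + 1) / 2) j, fun h => absurd h hAC, fun _ => rfl,
      (Fact.out : p.Prime).pos, by simp [phiFrom], by simp [phiFrom, isCoprime_one_left], a, ha,
      by simp, fun l hl hlp => Or.inr ⟨rfl, ?_⟩⟩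
    rw [phiFrom_eq_mul hc, mul_comm]
    refine mul_dvd_mul_right (prod_linFac_dvd_phiFrom hc hlp.le ?_ ?_) _
    · simp only [← e1, cast_add_half_eq_iff hp2]
      obtain ⟨n, hn⟩ := hodd
      rcases Nat.even_or_odd a with h | h
      · have : ¬ p + 1 ≤ a + 2 * j := fun h' => hAC (Or.inl ⟨h, h'⟩)
        obtain ⟨m, hm⟩ := h
        exact ⟨j + (p - a - 1) / 2, by omega, 1, by omega⟩
      · have : ¬ 2 * j + 1 ≤ a := fun h' => hAC (Or.inr ⟨h, h'⟩)
        obtain ⟨m, hm⟩ := h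
        exact ⟨j - (a + 1) / 2, by omega, 0, by omega⟩
    · simp only [← e2, cast_add_half_eq_iff hp2]
      obtain ⟨n, hn⟩ := hodd
      rcases Nat.even_or_odd a with h | h
      · have : ¬ p + 1 ≤ a + 2 * j := fun h' => hAC (Or.inl ⟨h, h'⟩)
        obtain ⟨m, hm⟩ := h
        exact ⟨(p - a - 1) / 2 - j, by omega, 1, by omega⟩
      · have : ¬ 2 * j + 1 ≤ a := fun h' => hAC (Or.inr ⟨h, h'⟩)
        obtain ⟨m, hm⟩ := h
        exact ⟨p - j - (a + 1) / 2, by omega, 2, by omega⟩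

variable (k : Type*) [Field k] [CharP k p]

theorem IsGood.map {a : ℤ} {s : ℕ} {Q : (ZMod p)[X]} (h : IsGood (ZMod p) p a s Q) :
    IsGood k p a s (Q.map (modHom k p)) := by
  obtain ⟨b, hb, hd, hl⟩ := h
  refine ⟨b, hb, hd, fun l h1 h2 => (hl l h1 h2).imp_right fun h => ⟨h.1, ?_⟩⟩
  have := Polynomial.map_dvd (modHom k p) h.2
  rwa [Polynomial.map_mul, map_phiFrom, map_phiFrom] at this

theorem IsBlock.of_zmod {a : ℤ} {s : ℕ} {Q m : (ZMod p)[X]} (hs : s < p)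
    (hfac : phiFrom (ZMod p) a 0 p = phiFrom (ZMod p) a 0 s * Q * m)
    (hcop : IsCoprime (phiFrom (ZMod p) a 0 s) m) (hgood : IsGood (ZMod p) p a s Q) :
    IsBlock k p a s (Q.map (modHom k p)) (m.map (modHom k p)) where
  lt := hs
  fac := by
    have := congrArg (Polynomial.map (modHom k p)) hfac
    rwa [Polynomial.map_mul, Polynomial.map_mul, map_phiFrom, map_phiFrom] at this
  coprime := by
    have := hcop.map (Polynomial.mapRingHom (modHom k p))
    rwa [Polynomial.coe_mapRingHom, map_phiFrom] at this
  good := hgood.map k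

theorem aeval_mul_mu (a : ℤ) (γ : k) (g : k[X]) :
    aeval (mu k p a * eT k + algebraMap k (U k) γ) g * mu k p a = elt k p a (g.comp (X + C γ)) := by
  have hcomm := algD_comm k (mu_mem_algD k p a) (aeval_eT_mem k p (X : k[X]))
  rw [aeval_X] at hcomm
  have h1 : (mu k p a * eT k + algebraMap k (U k) γ) * mu k p a =
      (eT k + algebraMap k (U k) γ) * mu k p a := by
    rw [add_mul, add_mul, hcomm, mul_assoc, mu_mul_self]
  have h2 : mu k p a * (eT k + algebraMap k (U k) γ) = (eT k + algebraMap k (U k) γ) * mu k p a := by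
    rw [mul_add, add_mul, hcomm, Algebra.commutes]
  rw [elt, aeval_comp, map_add, aeval_X, aeval_C]
  induction g using Polynomial.induction_on' with
  | add f g hf hg => rw [map_add, map_add, add_mul, add_mul, hf, hg]
  | monomial n x =>
    rw [aeval_monomial, aeval_monomial, mul_assoc, mul_assoc]
    congr 1
    induction n with
    | zero => rw [pow_zero, pow_zero]
    | succ n ih => rw [pow_succ, pow_succ, mul_assoc, h1, ← h2, ← mul_assoc, ih, mul_assoc, h2,
        mul_assoc]

theorem B₁_of_odd (hp2 : p ≠ 2) (ε : Fin 2) (q : ℕ × ℚ) :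
    B₁ k p ε q = elt k p q.1 ((psiShift p ε q).map (modHom k p)) := by
  rw [B₁, if_neg hp2, ← eT, aeval_mul_mu, psiShift, Polynomial.map_comp]
  have e : modHom k p ((((q.1 : ZMod p) + 1) / 2) ^ 2) = (((q.1 : k) + 1) / 2) ^ 2 := by
    rw [map_pow, map_div₀, map_add, map_natCast, map_one, map_ofNat]
  rw [Polynomial.map_add, map_X, map_C, e]

end OddBlocks

/-! ### The step maps of a pair, for odd `p` -/

section PairSteps

open Polynomial

/-- The index carrying the pair `q` is free: it contributes a factor `2` to the dimension. -/
def IsFree (p : ℕ) (q : ℕ × ℚ) : Prop := if p = 2 then q.1 ≠ 1 else q.2 ≠ 0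

variable (k : Type*) [Field k] (p : ℕ) [Fact p.Prime] [CharP k p]

/-- The maps `T 0`, `T 1` describe the operators `z ↦ Z^(ε)(z; q)` with `ε = 0, 1`, and have the
properties on which the induction on the number of pairs rests. -/
structure IsStep (q : ℕ × ℚ) (T : Fin 2 → U k →ₗ[k] U k) : Prop where
  Z_eq : ∀ ε, (¬ IsFree p q → ε = 0) → ∀ z, Z k p ε z q = T ε z
  B₁_eq : ∀ ε, (¬ IsFree p q → ε = 0) → B₁ k p ε q = T ε 1
  ArMod_sup : IsFree p q → ∀ r z,
    ArMod k p (r + 1) (T 0 z) = (ArMod k p r z).map (T 0) ⊔ (ArMod k p r z).map (T 1)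
  ArMod_one : IsFree p q → ∀ r z, ArMod k p (r + 1) (T 1 z) = (ArMod k p r z).map (T 1)
  indep : IsFree p q → ∀ z w, T 0 z + T 1 w = 0 → z = 0 ∧ w = 0
  ArMod_zero : ¬ IsFree p q → ∀ r z, ArMod k p (r + 1) (T 0 z) = (ArMod k p r z).map (T 0)
  injective : ¬ IsFree p q → Function.Injective (T 0)

variable {k p}

theorem IsStep.of_free {q : ℕ × ℚ} (hq : IsFree p q) {a : ℤ} {s : ℕ} {Q u : k[X]} {c : k}
    (hB : IsBlock k p a s Q ((X - C c) ^ 2)) (hu : u.eval c ≠ 0)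
    (hZ : ∀ ε z, Z k p ε z q = stepMap k p a s (if ε = 0 then u * Q else (X - C c) * Q) z)
    (hZ1 : ∀ ε, Z k p ε 1 q = B₁ k p ε q) :
    IsStep k p q fun ε => stepMap k p a s (if ε = 0 then u * Q else (X - C c) * Q) where
  Z_eq ε _ := hZ ε
  B₁_eq ε _ := by rw [← hZ1, hZ]
  ArMod_sup _ r z := hB.ArMod_stepMap_sup hu r z
  ArMod_one _ r z := hB.ArMod_stepMap_socle r z
  indep _ z w h := hB.stepMap_add_eq_zero hu h
  ArMod_zero h := absurd hq h
  injective h := absurd hq h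

theorem IsStep.of_not_free {q : ℕ × ℚ} (hq : ¬ IsFree p q) {a : ℤ} {s : ℕ} {Q : k[X]} {c : k}
    (hB : IsBlock k p a s Q (X - C c))
    (hZ : ∀ z, Z k p 0 z q = stepMap k p a s Q z) (hZ1 : Z k p 0 1 q = B₁ k p 0 q) :
    IsStep k p q fun _ => stepMap k p a s Q where
  Z_eq ε h := by rw [h hq]; exact hZ
  B₁_eq ε h := by rw [h hq, ← hZ1, hZ]
  ArMod_sup h := absurd h hq
  ArMod_one h := absurd h hq
  indep h := absurd h hq
  ArMod_zero _ r z := hB.ArMod_stepMap r z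
  injective _ := hB.stepMap_injective

variable (k p)

theorem exists_isStep_of_odd (hp2 : p ≠ 2) {q : ℕ × ℚ} (hq : q ∈ setP p) :
    ∃ T, IsStep k p q T := by
  have hodd : Odd p := (Fact.out : p.Prime).odd_of_ne_two hp2
  rw [setP, if_neg hp2] at hq
  obtain ⟨a, j'⟩ := q
  obtain ⟨ha, j, hj, rfl⟩ : a < p ∧ ∃ j : ℕ, j ≤ (p - 1) / 2 ∧ j' = j := hq
  have hj2 : 2 * j < p := by
    have := (Fact.out : p.Prime).pos
    omega
  obtain ⟨s, Q, hAC, hBD, hsp, hQ, hcop, hgood⟩ := exists_block_of_odd hp2 ha hj2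
  set c : ZMod p := ((a : ZMod p) + 1) / 2 with hc
  have hc2 : 2 * c = ((a : ℤ) : ZMod p) + 1 := by
    rw [hc, mul_div_cancel₀ _ (two_ne_zero_of_odd hp2), Int.cast_natCast]
  have hcast : (((j : ℕ) : ℚ) : ZMod p) = j := Rat.cast_natCast j
  have hnE : ∀ ε, condAC p (a, (j : ℚ)) → sInt p (a, (j : ℚ)) ≤ nE p ε (a, (j : ℚ)) := by
    intro ε h
    rw [← hAC h]
    refine le_nE hp2 ε _ ?_
    have h1 := outerProd_dvd_psiShift hp2 ε (a, (j : ℚ))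
    simp only [hcast] at h1
    rw [phi_eq_phiFrom]
    exact (Dvd.intro _ hQ).trans h1
  have hZ1 : ∀ ε, Z k p ε 1 (a, (j : ℚ)) = B₁ k p ε (a, (j : ℚ)) := fun ε =>
    Z_one k p (B₁_of_odd k hp2 ε _) (phi_nE_dvd hp2 ε _) (hnE ε)
  have hZ : ∀ (ε : Fin 2) (v : (ZMod p)[X]), psiShift p ε (a, (j : ℚ)) = v * outerProd p c j →
      ∀ z, Z k p ε z (a, (j : ℚ)) =
        stepMap k p a s (v.map (modHom k p) * Q.map (modHom k p)) z := by
    intro ε v hv z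
    have hg : phiFrom k a 0 s * (v.map (modHom k p) * Q.map (modHom k p)) =
        (psiShift p ε (a, (j : ℚ))).map (modHom k p) := by
      rw [hv, ← hQ, Polynomial.map_mul, Polynomial.map_mul, map_phiFrom]
      ring
    by_cases h : condAC p (a, (j : ℚ))
    · obtain rfl := hAC h
      exact Z_eq_stepMap k p h (B₁_of_odd k hp2 ε _) (phi_nE_dvd hp2 ε _) (hnE ε h) hsp hg z
    · obtain rfl := hBD h
      rw [show phiFrom k a 0 0 = 1 by simp [phiFrom], one_mul] at hg
      rw [hg]
      exact Z_eq_stepMap_zero k p h (B₁_of_odd k hp2 ε _) z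
  have hlin : (linFac p c j).map (modHom k p) = X - C (modHom k p (j ^ 2 - c ^ 2)) := by
    rw [linFac, Polynomial.map_sub, map_X, map_C]
  have hfac := phiFrom_eq_mul hc2 (j : ZMod p)
  by_cases hj0 : j = 0
  · subst hj0
    have hfree : ¬ IsFree p (a, ((0 : ℕ) : ℚ)) := by simp [IsFree, hp2]
    rw [Nat.cast_zero] at hfac hlin hQ hcop
    rw [prod_pair_linFac_zero, ← hQ] at hfac
    have hB := IsBlock.of_zmod k hsp hfac hcop hgood
    rw [hlin] at hB
    have hv := psiShift_of_eq_zero 0 (q := (a, ((0 : ℕ) : ℚ))) (by simp : (((0 : ℕ) : ℚ) : ZMod p) = 0)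
    have := hZ 0 1 (by rw [hv, one_mul]; simp only [Nat.cast_zero, hc])
    rw [Polynomial.map_one, one_mul] at this
    exact ⟨_, IsStep.of_not_free hfree hB this (hZ1 0)⟩
  · have hfree : IsFree p (a, (j : ℚ)) := by simp [IsFree, hp2, hj0]
    have hjp : (j : ZMod p) ≠ 0 := by
      rw [Ne, ZMod.natCast_eq_zero_iff]
      exact fun h => absurd (Nat.le_of_dvd (Nat.pos_of_ne_zero hj0) h) (by omega)
    rw [prod_pair_linFac hp2 c hjp, ← hQ] at hfac
    have hB := IsBlock.of_zmod k hsp hfac hcop.pow_right hgood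
    rw [Polynomial.map_pow, hlin] at hB
    have hv0 := psiShift_zero (p := p) (q := (a, (j : ℚ))) (by simpa using hjp)
    have hv1 := psiShift_one hp2 (q := (a, (j : ℚ))) (by simpa using hjp)
    simp only [hcast] at hv0 hv1
    have h0 := hZ 0 _ hv0
    have h1 := hZ 1 _ hv1
    rw [hlin] at h1
    refine ⟨_, IsStep.of_free hfree hB (u := (2 * (X + C (c ^ 2 + (j : ZMod p) ^ 2))).map (modHom k p))
      ?_ ?_ hZ1⟩
    · rw [eval_map, eval₂_hom, Ne, map_eq_zero]
      have h2 := two_ne_zero_of_odd hp2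
      have : eval ((j : ZMod p) ^ 2 - c ^ 2) (2 * (X + C (c ^ 2 + (j : ZMod p) ^ 2))) =
          2 * (2 * (j : ZMod p) ^ 2) := by
        simp only [eval_mul, eval_add, eval_X, eval_C, eval_ofNat]
        ring
      rw [this]
      exact mul_ne_zero h2 (mul_ne_zero h2 (pow_ne_zero 2 hjp))
    · intro ε z
      obtain rfl | rfl : ε = 0 ∨ ε = 1 := by omega
      · rw [h0, if_pos rfl]
      · rw [h1, if_neg (by decide)]

end PairSteps

/-! ### The step maps of a pair, for `p = 2` -/

section PairStepsTwo

open Polynomial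

variable (k : Type*) [Field k]

theorem Z_one_of_not_condAC (p : ℕ) [Fact p.Prime] [CharP k p] (ε : Fin 2) {q : ℕ × ℚ}
    (h : ¬ condAC p q) : Z k p ε 1 q = B₁ k p ε q := by
  rw [Z, if_neg h, Fr'_one, one_mul]

variable [Fact (Nat.Prime 2)] [CharP k 2]

/-- A double root: `φ_{0,2} = x²`. -/
theorem isStep_two_zero : ∃ T, IsStep k 2 (0, 1 / 2) T := by
  have hnot : ¬ condAC 2 (0, 1 / 2) := by
    rintro (⟨-, h, -⟩ | ⟨h, -⟩)
    · norm_num at h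
    · exact absurd h (by decide)
  have hB : IsBlock k 2 ((0 : ℕ) : ℤ) 0 1 ((X - C (0 : k)) ^ 2) := by
    refine ⟨two_pos, ?_, by simp [phiFrom, isCoprime_one_left], 0, two_pos, by simp,
      fun l h1 h3 => by omega⟩
    simp [phiFrom, Finset.prod_range_succ, one_add_one_eq_two, CharTwo.two_eq_zero, sq]
  have hB1 : ∀ ε : Fin 2, B₁ k 2 ε (0, 1 / 2) =
      elt k 2 ((0 : ℕ) : ℤ) (if ε = 0 then 1 * 1 else (X - C (0 : k)) * 1) := by
    intro ε
    obtain rfl | rfl : ε = 0 ∨ ε = 1 := by omega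
    · simp [B₁, elt]
    · have := mu_mul_dY_pow_mul_dX_pow k 2 0 1
      simp [B₁, phiFrom] at this ⊢
      exact this
  exact ⟨_, IsStep.of_free (by simp [IsFree]) hB (u := 1) (by simp)
    (fun ε z => Z_eq_stepMap_zero k 2 hnot (hB1 ε) z) fun ε => Z_one_of_not_condAC k 2 ε hnot⟩

/-- Here `φ_{1,2} = x (x - 1)`, and the factor `x` comes from `Y^s X^s` with `s = 1`. -/
theorem isStep_two_one_zero : ∃ T, IsStep k 2 (1, 0) T := by
  have hAC : condAC 2 (1, 0) := Or.inr ⟨by decide, by norm_num, by norm_num⟩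
  have hs : sInt 2 (1, 0) = 1 := by simp [sInt]
  have hn : nE 2 0 (1, 0) = 1 := by simp [nE]
  have hB : IsBlock k 2 ((1 : ℕ) : ℤ) 1 1 (X - C (1 : k)) := by
    refine ⟨one_lt_two, ?_, ?_, 1, one_lt_two, by simp, fun l h1 h3 => Or.inl (by omega)⟩
    · simp [phiFrom, Finset.prod_range_succ, one_add_one_eq_two, CharTwo.two_eq_zero]
    · simp only [phiFrom, Finset.prod_range_one]
      refine isCoprime_X_sub_C_of_isUnit_sub ?_
      simp
  have hB1 : B₁ k 2 0 (1, 0) = elt k 2 ((1 : ℕ) : ℤ) ((X : (ZMod 2)[X]).map (modHom k 2)) := by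
    have := mu_mul_dY_pow_mul_dX_pow k 2 1 1
    simp [B₁, phiFrom] at this ⊢
    exact this
  have hG : phi 2 ((1 : ℕ) : ℤ) (nE 2 0 (1, 0)) ∣ (X : (ZMod 2)[X]) := by
    rw [hn]
    simp [phi]
  refine ⟨_, IsStep.of_not_free (by simp [IsFree]) hB (fun z => ?_)
    (Z_one k 2 hB1 hG fun _ => by rw [hs, hn])⟩
  have := Z_eq_stepMap k 2 hAC hB1 hG (by rw [hs, hn]) (by rw [hs]; exact one_lt_two) (g := 1)
    (by simp [hs, phiFrom]) z
  rwa [hs] at this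

/-- Here `φ_{1,2} = x (x - 1)`, and the block is that of the root `0`. -/
theorem isStep_two_one_one : ∃ T, IsStep k 2 (1, 1) T := by
  have h2 : (2 : k) = 0 := by exact_mod_cast CharP.cast_eq_zero k 2
  have hnot : ¬ condAC 2 (1, 1) := by
    rintro (⟨h, -⟩ | ⟨-, -, h⟩)
    · exact absurd h (by decide)
    · norm_num at h
  have hphi : phiFrom k ((1 : ℕ) : ℤ) 0 2 = X * (X - C 1) := by
    simp [phiFrom, Finset.prod_range_succ, one_add_one_eq_two, CharTwo.two_eq_zero]
  have hB : IsBlock k 2 ((1 : ℕ) : ℤ) 0 (X - C (1 : k)) (X - C 0) := by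
    refine ⟨two_pos, ?_, by simp [phiFrom, isCoprime_one_left], 1, one_lt_two, by simp,
      fun l h1 h3 => Or.inr ⟨rfl, ?_⟩⟩
    · rw [hphi, phiFrom, Finset.prod_range_zero, C_0, sub_zero, one_mul, mul_comm]
    · obtain rfl : l = 1 := by omega
      rw [hphi]
      simp [phiFrom]
  have hB1 : B₁ k 2 0 (1, 1) = elt k 2 ((1 : ℕ) : ℤ) (X - C 1) := by
    have h3 : (X - C 1 : k[X]) = X + 1 := by
      rw [sub_eq_add_neg, ← C_neg, show (-1 : k) = 1 by linear_combination -h2, C_1]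
    have := mu_mul_dY_pow_mul_dX_pow k 2 1 1
    rw [h3, elt_add, elt_one]
    simp [B₁, phiFrom] at this ⊢
    exact this
  exact ⟨_, IsStep.of_not_free (by simp [IsFree]) hB
    (fun z => Z_eq_stepMap_zero k 2 hnot hB1 z) (Z_one_of_not_condAC k 2 0 hnot)⟩

end PairStepsTwo

/-! ### Induction on the number of pairs -/

section Induction

variable (k : Type*) [Field k] (p : ℕ) [Fact p.Prime] [CharP k p]

theorem exists_isStep {q : ℕ × ℚ} (hq : q ∈ setP p) : ∃ T, IsStep k p q T := by
  by_cases hp2 : p = 2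
  · subst hp2
    rw [setP, if_pos rfl] at hq
    rcases hq with rfl | rfl | rfl
    · exact isStep_two_zero k
    · exact isStep_two_one_zero k
    · exact isStep_two_one_one k
  · exact exists_isStep_of_odd k p hp2 hq

theorem mem_setX_iff (p : ℕ) {r : ℕ} (q : Fin r → ℕ × ℚ) (ε : Fin r → Fin 2) :
    ε ∈ setX p q ↔ ∀ i, ¬ IsFree p (q i) → ε i = 0 := by
  by_cases hp2 : p = 2 <;> simp [setX, IsFree, hp2]

theorem cons_mem_setX_iff (p : ℕ) {r : ℕ} (q : Fin (r + 1) → ℕ × ℚ) (d : Fin 2)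
    (θ : Fin r → Fin 2) : (Fin.cons d θ : Fin (r + 1) → Fin 2) ∈ setX p q ↔
      (¬ IsFree p (q 0) → d = 0) ∧ θ ∈ setX p (Fin.tail q) := by
  rw [mem_setX_iff, mem_setX_iff, Fin.forall_fin_succ]
  rfl

theorem le_cons_iff {r : ℕ} (ε : Fin (r + 1) → Fin 2) (d : Fin 2) (θ : Fin r → Fin 2) :
    ε ≤ (Fin.cons d θ : Fin (r + 1) → Fin 2) ↔ ε 0 ≤ d ∧ Fin.tail ε ≤ θ := by
  rw [Pi.le_def, Pi.le_def, Fin.forall_fin_succ]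
  rfl

variable {k p}

theorem B_cons {r : ℕ} {q : Fin (r + 1) → ℕ × ℚ} {T : Fin 2 → U k →ₗ[k] U k}
    (hT : IsStep k p (q 0) T) {d : Fin 2} (hd : ¬ IsFree p (q 0) → d = 0) (θ : Fin r → Fin 2) :
    B k p (r + 1) (Fin.cons d θ) q = T d (B k p r θ (Fin.tail q)) := by
  cases r with
  | zero => exact hT.B₁_eq d hd
  | succ r => exact hT.Z_eq d hd _

/-- The elements `B^(θ)` with `θ ≥ ε` for `r + 1` pairs come from those for `r` pairs, by the step maps
of the first pair. -/
theorem image_B_succ {r : ℕ} {q : Fin (r + 1) → ℕ × ℚ} {T : Fin 2 → U k →ₗ[k] U k}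
    (hT : IsStep k p (q 0) T) (ε : Fin (r + 1) → Fin 2) (x : U k) :
    x ∈ (fun θ => B k p (r + 1) θ q) '' {θ | θ ∈ setX p q ∧ ε ≤ θ} ↔
      ∃ d, ((¬ IsFree p (q 0) → d = 0) ∧ ε 0 ≤ d) ∧ x ∈ T d ''
        ((fun θ => B k p r θ (Fin.tail q)) '' {θ | θ ∈ setX p (Fin.tail q) ∧ Fin.tail ε ≤ θ}) := by
  constructor
  · rintro ⟨θ, ⟨h1, h2⟩, rfl⟩
    rw [← Fin.cons_self_tail θ] at h1 h2 ⊢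
    rw [cons_mem_setX_iff] at h1
    rw [le_cons_iff] at h2
    exact ⟨θ 0, ⟨h1.1, h2.1⟩, _, ⟨_, ⟨h1.2, h2.2⟩, rfl⟩, (B_cons hT h1.1 _).symm⟩
  · rintro ⟨d, ⟨h1, h2⟩, _, ⟨θ, ⟨h3, h4⟩, rfl⟩, rfl⟩
    exact ⟨Fin.cons d θ, ⟨(cons_mem_setX_iff p q d θ).2 ⟨h1, h3⟩, (le_cons_iff ε d θ).2 ⟨h2, h4⟩⟩,
      B_cons hT h1 _⟩

variable (k p)

theorem ArMod_B_eq_span (r : ℕ) (q : Fin r → ℕ × ℚ) (hq : ∀ i, q i ∈ setP p) {ε : Fin r → Fin 2}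
    (hε : ε ∈ setX p q) : ArMod k p r (B k p r ε q) =
      Submodule.span k ((fun θ => B k p r θ q) '' {θ | θ ∈ setX p q ∧ ε ≤ θ}) := by
  induction r with
  | zero =>
    have hB : ∀ θ, B k p 0 θ q = 1 := fun θ => rfl
    apply le_antisymm
    · intro x hx
      obtain ⟨w, hw, rfl⟩ := (mem_ArMod k p).1 hx
      rw [hB, mul_one]
      rw [mem_Ar_iff] at hw
      refine pbwSpan_induction k (C := fun w => w ∈ Submodule.span k _) (zero_mem _)
        (fun _ _ => add_mem) (fun c _ h => Submodule.smul_mem _ c h) ?_ w hw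
      rintro m n m' ⟨h1, h2, h3⟩
      change m = m' at h1
      change m < p ^ 0 at h2
      change n < p ^ 0 at h3
      rw [pow_zero, Nat.lt_one_iff] at h2 h3
      subst h1 h2 h3
      rw [show bin 0 0 = 1 from intPoly_ext fun n => by simp, map_one, dX_zero, dY_zero, mul_one,
        mul_one]
      exact Submodule.subset_span ⟨ε, ⟨hε, le_rfl⟩, rfl⟩
    · refine Submodule.span_le.2 ?_
      rintro _ ⟨θ, -, rfl⟩
      exact (mem_ArMod k p).2 ⟨1, one_mem _, by rw [one_mul, hB]; rfl⟩
  | succ r ih =>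
    obtain ⟨T, hT⟩ := exists_isStep k p (hq 0)
    obtain ⟨d, ε', rfl⟩ : ∃ d ε', ε = Fin.cons d ε' := ⟨ε 0, Fin.tail ε, (Fin.cons_self_tail ε).symm⟩
    have hset := image_B_succ (k := k) hT (Fin.cons d ε')
    rw [cons_mem_setX_iff] at hε
    have ih' := ih (Fin.tail q) (fun i => hq i.succ) hε.2
    rw [B_cons hT hε.1]
    simp only [Fin.tail_cons, Fin.cons_zero] at hset
    by_cases hf : IsFree p (q 0)
    · obtain rfl | rfl : d = 0 ∨ d = 1 := by omega
      · rw [hT.ArMod_sup hf, ih', Submodule.map_span, Submodule.map_span, ← Submodule.span_union]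
        congr 1
        ext x
        rw [hset, Fin.exists_fin_two]
        simp [hf]
      · rw [hT.ArMod_one hf, ih', Submodule.map_span]
        congr 1
        ext x
        rw [hset, Fin.exists_fin_two]
        simp [hf]
    · obtain rfl := hε.1 hf
      rw [hT.ArMod_zero hf, ih', Submodule.map_span]
      congr 1
      ext x
      rw [hset, Fin.exists_fin_two]
      simp [hf]

theorem eq_zero_of_sum_smul_B (r : ℕ) (q : Fin r → ℕ × ℚ) (hq : ∀ i, q i ∈ setP p)
    (c : (Fin r → Fin 2) → k) (hc : ∀ θ, θ ∉ setX p q → c θ = 0)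
    (h : ∑ θ, c θ • B k p r θ q = 0) (θ : Fin r → Fin 2) : c θ = 0 := by
  induction r with
  | zero =>
    have h3 := Ev_dY_hp_dX k 0 0 0 0 1
    rw [map_one, dX_zero, dY_zero, mul_one, mul_one, if_pos ⟨rfl, rfl⟩] at h3
    rw [Fintype.sum_unique, show ∀ θ, B k p 0 θ q = 1 from fun _ => rfl] at h
    have h4 := congrFun (congrArg (Ev k 0 0) h) 0
    rw [map_smul, h3] at h4
    simp only [Pi.smul_apply, val_one, Int.cast_one, smul_eq_mul, mul_one, map_zero,
      Pi.zero_apply] at h4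
    exact (congrArg c (Subsingleton.elim _ _)).trans h4
  | succ r ih =>
    obtain ⟨T, hT⟩ := exists_isStep k p (hq 0)
    have hq' : ∀ i, Fin.tail q i ∈ setP p := fun i => hq i.succ
    have hc' : ∀ d, ∀ θ, θ ∉ setX p (Fin.tail q) → c (Fin.cons d θ) = 0 := fun d θ hθ =>
      hc _ fun h => hθ ((cons_mem_setX_iff p q d θ).1 h).2
    have hsum : ∀ f : (Fin (r + 1) → Fin 2) → U k, ∑ θ, f θ =
        ∑ θ : Fin r → Fin 2, f (Fin.cons 0 θ) + ∑ θ : Fin r → Fin 2, f (Fin.cons 1 θ) := by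
      intro f
      rw [← (Fin.consEquiv fun _ : Fin (r + 1) => Fin 2).sum_comp f, Fintype.sum_prod_type,
        Fin.sum_univ_two]
      rfl
    have hT' : ∀ d : Fin 2, (¬ IsFree p (q 0) → d = 0) →
        ∑ θ : Fin r → Fin 2, c (Fin.cons d θ) • B k p (r + 1) (Fin.cons d θ) q =
          T d (∑ θ : Fin r → Fin 2, c (Fin.cons d θ) • B k p r θ (Fin.tail q)) := by
      intro d hd
      rw [map_sum]
      refine Finset.sum_congr rfl fun θ _ => ?_
      rw [map_smul, B_cons hT hd]
    rw [hsum, hT' 0 fun _ => rfl] at h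
    obtain ⟨d, θ', rfl⟩ : ∃ d θ', θ = Fin.cons d θ' := ⟨θ 0, Fin.tail θ, (Fin.cons_self_tail θ).symm⟩
    by_cases hf : IsFree p (q 0)
    · rw [hT' 1 fun h => absurd hf h] at h
      obtain ⟨h0, h1⟩ := hT.indep hf _ _ h
      obtain rfl | rfl : d = 0 ∨ d = 1 := by omega
      · exact ih _ hq' (fun θ => c (Fin.cons 0 θ)) (hc' 0) h0 θ'
      · exact ih _ hq' (fun θ => c (Fin.cons 1 θ)) (hc' 1) h1 θ'
    · have hz : ∀ θ : Fin r → Fin 2, c (Fin.cons 1 θ) = 0 := fun θ =>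
        hc _ fun h => absurd (((cons_mem_setX_iff p q 1 θ).1 h).1 hf) (by decide)
      obtain rfl | rfl : d = 0 ∨ d = 1 := by omega
      · rw [Finset.sum_eq_zero (s := Finset.univ) (f := fun θ : Fin r → Fin 2 =>
          c (Fin.cons 1 θ) • B k p (r + 1) (Fin.cons 1 θ) q)
          (fun θ _ => by rw [hz, zero_smul]), add_zero] at h
        have h0 := hT.injective hf (h.trans (map_zero _).symm)
        exact ih _ hq' (fun θ => c (Fin.cons 0 θ)) (hc' 0) h0 θ'
      · exact hz θ'

theorem linearIndepOn_B (r : ℕ) (q : Fin r → ℕ × ℚ) (hq : ∀ i, q i ∈ setP p) :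
    LinearIndepOn k (fun θ => B k p r θ q) (setX p q) := by
  rw [linearIndepOn_iff]
  intro l hl h
  have h' : ∑ θ, l θ • B k p r θ q = 0 := by
    rw [← h, Finsupp.linearCombination_apply]
    exact (Finsupp.sum_fintype l (fun θ a => a • B k p r θ q) fun _ => zero_smul k _).symm
  ext θ
  exact eq_zero_of_sum_smul_B k p r q hq l
    (fun θ hθ => Finsupp.notMem_support_iff.1 fun h => hθ (hl h)) h' θ

theorem exists_basis_of_eq_span {V ι : Type*} [AddCommGroup V] [Module k V] {v : ι → V}
    (hv : LinearIndependent k v) {N : Submodule k V} (hN : N = Submodule.span k (Set.range v)) :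
    ∃ b : Module.Basis ι k N, ∀ i, (b i : V) = v i := by
  subst hN
  exact ⟨Module.Basis.span hv, fun i => congrArg Subtype.val (Module.Basis.span_apply hv i)⟩

open Classical in
theorem ncard_setX (p : ℕ) {r : ℕ} (q : Fin r → ℕ × ℚ) : (setX p q).ncard = 2 ^ wt p q := by
  have h : setX p q = (Fintype.piFinset fun i =>
      if IsFree p (q i) then (Finset.univ : Finset (Fin 2)) else {0} : Finset (Fin r → Fin 2)) := by
    ext ε
    rw [mem_setX_iff, Finset.mem_coe, Fintype.mem_piFinset]
    refine forall_congr' fun i => ?_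
    split_ifs with hi <;> simp [hi]
  have hw : wt p q = (Finset.univ.filter fun i => IsFree p (q i)).card := by
    by_cases hp2 : p = 2 <;> simp [wt, IsFree, hp2]
  rw [h, Set.ncard_coe_finset, Fintype.card_piFinset, hw, ← Finset.prod_const, Finset.prod_filter]
  refine Finset.prod_congr rfl fun i _ => ?_
  split_ifs <;> simp

end Induction

end
end SL2Hyper

open SL2Hyper in
theorem theorem3p8 (p : ℕ) [Fact p.Prime] (k : Type*) [Field k] [IsAlgClosed k] [CharP k p]
    (r : ℕ) (hr : 0 < r) (q : Fin r → ℕ × ℚ) (hq : ∀ i, q i ∈ setP p) :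
    (∀ ε ∈ setX p q,
      ∃ b : Module.Basis {θ : Fin r → Fin 2 // θ ∈ setX p q ∧ ε ≤ θ} k
          (ArMod k p r (B k p r ε q)),
        ∀ θ, (b θ : U k) = B k p r θ q) ∧
    Module.finrank k (ArMod k p r (E k p r q)) = 2 ^ wt p q ∧
    ∃ b : Module.Basis {θ : Fin r → Fin 2 // θ ∈ setX p q} k (ArMod k p r (E k p r q)),
      ∀ θ, (b θ : U k) = B k p r θ q := by
  have hli := linearIndepOn_B k p r q hq
  have hE : ∃ b : Module.Basis {θ : Fin r → Fin 2 // θ ∈ setX p q} k (ArMod k p r (E k p r q)),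
      ∀ θ, (b θ : U k) = B k p r θ q := by
    refine exists_basis_of_eq_span k hli ?_
    rw [E, ArMod_B_eq_span k p r q hq ((mem_setX_iff p q _).2 fun _ _ => rfl)]
    congr 1
    ext x
    simp [Pi.le_def]
  refine ⟨fun ε hε => ?_, ?_, hE⟩
  · refine exists_basis_of_eq_span k
      (hli.mono (t := {θ | θ ∈ setX p q ∧ ε ≤ θ}) fun θ h => h.1) ?_
    rw [ArMod_B_eq_span k p r q hq hε, Set.image_eq_range]
  · obtain ⟨b, -⟩ := hE
    rw [Module.finrank_eq_nat_card_basis b, ← ncard_setX]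
    rfl
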